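/- **Setting.** Let $\boldsymbol X=\{X_\ell\}_{\ell=1}^{q}$, $X_\ell\in\mathbb R^{m_\ell\times n_\ell}$, with $\|\boldsymbol X\|^2=\sum_\ell\|X_\ell\|_F^2$, and let $f(\boldsymbol X)=\mathbb E_\xi[F(\boldsymbol X;\xi)]$ be bounded below, $f^*=\inf f$. Assume: (1) for every $\xi$, $F(\cdot;\xi)$ is differentiable and $\|\nabla F(\boldsymbol X;\xi)-\nabla F(\boldsymbol Y;\xi)\|\le L\|\boldsymbol X-\boldsymbol Y\|$ for all $\boldsymbol X,\boldsymbol Y$ (with $L>0$); moreover $\mathbb E[\nabla F(\boldsymbol X;\xi)]=\nabla f(\boldsymbol X)$ and $\mathbb E\|\nabla F(\boldsymbol X;\xi)-\nabla f(\boldsymbol X)\|^2\le\sigma^2$ for all $\boldsymbol X$; (2) $\boldsymbol V=\{V_\ell\}$, $V_\ell\in\mathbb R^{n_\ell\times r_\ell}$, is drawn from a distribution with $V_\ell^{\mathsf T}V_\ell=n_\ell I$ almost surely and $\mathbb E[V_\ell V_\ell^{\mathsf T}]=r_\ell I$ for each $\ell$. Let $\nu,K\ge1$ and $T=K\nu$.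 LOZO with step size $\alpha$ and smoothing $\epsilon$ starts at a deterministic $\boldsymbol X^0$ and iterates, for $t\ge 0$ and $k=\lfloor t/\nu\rfloor$, $$X_\ell^{t+1}=X_\ell^t-\alpha\,\frac{F(\{X^t_j+\epsilon U^t_j(V^{(k)}_j)^{\mathsf T}\}_j;\xi^t)-F(\{X^t_j-\epsilon U^t_j(V^{(k)}_j)^{\mathsf T}\}_j;\xi^t)}{2\epsilon}\cdot\frac{U^t_\ell (V^{(k)}_\ell)^{\mathsf T}}{r_\ell},$$ where the $U^t_\ell\in\mathbb R^{m_\ell\times r_\ell}$ have independent standard normal entries, the $\boldsymbol V^{(k)}$ have the distribution in (2), the $\xi^t$ are copies of $\xi$, and all the $\boldsymbol U^t$, $\boldsymbol V^{(k)}$, $\xi^t$ are mutually independent. Put $\Delta_0=f(\boldsymbol X^0)-f^*$. **Theorem.** (a) One layer ($q=1$; sizes $m,n,r$). If $\alpha,\epsilon>0$ and $\alpha\le\frac1{144Lmn\nu}$, then $$\frac1K\sum_{k=0}^{K-1}\mathbb E\|\nabla f(X^{k\nu})\|^2\le\frac{8\Delta_0}{T\alpha}+\frac{56Lmn^2\sigma^2\alpha}{r}+\frac{16Lmnr\epsilon^2}{\nu\alpha}.$$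 If moreover $\Delta_0>0$, then for $\epsilon=\sqrt{\frac{\Delta_0\nu}{16TLmnr}}$ and $\alpha=\Big(144Lmn\nu+\sqrt{\frac{56TLmn^2\sigma^2}{9\Delta_0r}}\Big)^{-1}$, $$\frac1K\sum_{k=0}^{K-1}\mathbb E\|\nabla f(X^{k\nu})\|^2\le16\sqrt{\frac1T\Big(\frac{7\Delta_0Lmn^2\sigma^2}{r}\Big)}+\frac{2592\,\Delta_0Lmn\nu}{T}.$$ (b) Any number of layers. Let $\tilde d=\sum_\ell m_\ell n_\ell^2/r_\ell$ and $d=\sum_\ell m_\ell n_\ell$. For every $\rho$ there is a constant $C$, depending only on $\rho$, such that whenever $r_\ell\le\rho\,r_{\ell'}$ for all $\ell,\ell'$ and $\Delta_0>0$, there are $\alpha,\epsilon>0$, depending only on $L,\sigma,\Delta_0,K,\nu$ and the sizes $m_\ell,n_\ell,r_\ell$, for which $$\frac1K\sum_{k=0}^{K-1}\mathbb E\|\nabla f(\boldsymbol X^{k\nu})\|^2\le C\Big(\sqrt{\frac{\Delta_0L\tilde d\sigma^2}{T}}+\frac{\Delta_0Ld\nu}{T}\Big).$$ (When all ranks $r_\ell$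 are equal, $C$ is an absolute constant.) -/

import Mathlib

open MeasureTheory ProbabilityTheory
open scoped BigOperators

noncomputable section

namespace LOZO

/-- Matrices with the given numbers of rows and columns, one for each of the `q` layers.  Written
as a plain function type, so that it carries the product σ-algebra and the product measures. -/
abbrev Blocks {q : ℕ} (rows cols : Fin q → ℕ) : Type :=
  ∀ l : Fin q, Fin (rows l) → Fin (cols l) → ℝ

/-- The `l`-th matrix of a family of blocks. -/
abbrev Blocks.mat {q : ℕ} {rows cols : Fin q → ℕ} (A : Blocks rows cols) (l : Fin q) :
    Matrix (Fin (rows l)) (Fin (cols l)) ℝ :=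
  Matrix.of (A l)

/-- The space of weights: all the entries of all the layers, with the Euclidean inner product.  Its
norm is the square root of the sum over the layers of the squared Frobenius norms. -/
abbrev Weights {q : ℕ} (m n : Fin q → ℕ) : Type :=
  EuclideanSpace ℝ ((l : Fin q) × (Fin (m l) × Fin (n l)))

/-- A family of matrices as an element of the space of weights. -/
def Weights.ofMat {q : ℕ} {m n : Fin q → ℕ}
    (A : ∀ l : Fin q, Matrix (Fin (m l)) (Fin (n l)) ℝ) : Weights m n :=
  WithLp.toLp 2 fun e => A e.1 e.2.1 e.2.2

/-- The direction `U Vᵀ`, layer by layer. -/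
def direction {q : ℕ} {m n r : Fin q → ℕ} (U : Blocks m r) (V : Blocks n r) : Weights m n :=
  Weights.ofMat fun l => U.mat l * (V.mat l).transpose

/-- The direction `U Vᵀ / r`, layer by layer. -/
def scaledDirection {q : ℕ} {m n r : Fin q → ℕ} (U : Blocks m r) (V : Blocks n r) :
    Weights m n :=
  Weights.ofMat fun l => ((r l : ℝ)⁻¹) • (U.mat l * (V.mat l).transpose)

/-- The low-rank zeroth-order gradient estimator
`(F(X + ε U Vᵀ; ξ) - F(X - ε U Vᵀ; ξ)) / (2 ε) * (U Vᵀ / r)`. -/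
def lge {q : ℕ} {m n r : Fin q → ℕ} {Ξ : Type*} (F : Weights m n → Ξ → ℝ) (ε : ℝ)
    (X : Weights m n) (U : Blocks m r) (V : Blocks n r) (ξ : Ξ) : Weights m n :=
  ((F (X + ε • direction U V) ξ - F (X - ε • direction U V) ξ) / (2 * ε)) •
    scaledDirection U V

/-- The LOZO iterates with step size `α`, smoothing `ε` and sampling interval `ν`, started at `X₀`
and driven by the sequences `U`, `V`, `ξ`; step `t` uses `U t`, `ξ t` and `V k` with
`k = ⌊t / ν⌋`. -/
def iterate {q : ℕ} {m n r : Fin q → ℕ} {Ξ : Type*} (F : Weights m n → Ξ → ℝ) (α ε : ℝ) (ν : ℕ)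
    (X₀ : Weights m n) (U : ℕ → Blocks m r) (V : ℕ → Blocks n r) (ξ : ℕ → Ξ) : ℕ → Weights m n
  | 0 => X₀
  | t + 1 =>
      iterate F α ε ν X₀ U V ξ t -
        α • lge F ε (iterate F α ε ν X₀ U V ξ t) (U t) (V (t / ν)) (ξ t)

/-- The objective `f(X) = E_ξ F(X; ξ)`, where `ξ` has law `D`. -/
def objective {q : ℕ} {m n : Fin q → ℕ} {Ξ : Type*} [MeasurableSpace Ξ]
    (F : Weights m n → Ξ → ℝ) (D : Measure Ξ) (X : Weights m n) : ℝ :=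
  ∫ z, F X z ∂D

/-- The initial gap `Δ₀ = f(X₀) - inf f`. -/
def initialGap {q : ℕ} {m n : Fin q → ℕ} {Ξ : Type*} [MeasurableSpace Ξ]
    (F : Weights m n → Ξ → ℝ) (D : Measure Ξ) (X₀ : Weights m n) : ℝ :=
  objective F D X₀ - ⨅ X, objective F D X

/-- The loss is differentiable in the weights for each `ξ`, its gradient is `L`-Lipschitz uniformly
in `ξ`, and the stochastic gradient is unbiased with variance at most `σ²`. -/
structure IsSmoothStochastic {q : ℕ} {m n : Fin q → ℕ} {Ξ : Type*} [MeasurableSpace Ξ]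
    (F : Weights m n → Ξ → ℝ) (D : Measure Ξ) (L σ : ℝ) : Prop where
  measurable : ∀ X, Measurable (F X)
  integrable : ∀ X, Integrable (F X) D
  differentiable : ∀ z, Differentiable ℝ fun X => F X z
  lipschitz : ∀ z X Y,
    ‖gradient (fun W => F W z) X - gradient (fun W => F W z) Y‖ ≤ L * ‖X - Y‖
  grad_integrable : ∀ X, Integrable (fun z => gradient (fun W => F W z) X) D
  unbiased : ∀ X, ∫ z, gradient (fun W => F W z) X ∂D = gradient (objective F D) X
  sq_integrable : ∀ X,
    Integrable (fun z => ‖gradient (fun W => F W z) X - gradient (objective F D) X‖ ^ 2) D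
  variance_le : ∀ X,
    ∫ z, ‖gradient (fun W => F W z) X - gradient (objective F D) X‖ ^ 2 ∂D ≤ σ ^ 2

/-- A law `Q` of `V` such that, in every layer, `Vᵀ V = n I` almost surely and
`E[V Vᵀ] = r I` (entrywise). -/
structure IsSubspaceLaw {q : ℕ} {n r : Fin q → ℕ} (Q : Measure (Blocks n r)) : Prop where
  gram : ∀ᵐ V ∂Q, ∀ l, (V.mat l).transpose * V.mat l =
    (n l : ℝ) • (1 : Matrix (Fin (r l)) (Fin (r l)) ℝ)
  second_moment : ∀ l (i j : Fin (n l)),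
    ∫ V, (V.mat l * (V.mat l).transpose) i j ∂Q =
      ((r l : ℝ) • (1 : Matrix (Fin (n l)) (Fin (n l)) ℝ)) i j

/-- The law of a family of matrices all of whose entries are independent standard normal. -/
def gaussianLaw {q : ℕ} (m r : Fin q → ℕ) : Measure (Blocks m r) :=
  Measure.pi fun _ => Measure.pi fun _ => Measure.pi fun _ => gaussianReal 0 1

/-- The random input of the algorithm: every `U t` has independent standard normal entries, every
`V k` has law `Q`, every `ξ t` has law `D`, and all of these are mutually independent. -/
structure IsSampling {q : ℕ} {m n r : Fin q → ℕ} {Ξ Ω : Type*} [MeasurableSpace Ξ]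
    [MeasurableSpace Ω] (P : Measure Ω) (D : Measure Ξ) (Q : Measure (Blocks n r))
    (U : ℕ → Ω → Blocks m r) (V : ℕ → Ω → Blocks n r) (ξ : ℕ → Ω → Ξ) : Prop where
  measurable_U : ∀ t, Measurable (U t)
  measurable_V : ∀ k, Measurable (V k)
  measurable_ξ : ∀ t, Measurable (ξ t)
  law_U : ∀ t, P.map (U t) = gaussianLaw m r
  law_V : ∀ k, P.map (V k) = Q
  law_ξ : ∀ t, P.map (ξ t) = D
  indep : iIndep
    (Sum.elim (fun t : ℕ => MeasurableSpace.comap (U t) inferInstance)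
      (Sum.elim (fun k : ℕ => MeasurableSpace.comap (V k) inferInstance)
        (fun t : ℕ => MeasurableSpace.comap (ξ t) inferInstance))) P

/-- The random variable `‖∇f(X^{kν})‖²` along the LOZO iterates. -/
def gradSq {q : ℕ} {m n r : Fin q → ℕ} {Ξ Ω : Type*} [MeasurableSpace Ξ]
    (F : Weights m n → Ξ → ℝ) (D : Measure Ξ) (α ε : ℝ) (ν : ℕ) (X₀ : Weights m n)
    (U : ℕ → Ω → Blocks m r) (V : ℕ → Ω → Blocks n r) (ξ : ℕ → Ω → Ξ) (k : ℕ) (ω : Ω) : ℝ :=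
  ‖gradient (objective F D)
    (iterate F α ε ν X₀ (fun t => U t ω) (fun j => V j ω) (fun t => ξ t ω) (k * ν))‖ ^ 2

/-- `(1/K) ∑_{k < K} E‖∇f(X^{kν})‖² ≤ R`, all these expectations being finite. -/
def AvgGradSqLe {q : ℕ} {m n r : Fin q → ℕ} {Ξ Ω : Type*} [MeasurableSpace Ξ]
    [MeasurableSpace Ω] (P : Measure Ω)
    (F : Weights m n → Ξ → ℝ) (D : Measure Ξ) (α ε : ℝ) (ν K : ℕ) (X₀ : Weights m n)
    (U : ℕ → Ω → Blocks m r) (V : ℕ → Ω → Blocks n r) (ξ : ℕ → Ω → Ξ) (R : ℝ) : Prop :=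
  (∀ k < K, Integrable (gradSq F D α ε ν X₀ U V ξ k) P) ∧
    (1 / (K : ℝ)) * ∑ k ∈ Finset.range K, ∫ ω, gradSq F D α ε ν X₀ U V ξ k ω ∂P ≤ R

end LOZO

end

noncomputable section

namespace LOZO

/-! ### Moments of Gaussian variables -/

/-! Fix the subspace matrices V. Since ⟨G, U Vᵀ⟩ = ⟨G V, U⟩, the estimator is an ordinary Gaussian
two-point estimator in the variable U, and its mean given V is G V Vᵀ / r up to a smoothing bias.
Inside a block the right size of a gradient is therefore the quadratic form `projSq V G` = ∑ ‖G_l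
V_l‖² / r_l. Its mean over V is ‖G‖² (`integral_projSq`), and it never exceeds d‖G‖² with d = `dim m
n` (`projSq_le`).

The difficulty is that V is kept for ν steps, so the later iterates X of a block depend on V and
averaging over V is not available for them. Every quantity is therefore compared with its value at
the start Y of the block, which is independent of V, at the price of a multiple of d L²‖X - Y‖². The
stochastic gradient can be compared in the same way because F(·; ξ) has a Lipschitz gradient for
each ξ. Hence the noise also enters only at Y, where its projected size averages to at most σ²
instead of the worst case d σ².

Two one-step inequalities carry the proof: the descent of f (`Admissible.integral_objective_le`) and
the growth of ‖X - Y‖² (`Admissible.integral_norm_sub_sq_le`). The growth factor is 1 + O(1/ν), so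
over a block it costs only a constant (`le_of_drift_recursion`), and the step-size restriction lets
the descent absorb the drift (`step_with_drift`). Averaging over V gives `IsSampling.block_descent`,
and telescoping gives `IsSampling.avgGradSqLe`.

The smoothing error uses only the quadratic Taylor bound for F(·; ξ) and Gaussian moments of order
2, 4 and 6. The noise term obtained is of order L α d σ²; the form with m n² / r is weaker, because
the Gram condition forces r ≤ n. -/

lemma integral_pow_gaussianReal (v : NNReal) :
    (∫ x, x ^ 2 ∂gaussianReal 0 v = v) ∧ (∫ x, x ^ 4 ∂gaussianReal 0 v = 3 * v ^ 2) ∧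
      (∫ x, x ^ 6 ∂gaussianReal 0 v = 15 * v ^ 3) := by
  have hmom : ∀ n : ℕ, ∫ x, x ^ n ∂gaussianReal 0 v =
      iteratedDeriv n (fun t : ℝ => Real.exp (v * t ^ 2 / 2)) 0 := by
    intro n
    have h := iteratedDeriv_mgf_zero (X := fun x : ℝ => x) (μ := gaussianReal 0 v)
      (by simp [integrableExpSet_fun_id_gaussianReal]) n
    rw [mgf_fun_id_gaussianReal] at h
    simpa using h.symm
  set E : ℝ → ℝ := fun t => Real.exp (v * t ^ 2 / 2) with hE
  -- Every derivative of the moment generating function `E` is a polynomial times `E`.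
  -- Differentiating replaces the polynomial p by p' + v t p, and the moments are the constant
  -- terms.
  have key : ∀ p p' : ℝ → ℝ, (∀ t, HasDerivAt p (p' t) t) →
      deriv (fun t => p t * E t) = fun t => (p' t + v * t * p t) * E t := by
    intro p p' hp
    ext t
    have h1 : HasDerivAt E (E t * (v * t)) t := by
      have : HasDerivAt (fun t : ℝ => (v : ℝ) * t ^ 2 / 2) (v * t) t := by
        have := (((hasDerivAt_id t).pow 2).const_mul (v : ℝ)).div_const 2
        refine this.congr_deriv ?_
        simp
        ring
      exact this.exp
    refine ((hp t).mul h1).deriv.trans ?_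
    ring
  have e1 : deriv E = fun t => (v * t) * E t := by
    have := key (fun _ => 1) (fun _ => 0) (fun t => hasDerivAt_const t 1)
    simpa using this
  have poly : ∀ a0 a1 a2 a3 a4 a5 a6 : ℝ, ∀ t : ℝ,
      HasDerivAt (fun t : ℝ => a0 + a1 * t + a2 * t ^ 2 + a3 * t ^ 3 + a4 * t ^ 4 + a5 * t ^ 5
        + a6 * t ^ 6)
      (a1 + 2 * a2 * t + 3 * a3 * t ^ 2 + 4 * a4 * t ^ 3 + 5 * a5 * t ^ 4 + 6 * a6 * t ^ 5) t := by
    intro a0 a1 a2 a3 a4 a5 a6 t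
    have := (((((((hasDerivAt_const t a0).add ((hasDerivAt_id t).const_mul a1)).add
      (((hasDerivAt_id t).pow 2).const_mul a2)).add (((hasDerivAt_id t).pow 3).const_mul a3)).add
      (((hasDerivAt_id t).pow 4).const_mul a4)).add (((hasDerivAt_id t).pow 5).const_mul a5)).add
      (((hasDerivAt_id t).pow 6).const_mul a6))
    refine this.congr_deriv ?_
    simp
    ring
  have e2 : deriv (fun t => (v * t) * E t) = fun t => (v + v ^ 2 * t ^ 2) * E t := by
    have := key _ _ (poly 0 v 0 0 0 0 0)
    ring_nf at this ⊢
    exact this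
  have e3 : deriv (fun t => (v + v ^ 2 * t ^ 2) * E t) =
      fun t => (3 * v ^ 2 * t + v ^ 3 * t ^ 3) * E t := by
    have := key _ _ (poly v 0 (v ^ 2) 0 0 0 0)
    ring_nf at this ⊢
    exact this
  have e4 : deriv (fun t => (3 * v ^ 2 * t + v ^ 3 * t ^ 3) * E t) =
      fun t => (3 * v ^ 2 + 6 * v ^ 3 * t ^ 2 + v ^ 4 * t ^ 4) * E t := by
    have := key _ _ (poly 0 (3 * v ^ 2) 0 (v ^ 3) 0 0 0)
    ring_nf at this ⊢
    exact this
  have e5 : deriv (fun t => (3 * v ^ 2 + 6 * v ^ 3 * t ^ 2 + v ^ 4 * t ^ 4) * E t) =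
      fun t => (15 * v ^ 3 * t + 10 * v ^ 4 * t ^ 3 + v ^ 5 * t ^ 5) * E t := by
    have := key _ _ (poly (3 * v ^ 2) 0 (6 * v ^ 3) 0 (v ^ 4) 0 0)
    ring_nf at this ⊢
    exact this
  have e6 : deriv (fun t => (15 * v ^ 3 * t + 10 * v ^ 4 * t ^ 3 + v ^ 5 * t ^ 5) * E t) =
      fun t => (15 * v ^ 3 + 45 * v ^ 4 * t ^ 2 + 15 * v ^ 5 * t ^ 4 + v ^ 6 * t ^ 6) * E t := by
    have := key _ _ (poly 0 (15 * v ^ 3) 0 (10 * v ^ 4) 0 (v ^ 5) 0)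
    ring_nf at this ⊢
    exact this
  refine ⟨?_, ?_, ?_⟩
  · rw [hmom]
    simp only [iteratedDeriv_succ', iteratedDeriv_zero, e1, e2]
    simp [hE]
  · rw [hmom]
    simp only [iteratedDeriv_succ', iteratedDeriv_zero, e1, e2, e3, e4]
    simp [hE]
  · rw [hmom]
    simp only [iteratedDeriv_succ', iteratedDeriv_zero, e1, e2, e3, e4, e5, e6]
    simp [hE]

/-- Characteristic functions multiply over a product measure. The general index allows three uses,
one for each nested product in `gaussianLaw`: columns, rows, layers. -/
lemma map_sum_pi_eq_gaussianReal {ι : Type*} [Fintype ι] {α : ι → Type*}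
    [∀ i, MeasurableSpace (α i)] (μ : ∀ i, Measure (α i)) [∀ i, IsProbabilityMeasure (μ i)]
    (φ : ∀ i, α i → ℝ) (hφ : ∀ i, Measurable (φ i)) (v : ι → NNReal)
    (h : ∀ i, (μ i).map (φ i) = gaussianReal 0 (v i)) :
    (Measure.pi μ).map (fun x => ∑ i, φ i (x i)) = gaussianReal 0 (∑ i, v i) := by
  have hm : Measurable fun x : ∀ i, α i => ∑ i, φ i (x i) :=
    Finset.measurable_sum _ fun i _ => (hφ i).comp (measurable_pi_apply i)
  have := Measure.isProbabilityMeasure_map (μ := Measure.pi μ) hm.aemeasurable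
  refine Measure.ext_of_charFun ?_
  ext t
  rw [charFun_apply_real, integral_map hm.aemeasurable (by fun_prop)]
  have hfac : ∀ i, ∫ x, Complex.exp (t * (φ i x : ℝ) * Complex.I) ∂μ i =
      charFun (gaussianReal 0 (v i)) t := by
    intro i
    rw [← h i, charFun_apply_real, integral_map (hφ i).aemeasurable (by fun_prop)]
  have hprod : ∀ x : ∀ i, α i, Complex.exp (t * ((∑ i, φ i (x i) : ℝ) : ℂ) * Complex.I) =
      ∏ i, Complex.exp (t * (φ i (x i) : ℝ) * Complex.I) := by
    intro x
    rw [← Complex.exp_sum]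
    push_cast
    rw [Finset.mul_sum, Finset.sum_mul]
  simp_rw [hprod]
  rw [integral_fintype_prod_eq_prod (𝕜 := ℂ)
    (f := fun i x => Complex.exp (t * (φ i x : ℝ) * Complex.I))]
  simp_rw [hfac, charFun_gaussianReal]
  rw [← Complex.exp_sum]
  congr 1
  push_cast
  simp [Finset.sum_mul, Finset.sum_div]

/-- A random vector all of whose linear functionals are centred Gaussian with variance the squared
norm of the functional. -/
structure IsStdGaussian {ι Ω : Type*} [Fintype ι] [MeasurableSpace Ω]
    (u : Ω → EuclideanSpace ℝ ι) (μ : Measure Ω) : Prop where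
  measurable : Measurable u
  map_inner : ∀ a, μ.map (fun ω => inner ℝ a (u ω)) = gaussianReal 0 (‖a‖₊ ^ 2)

namespace IsStdGaussian

variable {ι Ω : Type*} [Fintype ι] [MeasurableSpace Ω] {u : Ω → EuclideanSpace ℝ ι} {μ : Measure Ω}

lemma measurable_inner (h : IsStdGaussian u μ) (a : EuclideanSpace ℝ ι) :
    Measurable fun ω => inner ℝ a (u ω) :=
  measurable_const.inner h.measurable

lemma integrable_inner_pow (h : IsStdGaussian u μ) (a : EuclideanSpace ℝ ι) (n : ℕ) :
    Integrable (fun ω => inner ℝ a (u ω) ^ n) μ := by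
  have h1 : Integrable (fun x : ℝ => x ^ n) (μ.map fun ω => inner ℝ a (u ω)) := by
    rw [h.map_inner]
    rcases Nat.eq_zero_or_pos n with rfl | hn
    · simp
    · have := (memLp_id_gaussianReal (μ := 0) (v := ‖a‖₊ ^ 2) (n : NNReal)).integrable_norm_pow
        (p := n) (by omega)
      refine this.mono' (by fun_prop) (Filter.Eventually.of_forall fun x => ?_)
      simp
  exact h1.comp_measurable (h.measurable_inner a)

lemma integral_inner_pow (h : IsStdGaussian u μ) (a : EuclideanSpace ℝ ι) :
    (∫ ω, inner ℝ a (u ω) ^ 2 ∂μ = ‖a‖ ^ 2) ∧ (∫ ω, inner ℝ a (u ω) ^ 4 ∂μ = 3 * ‖a‖ ^ 4) ∧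
      (∫ ω, inner ℝ a (u ω) ^ 6 ∂μ = 15 * ‖a‖ ^ 6) := by
  have key : ∀ n : ℕ, ∫ ω, inner ℝ a (u ω) ^ n ∂μ = ∫ x, x ^ n ∂gaussianReal 0 (‖a‖₊ ^ 2) := by
    intro n
    rw [← h.map_inner, integral_map (h.measurable_inner a).aemeasurable (by fun_prop)]
  obtain ⟨h2, h4, h6⟩ := integral_pow_gaussianReal (‖a‖₊ ^ 2)
  refine ⟨?_, ?_, ?_⟩
  · rw [key, h2]; simp
  · rw [key, h4]; push_cast; simp; ring
  · rw [key, h6]; push_cast; simp; ring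

/-- Polarization: the covariance is read off from the second moments of the functionals a + b and a
- b. -/
lemma inner_mul_inner (h : IsStdGaussian u μ) (a b : EuclideanSpace ℝ ι) :
    Integrable (fun ω => inner ℝ a (u ω) * inner ℝ b (u ω)) μ ∧
      ∫ ω, inner ℝ a (u ω) * inner ℝ b (u ω) ∂μ = inner ℝ a b := by
  have heq : (fun ω => inner ℝ a (u ω) * inner ℝ b (u ω)) =
      fun ω => (1 / 4) * (inner ℝ (a + b) (u ω) ^ 2 - inner ℝ (a - b) (u ω) ^ 2) := by
    ext ω
    rw [inner_add_left, inner_sub_left]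
    ring
  have i1 := h.integrable_inner_pow (a + b) 2
  have i2 := h.integrable_inner_pow (a - b) 2
  rw [heq]
  refine ⟨(i1.sub i2).const_mul _, ?_⟩
  rw [integral_const_mul, integral_sub i1 i2, (h.integral_inner_pow _).1,
    (h.integral_inner_pow _).1, norm_add_sq_real, norm_sub_sq_real]
  ring

lemma coord_eq [DecidableEq ι] (x : EuclideanSpace ℝ ι) (i : ι) :
    x i = inner ℝ (EuclideanSpace.single i (1 : ℝ)) x := by
  simp [EuclideanSpace.inner_single_left]

lemma coord (h : IsStdGaussian u μ) (i : ι) :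
    (∀ n : ℕ, Integrable (fun ω => u ω i ^ n) μ) ∧ (∫ ω, u ω i ^ 2 ∂μ = 1) ∧
      (∫ ω, u ω i ^ 4 ∂μ = 3) ∧ (∫ ω, u ω i ^ 6 ∂μ = 15) := by
  classical
  simp_rw [coord_eq _ i]
  refine ⟨h.integrable_inner_pow _, ?_⟩
  simpa using h.integral_inner_pow (EuclideanSpace.single i (1 : ℝ))

lemma measurable_coord (h : IsStdGaussian u μ) (i : ι) : Measurable fun ω => u ω i := by
  classical
  simp_rw [coord_eq _ i]
  exact h.measurable_inner _

lemma measurable_weighted (h : IsStdGaussian u μ) (w : ι → ℝ) :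
    Measurable fun ω => ∑ i, w i * u ω i ^ 2 :=
  Finset.measurable_sum _ fun i _ => ((h.measurable_coord i).pow_const 2).const_mul _

end IsStdGaussian

/-- Jensen's inequality for the power n + 1 with normalized weights; total weight zero is trivial
but must be split off. -/
lemma sum_mul_pow_le {ι : Type*} [Fintype ι] (w z : ι → ℝ) (hw : ∀ i, 0 ≤ w i) (hz : ∀ i, 0 ≤ z i)
    (n : ℕ) : (∑ i, w i * z i) ^ (n + 1) ≤ (∑ i, w i) ^ n * ∑ i, w i * z i ^ (n + 1) := by
  set W := ∑ i, w i with hW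
  have hW0 : 0 ≤ W := Finset.sum_nonneg fun i _ => hw i
  rcases hW0.eq_or_lt with h0 | hpos
  · have hw0 : ∀ i, w i = 0 := fun i =>
      (Finset.sum_eq_zero_iff_of_nonneg fun i _ => hw i).1 h0.symm i (Finset.mem_univ i)
    simp [hw0]
  · have := Real.pow_arith_mean_le_arith_mean_pow Finset.univ (fun i => w i / W) z
      (fun i _ => div_nonneg (hw i) hW0) (by rw [← Finset.sum_div, ← hW, div_self hpos.ne'])
      (fun i _ => hz i) (n + 1)
    simp_rw [div_mul_eq_mul_div] at this
    rw [← Finset.sum_div, ← Finset.sum_div, div_pow, div_le_div_iff₀ (by positivity) hpos] at this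
    have h2 : (∑ i, w i * z i) ^ (n + 1) * W ≤
        (W ^ n * ∑ i, w i * z i ^ (n + 1)) * W := by
      calc _ ≤ _ := this
        _ = _ := by ring
    exact le_of_mul_le_mul_right h2 hpos

namespace IsStdGaussian

variable {ι Ω : Type*} [Fintype ι] [MeasurableSpace Ω] {u : Ω → EuclideanSpace ℝ ι} {μ : Measure Ω}

/-- Jensen reduces the square to fourth moments of single coordinates, so independence of the
coordinates is not needed; 3 is the fourth moment of a standard normal. The cubic analogue below has
the sixth moment 15. -/
lemma weighted_sq (h : IsStdGaussian u μ) (w : ι → ℝ) (hw : ∀ i, 0 ≤ w i) :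
    Integrable (fun ω => (∑ i, w i * u ω i ^ 2) ^ 2) μ ∧
      ∫ ω, (∑ i, w i * u ω i ^ 2) ^ 2 ∂μ ≤ 3 * (∑ i, w i) ^ 2 := by
  have hb : ∀ ω, (∑ i, w i * u ω i ^ 2) ^ 2 ≤ (∑ i, w i) * ∑ i, w i * u ω i ^ 4 := by
    intro ω
    have := sum_mul_pow_le w (fun i => u ω i ^ 2) hw (fun i => sq_nonneg _) 1
    simpa [← pow_mul] using this
  have hi : Integrable (fun ω => (∑ i, w i) * ∑ i, w i * u ω i ^ 4) μ :=
    (integrable_finsetSum _ fun i _ => ((h.coord i).1 4).const_mul _).const_mul _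
  have hint : Integrable (fun ω => (∑ i, w i * u ω i ^ 2) ^ 2) μ :=
    hi.mono' ((h.measurable_weighted w).pow_const 2).aestronglyMeasurable
      (Filter.Eventually.of_forall fun ω => by
        rw [Real.norm_of_nonneg (sq_nonneg _)]; exact hb ω)
  refine ⟨hint, (integral_mono hint hi hb).trans_eq ?_⟩
  rw [integral_const_mul, integral_finsetSum _ fun i _ => ((h.coord i).1 4).const_mul _]
  simp_rw [integral_const_mul, (h.coord _).2.2.1]
  rw [← Finset.sum_mul]
  ring

lemma weighted_cube (h : IsStdGaussian u μ) (w : ι → ℝ) (hw : ∀ i, 0 ≤ w i) :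
    Integrable (fun ω => (∑ i, w i * u ω i ^ 2) ^ 3) μ ∧
      ∫ ω, (∑ i, w i * u ω i ^ 2) ^ 3 ∂μ ≤ 15 * (∑ i, w i) ^ 3 := by
  have hb : ∀ ω, (∑ i, w i * u ω i ^ 2) ^ 3 ≤ (∑ i, w i) ^ 2 * ∑ i, w i * u ω i ^ 6 := by
    intro ω
    have := sum_mul_pow_le w (fun i => u ω i ^ 2) hw (fun i => sq_nonneg _) 2
    simpa [← pow_mul] using this
  have hi : Integrable (fun ω => (∑ i, w i) ^ 2 * ∑ i, w i * u ω i ^ 6) μ :=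
    (integrable_finsetSum _ fun i _ => ((h.coord i).1 6).const_mul _).const_mul _
  have hint : Integrable (fun ω => (∑ i, w i * u ω i ^ 2) ^ 3) μ :=
    hi.mono' ((h.measurable_weighted w).pow_const 3).aestronglyMeasurable
      (Filter.Eventually.of_forall fun ω => by
        rw [Real.norm_of_nonneg (pow_nonneg (Finset.sum_nonneg fun i _ =>
          mul_nonneg (hw i) (sq_nonneg _)) _)]
        exact hb ω)
  refine ⟨hint, (integral_mono hint hi hb).trans_eq ?_⟩
  rw [integral_const_mul, integral_finsetSum _ fun i _ => ((h.coord i).1 6).const_mul _]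
  simp_rw [integral_const_mul, (h.coord _).2.2.2]
  rw [← Finset.sum_mul]
  ring

/-- Young's inequality, balanced by ‖a‖², separates the two factors into fourth powers. Each half
contributes (3/2)‖a‖² per unit of weight, again without using a joint law. -/
lemma inner_sq_mul_weighted (h : IsStdGaussian u μ) (w : ι → ℝ) (hw : ∀ i, 0 ≤ w i)
    (a : EuclideanSpace ℝ ι) :
    Integrable (fun ω => inner ℝ a (u ω) ^ 2 * ∑ i, w i * u ω i ^ 2) μ ∧
      ∫ ω, inner ℝ a (u ω) ^ 2 * ∑ i, w i * u ω i ^ 2 ∂μ ≤ 3 * ‖a‖ ^ 2 * ∑ i, w i := by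
  rcases eq_or_ne a 0 with rfl | ha
  · simp
  have hna : 0 < ‖a‖ ^ 2 := by positivity
  have hb : ∀ ω, inner ℝ a (u ω) ^ 2 * ∑ i, w i * u ω i ^ 2 ≤
      ∑ i, w i * ((2 * ‖a‖ ^ 2)⁻¹ * inner ℝ a (u ω) ^ 4 + ‖a‖ ^ 2 / 2 * u ω i ^ 4) := by
    intro ω
    rw [Finset.mul_sum]
    refine Finset.sum_le_sum fun i _ => ?_
    have : inner ℝ a (u ω) ^ 2 * u ω i ^ 2 ≤
        (2 * ‖a‖ ^ 2)⁻¹ * inner ℝ a (u ω) ^ 4 + ‖a‖ ^ 2 / 2 * u ω i ^ 4 := by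
      have h0 : (2 * ‖a‖ ^ 2)⁻¹ * (inner ℝ a (u ω) ^ 2 - ‖a‖ ^ 2 * u ω i ^ 2) ^ 2 =
          (2 * ‖a‖ ^ 2)⁻¹ * inner ℝ a (u ω) ^ 4 + ‖a‖ ^ 2 / 2 * u ω i ^ 4 -
            inner ℝ a (u ω) ^ 2 * u ω i ^ 2 := by
        field_simp
        ring
      have h1 : 0 ≤ (2 * ‖a‖ ^ 2)⁻¹ * (inner ℝ a (u ω) ^ 2 - ‖a‖ ^ 2 * u ω i ^ 2) ^ 2 := by
        positivity
      linarith
    calc _ = w i * (inner ℝ a (u ω) ^ 2 * u ω i ^ 2) := by ring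
      _ ≤ _ := mul_le_mul_of_nonneg_left this (hw i)
  have hterm : ∀ i, Integrable (fun ω => w i * ((2 * ‖a‖ ^ 2)⁻¹ * inner ℝ a (u ω) ^ 4 +
      ‖a‖ ^ 2 / 2 * u ω i ^ 4)) μ := fun i =>
    (((h.integrable_inner_pow a 4).const_mul _).add (((h.coord i).1 4).const_mul _)).const_mul _
  have hi := integrable_finsetSum Finset.univ fun i _ => hterm i
  have hint : Integrable (fun ω => inner ℝ a (u ω) ^ 2 * ∑ i, w i * u ω i ^ 2) μ :=
    hi.mono' (((h.measurable_inner a).pow_const 2).mul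
      (h.measurable_weighted w)).aestronglyMeasurable
      (Filter.Eventually.of_forall fun ω => by
        rw [Real.norm_of_nonneg (mul_nonneg (sq_nonneg _) (Finset.sum_nonneg fun i _ =>
          mul_nonneg (hw i) (sq_nonneg _)))]
        exact hb ω)
  refine ⟨hint, (integral_mono hint hi hb).trans_eq ?_⟩
  rw [integral_finsetSum _ fun i _ => hterm i]
  have : ∀ i, ∫ ω, w i * ((2 * ‖a‖ ^ 2)⁻¹ * inner ℝ a (u ω) ^ 4 + ‖a‖ ^ 2 / 2 * u ω i ^ 4) ∂μ =
      w i * (3 * ‖a‖ ^ 2) := by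
    intro i
    rw [integral_const_mul, integral_add ((h.integrable_inner_pow a 4).const_mul _)
      (((h.coord i).1 4).const_mul _), integral_const_mul, integral_const_mul,
      (h.coord i).2.2.1, (h.integral_inner_pow a).2.1]
    field_simp
    ring
  simp_rw [this]
  rw [← Finset.sum_mul]
  ring

end IsStdGaussian

/-- The entries of a family of blocks as a vector. -/
def flatten {q : ℕ} {m r : Fin q → ℕ} (U : Blocks m r) : Weights m r :=
  Weights.ofMat fun l => U.mat l

instance {q : ℕ} (m r : Fin q → ℕ) : IsProbabilityMeasure (gaussianLaw m r) := by
  unfold gaussianLaw; infer_instance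

lemma flatten_apply {q : ℕ} {m r : Fin q → ℕ} (U : Blocks m r)
    (e : (l : Fin q) × (Fin (m l) × Fin (r l))) : flatten U e = U e.1 e.2.1 e.2.2 := rfl

lemma measurable_flatten {q : ℕ} {m r : Fin q → ℕ} :
    Measurable (flatten : Blocks m r → Weights m r) := by
  refine (PiLp.continuous_toLp 2 _).measurable.comp (measurable_pi_iff.2 fun e => ?_)
  simp only [Blocks.mat, Matrix.of_apply]
  fun_prop

lemma isStdGaussian_flatten {q : ℕ} (m r : Fin q → ℕ) :
    IsStdGaussian (flatten : Blocks m r → Weights m r) (gaussianLaw m r) where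
  measurable := measurable_flatten
  map_inner a := by
    have h0 : ∀ l i j, (gaussianReal 0 1).map (fun x => a ⟨l, i, j⟩ * x) =
        gaussianReal 0 (‖a ⟨l, i, j⟩‖₊ ^ 2) := by
      intro l i j
      rw [gaussianReal_map_const_mul]
      congr 1
      · simp
      · ext; simp
    have h1 := fun l i => map_sum_pi_eq_gaussianReal (fun _ : Fin (r l) => gaussianReal 0 1)
      (fun j x => a ⟨l, i, j⟩ * x) (fun j => measurable_id.const_mul _) _ (h0 l i)
    have h2 := fun l => map_sum_pi_eq_gaussianReal
      (fun _ : Fin (m l) => Measure.pi fun _ : Fin (r l) => gaussianReal 0 1)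
      (fun i (x : Fin (r l) → ℝ) => ∑ j, a ⟨l, i, j⟩ * x j)
      (fun i => by fun_prop) _ (h1 l)
    have h3 := map_sum_pi_eq_gaussianReal
      (fun l : Fin q => Measure.pi fun _ : Fin (m l) => Measure.pi fun _ : Fin (r l) =>
        gaussianReal 0 1)
      (fun l (x : Fin (m l) → Fin (r l) → ℝ) => ∑ i, ∑ j, a ⟨l, i, j⟩ * x i j)
      (fun i => by fun_prop) _ h2
    have e1 : (fun U : Blocks m r => inner ℝ a (flatten U)) =
        fun U : Blocks m r => ∑ l, ∑ i, ∑ j, a ⟨l, i, j⟩ * U l i j := by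
      ext U
      simp only [PiLp.inner_apply, Fintype.sum_sigma, Fintype.sum_prod_type, flatten_apply]
      simp [mul_comm]
    rw [e1, gaussianLaw, h3]
    congr 1
    ext
    simp [EuclideanSpace.norm_sq_eq, Fintype.sum_sigma, Fintype.sum_prod_type]

/-! ### The low-rank projection -/

section Projection

variable {q : ℕ} {m n r : Fin q → ℕ}

/-- The matrices `G V`, layer by layer. -/
def proj (V : Blocks n r) (G : Weights m n) : Weights m r :=
  WithLp.toLp 2 fun e => ∑ k, G ⟨e.1, e.2.1, k⟩ * V e.1 k e.2.2

/-- The matrices `G V / r`, layer by layer. -/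
def scaledProj (V : Blocks n r) (G : Weights m n) : Weights m r :=
  WithLp.toLp 2 fun e => (r e.1 : ℝ)⁻¹ * proj V G e

/-- The quadratic form `∑ ‖G V‖² / r`. -/
def projSq (V : Blocks n r) (G : Weights m n) : ℝ :=
  ∑ e, (r e.1 : ℝ)⁻¹ * proj V G e ^ 2

lemma proj_apply (V : Blocks n r) (G : Weights m n) (e) :
    proj V G e = ∑ k, G ⟨e.1, e.2.1, k⟩ * V e.1 k e.2.2 := rfl

lemma scaledProj_apply (V : Blocks n r) (G : Weights m n) (e) :
    scaledProj V G e = (r e.1 : ℝ)⁻¹ * proj V G e := rfl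

lemma direction_apply (U : Blocks m r) (V : Blocks n r) (e) :
    direction U V e = ∑ j, U e.1 e.2.1 j * V e.1 e.2.2 j := by
  simp [direction, Weights.ofMat, Matrix.mul_apply]

lemma scaledDirection_apply (U : Blocks m r) (V : Blocks n r) (e) :
    scaledDirection U V e = (r e.1 : ℝ)⁻¹ * direction U V e := by
  simp [direction, scaledDirection, Weights.ofMat]

lemma proj_add (V : Blocks n r) (G H : Weights m n) : proj V (G + H) = proj V G + proj V H := by
  ext e
  simp [proj_apply, add_mul, Finset.sum_add_distrib]

lemma inner_eq_sum (G H : Weights m n) : inner ℝ G H = ∑ e, G e * H e := by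
  simp [PiLp.inner_apply, mul_comm]

lemma norm_sq_eq_sum (G : Weights m n) : ‖G‖ ^ 2 = ∑ e, G e ^ 2 := by
  simp [EuclideanSpace.norm_sq_eq]

/-- The map G ↦ G V is adjoint to U ↦ U Vᵀ. This turns directional derivatives along the random
matrix into linear functionals of a standard Gaussian vector. -/
lemma inner_direction (G : Weights m n) (U : Blocks m r) (V : Blocks n r) :
    inner ℝ G (direction U V) = inner ℝ (proj V G) (flatten U) := by
  simp_rw [inner_eq_sum, direction_apply, proj_apply, flatten_apply, Fintype.sum_sigma,
    Fintype.sum_prod_type, Finset.mul_sum, Finset.sum_mul]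
  refine Finset.sum_congr rfl fun l _ => Finset.sum_congr rfl fun i _ => ?_
  change ∑ k : Fin (n l), ∑ j : Fin (r l), G ⟨l, (i, k)⟩ * (U l i j * V l k j) =
    ∑ j : Fin (r l), ∑ k : Fin (n l), G ⟨l, (i, k)⟩ * V l k j * U l i j
  refine Finset.sum_comm.trans ?_
  exact Finset.sum_congr rfl fun j _ => Finset.sum_congr rfl fun k _ => by ring

lemma inner_scaledDirection (G : Weights m n) (U : Blocks m r) (V : Blocks n r) :
    inner ℝ G (scaledDirection U V) = inner ℝ (scaledProj V G) (flatten U) := by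
  simp_rw [inner_eq_sum, scaledDirection_apply, scaledProj_apply, direction_apply, proj_apply,
    flatten_apply, Fintype.sum_sigma, Fintype.sum_prod_type, Finset.mul_sum, Finset.sum_mul]
  refine Finset.sum_congr rfl fun l _ => Finset.sum_congr rfl fun i _ => ?_
  change ∑ k : Fin (n l), ∑ j : Fin (r l), G ⟨l, (i, k)⟩ * ((r l : ℝ)⁻¹ * (U l i j * V l k j)) =
    ∑ j : Fin (r l), ∑ k : Fin (n l), (r l : ℝ)⁻¹ * (G ⟨l, (i, k)⟩ * V l k j) * U l i j
  refine Finset.sum_comm.trans ?_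
  exact Finset.sum_congr rfl fun j _ => Finset.sum_congr rfl fun k _ => by ring

lemma sum_sq_sum_mul {ι κ : Type*} [Fintype ι] [Fintype κ] (u : ι → ℝ) (A : κ → ι → ℝ) :
    ∑ k, (∑ j, u j * A k j) ^ 2 = ∑ j, ∑ j', u j * u j' * ∑ k, A k j * A k j' := by
  simp_rw [sq, Finset.sum_mul_sum, Finset.mul_sum]
  rw [Finset.sum_comm]
  refine Finset.sum_congr rfl fun j _ => ?_
  rw [Finset.sum_comm]
  exact Finset.sum_congr rfl fun j' _ => Finset.sum_congr rfl fun k _ => by ring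

/-- The columns of every layer are orthogonal with squared norm the number of rows. -/
def IsGram (V : Blocks n r) : Prop :=
  ∀ l, (V.mat l).transpose * V.mat l = (n l : ℝ) • (1 : Matrix (Fin (r l)) (Fin (r l)) ℝ)

lemma IsGram.sum_mul {V : Blocks n r} (hV : IsGram V) (l : Fin q) (j j' : Fin (r l)) :
    ∑ k, V l k j * V l k j' = if j = j' then (n l : ℝ) else 0 := by
  have := congrFun (congrFun (hV l) j) j'
  simpa [Matrix.mul_apply, Matrix.one_apply] using this

lemma IsGram.row_sq {V : Blocks n r} (hV : IsGram V) (l : Fin q) (u : Fin (r l) → ℝ) :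
    ∑ k, (∑ j, u j * V l k j) ^ 2 = n l * ∑ j, u j ^ 2 := by
  rw [sum_sq_sum_mul u (fun k j => V l k j)]
  simp_rw [hV.sum_mul]
  simp only [mul_ite, mul_zero, Finset.sum_ite_eq, Finset.mem_univ, if_true, Finset.mul_sum]
  exact Finset.sum_congr rfl fun j _ => by ring

lemma IsGram.norm_direction_sq {V : Blocks n r} (hV : IsGram V) (U : Blocks m r) :
    ‖direction U V‖ ^ 2 =
      ∑ e : (l : Fin q) × (Fin (m l) × Fin (r l)), (n e.1 : ℝ) * flatten U e ^ 2 := by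
  simp_rw [norm_sq_eq_sum, direction_apply, flatten_apply, Fintype.sum_sigma,
    Fintype.sum_prod_type]
  simp_rw [hV.row_sq, Finset.mul_sum]

lemma IsGram.norm_scaledDirection_sq {V : Blocks n r} (hV : IsGram V) (U : Blocks m r) :
    ‖scaledDirection U V‖ ^ 2 = ∑ e : (l : Fin q) × (Fin (m l) × Fin (r l)),
      (n e.1 : ℝ) * ((r e.1 : ℝ)⁻¹ ^ 2 * flatten U e ^ 2) := by
  simp_rw [norm_sq_eq_sum, scaledDirection_apply, mul_pow, direction_apply, flatten_apply,
    Fintype.sum_sigma, Fintype.sum_prod_type]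
  refine Finset.sum_congr rfl fun l _ => Finset.sum_congr rfl fun i _ => ?_
  change ∑ k : Fin (n l), (r l : ℝ)⁻¹ ^ 2 * (∑ j : Fin (r l), U l i j * V l k j) ^ 2 =
    ∑ j : Fin (r l), (n l : ℝ) * ((r l : ℝ)⁻¹ ^ 2 * U l i j ^ 2)
  rw [← Finset.mul_sum, hV.row_sq, Finset.mul_sum, Finset.mul_sum]
  exact Finset.sum_congr rfl fun j _ => by ring

/-- The Gram matrix is invertible of size r and factors through a space of dimension n. This is what
allows m n to be replaced by m n² / r in the final bounds. -/
lemma IsGram.rank_le {V : Blocks n r} (hV : IsGram V) (hn : ∀ l, 0 < n l) (l : Fin q) :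
    r l ≤ n l := by
  have h1 : ((V.mat l).transpose * V.mat l).rank = r l := by
    have hn' : (n l : ℝ) ≠ 0 := by have := hn l; positivity
    rw [hV l, Matrix.rank_of_isUnit, Fintype.card_fin]
    rw [← Algebra.algebraMap_eq_smul_one]
    exact (IsUnit.mk0 _ hn').map _
  calc r l = ((V.mat l).transpose * V.mat l).rank := h1.symm
    _ ≤ (V.mat l).rank := Matrix.rank_mul_le_right _ _
    _ ≤ _ := (Matrix.rank_le_card_height _).trans_eq (Fintype.card_fin _)

lemma projSq_nonneg (V : Blocks n r) (G : Weights m n) : 0 ≤ projSq V G :=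
  Finset.sum_nonneg fun _ _ => by positivity

lemma projSq_eq_inner (V : Blocks n r) (G : Weights m n) :
    projSq V G = inner ℝ (proj V G) (scaledProj V G) := by
  rw [inner_eq_sum, projSq]
  exact Finset.sum_congr rfl fun e _ => by rw [scaledProj_apply]; ring

lemma projSq_add_le (V : Blocks n r) (G H : Weights m n) :
    projSq V (G + H) ≤ 2 * projSq V G + 2 * projSq V H := by
  simp_rw [projSq, Finset.mul_sum, ← Finset.sum_add_distrib]
  refine Finset.sum_le_sum fun e _ => ?_
  rw [proj_add, PiLp.add_apply]
  have h : (0 : ℝ) ≤ (r e.1 : ℝ)⁻¹ * (proj V G e - proj V H e) ^ 2 := by positivity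
  nlinarith

lemma projSq_add_add_le (V : Blocks n r) (G H I : Weights m n) :
    projSq V (G + H + I) ≤ 3 * (projSq V G + projSq V H + projSq V I) := by
  simp_rw [projSq, mul_add, Finset.mul_sum, ← Finset.sum_add_distrib]
  refine Finset.sum_le_sum fun e _ => ?_
  rw [proj_add, proj_add, PiLp.add_apply, PiLp.add_apply]
  set a := proj V G e
  set b := proj V H e
  set c := proj V I e
  have h : (0 : ℝ) ≤ (r e.1 : ℝ)⁻¹ * ((a - b) ^ 2 + (b - c) ^ 2 + (a - c) ^ 2) := by positivity
  nlinarith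

/-- `R` and `ρ` bound the ranks from above and below. -/
structure RankBounds (r : Fin q → ℕ) (R ρ : ℝ) : Prop where
  pos : ∀ l, 0 < r l
  le : ∀ l, (r l : ℝ) ≤ R
  ge : ∀ l, R ≤ ρ * r l
  R_pos : 0 < R
  one_le : 1 ≤ ρ

lemma RankBounds.inv_le {R ρ : ℝ} (h : RankBounds r R ρ) (l : Fin q) : (r l : ℝ)⁻¹ ≤ ρ / R := by
  have h1 : (0 : ℝ) < r l := by exact_mod_cast h.pos l
  rw [inv_eq_one_div, div_le_div_iff₀ h1 h.R_pos]
  linarith [h.ge l]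

lemma RankBounds.inv_R_le {R ρ : ℝ} (h : RankBounds r R ρ) (l : Fin q) : 1 / R ≤ (r l : ℝ)⁻¹ := by
  have h1 : (0 : ℝ) < r l := by exact_mod_cast h.pos l
  rw [inv_eq_one_div]
  exact one_div_le_one_div_of_le h1 (h.le l)

lemma RankBounds.norm_proj_sq_le {R ρ : ℝ} (h : RankBounds r R ρ) (V : Blocks n r)
    (G : Weights m n) : ‖proj V G‖ ^ 2 ≤ R * projSq V G := by
  rw [norm_sq_eq_sum, projSq, Finset.mul_sum]
  refine Finset.sum_le_sum fun e _ => ?_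
  have h1 := h.inv_R_le e.1
  rw [div_le_iff₀ h.R_pos] at h1
  nlinarith [sq_nonneg (proj V G e)]

lemma RankBounds.norm_scaledProj_sq_le {R ρ : ℝ} (h : RankBounds r R ρ) (V : Blocks n r)
    (G : Weights m n) : ‖scaledProj V G‖ ^ 2 ≤ ρ / R * projSq V G := by
  rw [norm_sq_eq_sum, projSq, Finset.mul_sum]
  refine Finset.sum_le_sum fun e _ => ?_
  rw [scaledProj_apply]
  have h1 := h.inv_le e.1
  have h2 : (0 : ℝ) ≤ (r e.1 : ℝ)⁻¹ * proj V G e ^ 2 := by positivity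
  nlinarith

lemma RankBounds.norm_scaledDirection_sq_le {R ρ : ℝ} (h : RankBounds r R ρ) {V : Blocks n r}
    (hV : IsGram V) (U : Blocks m r) :
    ‖scaledDirection U V‖ ^ 2 ≤ (ρ / R) ^ 2 * ‖direction U V‖ ^ 2 := by
  rw [hV.norm_scaledDirection_sq, hV.norm_direction_sq, Finset.mul_sum]
  refine Finset.sum_le_sum fun e _ => ?_
  have h2 : ((r e.1 : ℝ)⁻¹) ^ 2 ≤ (ρ / R) ^ 2 :=
    pow_le_pow_left₀ (by positivity) (h.inv_le e.1) 2
  have h3 : (0 : ℝ) ≤ n e.1 * flatten U e ^ 2 := by positivity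
  nlinarith

/-- A duality argument: `projSq V G` is the inner product of G with G V Vᵀ / r, and the Gram
condition bounds the squared norm of the latter by d times `projSq V G`. Cauchy–Schwarz then allows
cancelling one factor `projSq V G`. The bound n_l ≤ d needs m_l ≥ 1. -/
lemma projSq_le (hm : ∀ l, 0 < m l) {V : Blocks n r} (hV : IsGram V) (hr : ∀ l, 0 < r l)
    (G : Weights m n) :
    projSq V G ≤ (∑ l, (m l : ℝ) * n l) * ‖G‖ ^ 2 := by
  set D := ∑ l, (m l : ℝ) * n l with hD
  have hnD : ∀ l, (n l : ℝ) ≤ D := fun l => by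
    have h1 : (n l : ℝ) ≤ m l * n l := by
      have : (1 : ℝ) ≤ m l := by exact_mod_cast hm l
      have h2 : (0 : ℝ) ≤ n l := by positivity
      nlinarith
    exact h1.trans (Finset.single_le_sum (f := fun l => (m l : ℝ) * n l)
      (fun _ _ => by positivity) (Finset.mem_univ l))
  have hD0 : 0 ≤ D := Finset.sum_nonneg fun _ _ => by positivity
  set A : Blocks m r := fun l i j => proj V G ⟨l, i, j⟩ with hA
  have hfl : flatten A = proj V G := rfl
  have h1 : projSq V G = inner ℝ G (scaledDirection A V) := by
    rw [inner_scaledDirection, hfl, projSq_eq_inner, real_inner_comm]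
  have h2 : ‖scaledDirection A V‖ ^ 2 ≤ D * projSq V G := by
    rw [hV.norm_scaledDirection_sq, projSq, Finset.mul_sum, hfl]
    refine Finset.sum_le_sum fun e _ => ?_
    have h3 : (r e.1 : ℝ)⁻¹ ≤ 1 := inv_le_one_of_one_le₀ (by exact_mod_cast hr e.1)
    have h4 : (0 : ℝ) ≤ (r e.1 : ℝ)⁻¹ * proj V G e ^ 2 := by positivity
    calc (n e.1 : ℝ) * ((r e.1 : ℝ)⁻¹ ^ 2 * proj V G e ^ 2)
        = n e.1 * ((r e.1 : ℝ)⁻¹ * ((r e.1 : ℝ)⁻¹ * proj V G e ^ 2)) := by ring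
      _ ≤ D * (1 * ((r e.1 : ℝ)⁻¹ * proj V G e ^ 2)) := by
        gcongr
        exact hnD _
      _ = _ := by ring
  have h3 : projSq V G ≤ ‖G‖ * ‖scaledDirection A V‖ := h1 ▸ real_inner_le_norm _ _
  have hp := projSq_nonneg V G
  rcases hp.eq_or_lt with h0 | hpos
  · rw [← h0]; positivity
  have h4 : projSq V G ^ 2 ≤ ‖G‖ ^ 2 * (D * projSq V G) :=
    calc projSq V G ^ 2 ≤ (‖G‖ * ‖scaledDirection A V‖) ^ 2 := pow_le_pow_left₀ hp h3 2
      _ = ‖G‖ ^ 2 * ‖scaledDirection A V‖ ^ 2 := by ring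
      _ ≤ _ := by gcongr
  refine le_of_mul_le_mul_right ?_ hpos
  calc projSq V G * projSq V G = projSq V G ^ 2 := by ring
    _ ≤ _ := h4
    _ = _ := by ring

/-- Young's inequality for the semi-inner product whose quadratic form is `projSq V`; the parameter
τ is tuned in the drift estimate. -/
lemma abs_inner_proj_scaledProj_le (V : Blocks n r) (G H : Weights m n) {τ : ℝ} (hτ : 0 < τ) :
    2 * |inner ℝ (proj V G) (scaledProj V H)| ≤ projSq V G / τ + τ * projSq V H := by
  -- The sign s = ±1 treats both cases of the absolute value at once.
  have key : ∀ s : ℝ, s ^ 2 = 1 →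
      2 * (s * inner ℝ (proj V G) (scaledProj V H)) ≤ projSq V G / τ + τ * projSq V H := by
    intro s hs
    simp_rw [inner_eq_sum, projSq, Finset.mul_sum, Finset.sum_div, ← Finset.sum_add_distrib]
    refine Finset.sum_le_sum fun e _ => ?_
    rw [scaledProj_apply]
    have h : (0 : ℝ) ≤ (r e.1 : ℝ)⁻¹ * (proj V G e - s * τ * proj V H e) ^ 2 / τ := by positivity
    have e1 : (r e.1 : ℝ)⁻¹ * (proj V G e - s * τ * proj V H e) ^ 2 / τ =
        (r e.1 : ℝ)⁻¹ * proj V G e ^ 2 / τ +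
          s ^ 2 * (τ * ((r e.1 : ℝ)⁻¹ * proj V H e ^ 2)) -
          2 * (s * (proj V G e * ((r e.1 : ℝ)⁻¹ * proj V H e))) := by
      field_simp
      ring
    rw [e1, hs] at h
    linarith
  rcases abs_cases (inner ℝ (proj V G) (scaledProj V H)) with h | h <;> rw [h.1]
  · simpa using key 1 (by norm_num)
  · simpa using key (-1) (by norm_num)

lemma measurable_proj : Measurable fun p : Blocks n r × Weights m n => proj p.1 p.2 := by
  refine (PiLp.continuous_toLp 2 _).measurable.comp (measurable_pi_iff.2 fun e => ?_)
  refine Finset.measurable_sum _ fun k _ => Measurable.mul ?_ ?_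
  · exact (measurable_pi_apply _).comp ((WithLp.measurable_ofLp 2 _).comp measurable_snd)
  · exact (measurable_pi_apply _).comp ((measurable_pi_apply _).comp
      ((measurable_pi_apply _).comp measurable_fst))

lemma measurable_projSq : Measurable fun p : Blocks n r × Weights m n => projSq p.1 p.2 := by
  refine Finset.measurable_sum _ fun e _ => Measurable.const_mul (Measurable.pow_const ?_ 2) _
  exact (measurable_pi_apply _).comp ((WithLp.measurable_ofLp 2 _).comp measurable_proj)

lemma measurable_direction :
    Measurable fun p : Blocks m r × Blocks n r => direction p.1 p.2 := by
  refine (PiLp.continuous_toLp 2 _).measurable.comp (measurable_pi_iff.2 fun e => ?_)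
  simp only [Matrix.mul_apply, Matrix.transpose_apply, Matrix.of_apply]
  fun_prop

lemma measurable_scaledDirection :
    Measurable fun p : Blocks m r × Blocks n r => scaledDirection p.1 p.2 := by
  refine (PiLp.continuous_toLp 2 _).measurable.comp (measurable_pi_iff.2 fun e => ?_)
  simp only [Matrix.smul_apply, Matrix.mul_apply, Matrix.transpose_apply, Matrix.of_apply]
  fun_prop

/-- The Gram condition bounds each entry of V by √n, which gives integrability of all products of
entries. Expanding the square then leaves only the entries of E[V Vᵀ] = r I, and the factor r
cancels. -/
lemma integral_projSq {Q : Measure (Blocks n r)} [IsProbabilityMeasure Q] (hQ : IsSubspaceLaw Q)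
    (hr : ∀ l, 0 < r l) (G : Weights m n) :
    Integrable (fun V => projSq V G) Q ∧ ∫ V, projSq V G ∂Q = ‖G‖ ^ 2 := by
  have hentry : ∀ l k j, ∀ᵐ V ∂Q, |V l k j| ≤ Real.sqrt (n l) := by
    intro l k j
    filter_upwards [hQ.gram] with V hV
    have h1 := IsGram.sum_mul (V := V) hV l j j
    simp only [if_true] at h1
    refine Real.abs_le_sqrt ?_
    rw [← h1, sq]
    exact Finset.single_le_sum (f := fun k => V l k j * V l k j)
      (fun _ _ => mul_self_nonneg _) (Finset.mem_univ k)
  have hmul : ∀ l k k' j, Integrable (fun V : Blocks n r => V l k j * V l k' j) Q := by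
    intro l k k' j
    refine Integrable.of_bound (C := Real.sqrt (n l) * Real.sqrt (n l))
      (Measurable.aestronglyMeasurable (by fun_prop)) ?_
    filter_upwards [hentry l k j, hentry l k' j] with V h1 h2
    rw [norm_mul]
    exact mul_le_mul h1 h2 (abs_nonneg _) (Real.sqrt_nonneg _)
  have hsec : ∀ l k k', ∫ V : Blocks n r, ∑ j, V l k j * V l k' j ∂Q =
      if k = k' then (r l : ℝ) else 0 := by
    intro l k k'
    have := hQ.second_moment l k k'
    simpa [Matrix.mul_apply, Matrix.one_apply] using this
  have hexp : ∀ V : Blocks n r, projSq V G = ∑ l, ∑ i, (r l : ℝ)⁻¹ *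
      ∑ k, ∑ k', G ⟨l, i, k⟩ * G ⟨l, i, k'⟩ * ∑ j, V l k j * V l k' j := by
    intro V
    simp_rw [projSq, proj_apply, Fintype.sum_sigma, Fintype.sum_prod_type, ← Finset.mul_sum]
    refine Finset.sum_congr rfl fun l _ => ?_
    congr 1
    refine Finset.sum_congr rfl fun i _ => ?_
    rw [sum_sq_sum_mul (fun k => G ⟨l, i, k⟩) (fun j k => V l k j)]
  have hterm : ∀ l i k k', Integrable (fun V : Blocks n r =>
      G ⟨l, i, k⟩ * G ⟨l, i, k'⟩ * ∑ j, V l k j * V l k' j) Q := fun l i k k' =>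
    (integrable_finsetSum _ fun j _ => hmul l k k' j).const_mul _
  have hi1 : ∀ l i, Integrable (fun V : Blocks n r => (r l : ℝ)⁻¹ *
      ∑ k, ∑ k', G ⟨l, i, k⟩ * G ⟨l, i, k'⟩ * ∑ j, V l k j * V l k' j) Q := fun l i =>
    (integrable_finsetSum _ fun k _ => integrable_finsetSum _ fun k' _ =>
      hterm l i k k').const_mul _
  simp_rw [hexp]
  refine ⟨integrable_finsetSum _ fun l _ => integrable_finsetSum _ fun i _ => hi1 l i, ?_⟩
  rw [integral_finsetSum _ fun l _ => integrable_finsetSum _ fun i _ => hi1 l i, norm_sq_eq_sum,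
    Fintype.sum_sigma]
  refine Finset.sum_congr rfl fun l _ => ?_
  rw [integral_finsetSum _ fun i _ => hi1 l i, Fintype.sum_prod_type]
  refine Finset.sum_congr rfl fun i _ => ?_
  rw [integral_const_mul, integral_finsetSum _ fun k _ => integrable_finsetSum _ fun k' _ =>
    hterm l i k k']
  simp_rw [fun k => integral_finsetSum Finset.univ fun k' _ => hterm l i k k',
    integral_const_mul, hsec]
  have hr' : (r l : ℝ) ≠ 0 := by have := hr l; positivity
  simp [Finset.mul_sum]
  refine Finset.sum_congr rfl fun k _ => ?_
  field_simp

end Projection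

/-! ### Smoothness -/

section Descent

variable {E : Type*} [NormedAddCommGroup E] [InnerProductSpace ℝ E] [CompleteSpace E]

/-- Along the segment from x to x + h, subtract the linear and quadratic terms. The remainder `ψ`
has nonpositive derivative by Cauchy–Schwarz and the Lipschitz bound, so its value at 1 is at most
its value at 0. -/
lemma sub_sub_inner_gradient_le {φ : E → ℝ} {L : ℝ} (hφ : Differentiable ℝ φ)
    (hL : ∀ x y, ‖gradient φ x - gradient φ y‖ ≤ L * ‖x - y‖) (x h : E) :
    φ (x + h) - φ x - inner ℝ (gradient φ x) h ≤ L / 2 * ‖h‖ ^ 2 := by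
  set ψ : ℝ → ℝ := fun t => φ (x + t • h) - t * inner ℝ (gradient φ x) h - t ^ 2 * (L / 2 * ‖h‖ ^ 2)
    with hψ
  have hd : ∀ t : ℝ, HasDerivAt ψ (inner ℝ (gradient φ (x + t • h)) h -
      inner ℝ (gradient φ x) h - 2 * t * (L / 2 * ‖h‖ ^ 2)) t := by
    intro t
    have h1 : HasDerivAt (fun t : ℝ => x + t • h) h t := by
      simpa using ((hasDerivAt_id t).smul_const h).const_add x
    have h2 : HasDerivAt (fun t : ℝ => φ (x + t • h)) (fderiv ℝ φ (x + t • h) h) t :=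
      (hφ (x + t • h)).hasFDerivAt.comp_hasDerivAt t h1
    rw [← inner_gradient_left] at h2
    have h3 := (h2.sub ((hasDerivAt_id t).mul_const (inner ℝ (gradient φ x) h))).sub
      (((hasDerivAt_id t).pow 2).mul_const (L / 2 * ‖h‖ ^ 2))
    refine h3.congr_deriv ?_
    simp
  have hanti : AntitoneOn ψ (Set.Ici 0) := by
    refine antitoneOn_of_deriv_nonpos (convex_Ici 0)
      (fun t _ => (hd t).continuousAt.continuousWithinAt)
      (fun t _ => (hd t).differentiableAt.differentiableWithinAt) fun t ht => ?_
    rw [interior_Ici, Set.mem_Ioi] at ht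
    rw [(hd t).deriv, ← inner_sub_left]
    have h1 := hL (x + t • h) x
    rw [add_sub_cancel_left, norm_smul, Real.norm_of_nonneg ht.le] at h1
    have h2 := real_inner_le_norm (gradient φ (x + t • h) - gradient φ x) h
    nlinarith [norm_nonneg h]
  have := hanti (Set.mem_Ici.2 le_rfl) (Set.mem_Ici.2 zero_le_one) zero_le_one
  simp only [hψ, one_smul, zero_smul, add_zero] at this
  linarith

lemma gradient_fun_neg {φ : E → ℝ} (x : E) : gradient (fun y => -φ y) x = -gradient φ x := by
  simp [gradient, fderiv_fun_neg]

lemma abs_sub_sub_inner_gradient_le {φ : E → ℝ} {L : ℝ} (hφ : Differentiable ℝ φ)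
    (hL : ∀ x y, ‖gradient φ x - gradient φ y‖ ≤ L * ‖x - y‖) (x h : E) :
    |φ (x + h) - φ x - inner ℝ (gradient φ x) h| ≤ L / 2 * ‖h‖ ^ 2 := by
  refine abs_le.2 ⟨?_, sub_sub_inner_gradient_le hφ hL x h⟩
  have := sub_sub_inner_gradient_le (φ := fun y => -φ y) (L := L) hφ.fun_neg (fun x y => by
    rw [gradient_fun_neg, gradient_fun_neg, neg_sub_neg, norm_sub_rev]
    exact hL x y) x h
  rw [gradient_fun_neg, inner_neg_left] at this
  linarith

lemma hasGradientAt_of_abs_le {φ : E → ℝ} {L : ℝ} {x g : E}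
    (h : ∀ v, |φ (x + v) - φ x - inner ℝ g v| ≤ L / 2 * ‖v‖ ^ 2) : HasGradientAt φ g x := by
  rw [hasGradientAt_iff_isLittleO_nhds_zero]
  have h1 : (fun v : E => φ (x + v) - φ x - inner ℝ g v) =O[nhds 0] fun v => ‖v‖ ^ 2 :=
    Asymptotics.IsBigO.of_bound (L / 2) (Filter.Eventually.of_forall fun v => by
      rw [Real.norm_eq_abs, Real.norm_of_nonneg (sq_nonneg ‖v‖)]
      exact h v)
  refine h1.trans_isLittleO ?_
  refine (Asymptotics.isLittleO_norm_pow_id one_lt_two)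

end Descent

section Smooth

variable {q : ℕ} {m n r : Fin q → ℕ} {Ξ : Type*} [MeasurableSpace Ξ]
  {F : Weights m n → Ξ → ℝ} {D : Measure Ξ} {L σ : ℝ}

/-- The stochastic gradient. -/
def stochGrad (F : Weights m n → Ξ → ℝ) (X : Weights m n) (z : Ξ) : Weights m n :=
  gradient (fun W => F W z) X

namespace IsSmoothStochastic

lemma abs_le (S : IsSmoothStochastic F D L σ) (X h : Weights m n) (z : Ξ) :
    |F (X + h) z - F X z - inner ℝ (stochGrad F X z) h| ≤ L / 2 * ‖h‖ ^ 2 :=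
  abs_sub_sub_inner_gradient_le (φ := fun W => F W z) (S.differentiable z) (S.lipschitz z) X h

lemma integral_stochGrad (S : IsSmoothStochastic F D L σ) (X : Weights m n) :
    ∫ z, stochGrad F X z ∂D = gradient (objective F D) X := S.unbiased X

lemma integrable_stochGrad (S : IsSmoothStochastic F D L σ) (X : Weights m n) :
    Integrable (fun z => stochGrad F X z) D := S.grad_integrable X

lemma integrable_inner_stochGrad (S : IsSmoothStochastic F D L σ) (X h : Weights m n) :
    Integrable (fun z => inner ℝ (stochGrad F X z) h) D :=
  (S.integrable_stochGrad X).inner_const h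

lemma integral_inner_stochGrad (S : IsSmoothStochastic F D L σ) (X h : Weights m n) :
    ∫ z, inner ℝ (stochGrad F X z) h ∂D = inner ℝ (gradient (objective F D) X) h := by
  rw [← S.integral_stochGrad, real_inner_comm, ← integral_inner (S.integrable_stochGrad X)]
  exact integral_congr_ae (Filter.Eventually.of_forall fun z => real_inner_comm _ _)

/-- The Taylor bound for each ξ is integrated. Differentiability of the objective is not known yet,
so its `gradient` could be a default value; unbiasedness nevertheless identifies it with the mean
stochastic gradient. -/
lemma objective_abs_le [IsProbabilityMeasure D] (S : IsSmoothStochastic F D L σ)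
    (X h : Weights m n) :
    |objective F D (X + h) - objective F D X - inner ℝ (gradient (objective F D) X) h| ≤
      L / 2 * ‖h‖ ^ 2 := by
  have hi : Integrable (fun z => F (X + h) z - F X z) D := (S.integrable _).sub (S.integrable _)
  rw [← S.integral_inner_stochGrad, objective, objective,
    ← integral_sub (S.integrable _) (S.integrable _),
    ← integral_sub hi (S.integrable_inner_stochGrad X h)]
  have := norm_integral_le_of_norm_le_const (μ := D) (C := L / 2 * ‖h‖ ^ 2)
    (f := fun z => F (X + h) z - F X z - inner ℝ (stochGrad F X z) h)
    (Filter.Eventually.of_forall fun z => S.abs_le X h z)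
  simpa using this

/-- The quadratic Taylor bound itself forces differentiability, so the gradient in the hypotheses is
a genuine one. -/
lemma objective_hasGradientAt [IsProbabilityMeasure D] (S : IsSmoothStochastic F D L σ)
    (X : Weights m n) : HasGradientAt (objective F D) (gradient (objective F D) X) X :=
  hasGradientAt_of_abs_le (S.objective_abs_le X)

lemma objective_continuous [IsProbabilityMeasure D] (S : IsSmoothStochastic F D L σ) :
    Continuous (objective F D) :=
  continuous_iff_continuousAt.2 fun X => (S.objective_hasGradientAt X).continuousAt

lemma objective_lipschitz [IsProbabilityMeasure D] (S : IsSmoothStochastic F D L σ)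
    (X Y : Weights m n) :
    ‖gradient (objective F D) X - gradient (objective F D) Y‖ ≤ L * ‖X - Y‖ := by
  rw [← S.integral_stochGrad, ← S.integral_stochGrad,
    ← integral_sub (S.integrable_stochGrad X) (S.integrable_stochGrad Y)]
  have := norm_integral_le_of_norm_le_const (μ := D)
    (Filter.Eventually.of_forall fun z => S.lipschitz z X Y)
  simpa [stochGrad] using this

lemma gradient_continuous [IsProbabilityMeasure D] (S : IsSmoothStochastic F D L σ) :
    Continuous (gradient (objective F D)) := by
  refine (LipschitzWith.of_dist_le_mul (K := L.toNNReal) fun X Y => ?_).continuous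
  rw [dist_eq_norm, dist_eq_norm]
  refine (S.objective_lipschitz X Y).trans ?_
  gcongr
  exact Real.le_coe_toNNReal L

lemma measurable_uncurry (S : IsSmoothStochastic F D L σ) :
    Measurable fun p : Weights m n × Ξ => F p.1 p.2 :=
  measurable_uncurry_of_continuous_of_measurable (u := F) (fun z => (S.differentiable z).continuous)
    S.measurable

/-- Each coordinate of the gradient is a pointwise limit of difference quotients of F, which is
jointly measurable because it is continuous in the weights and measurable in ξ. -/
lemma measurable_stochGrad (S : IsSmoothStochastic F D L σ) :
    Measurable fun p : Weights m n × Ξ => stochGrad F p.1 p.2 := by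
  have hinner : ∀ e, Measurable fun p : Weights m n × Ξ => stochGrad F p.1 p.2 e := by
    intro e
    set b : Weights m n := EuclideanSpace.single e 1 with hb
    have hlim : ∀ p : Weights m n × Ξ, Filter.Tendsto
        (fun k : ℕ => ((k : ℝ) + 1) * (F (p.1 + (1 / ((k : ℝ) + 1)) • b) p.2 - F p.1 p.2))
        Filter.atTop (nhds (stochGrad F p.1 p.2 e)) := by
      intro p
      have hval : stochGrad F p.1 p.2 e = inner ℝ (stochGrad F p.1 p.2) b := by
        rw [IsStdGaussian.coord_eq _ e, real_inner_comm]
      rw [hval, tendsto_iff_norm_sub_tendsto_zero]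
      have h0 : Filter.Tendsto (fun k : ℕ => L / 2 * ‖b‖ ^ 2 * (1 / ((k : ℝ) + 1)))
          Filter.atTop (nhds 0) := by
        simpa using (tendsto_one_div_add_atTop_nhds_zero_nat (𝕜 := ℝ)).const_mul (L / 2 * ‖b‖ ^ 2)
      refine squeeze_zero (fun _ => norm_nonneg _) (fun k => ?_) h0
      have hk : (0 : ℝ) < (k : ℝ) + 1 := by positivity
      have h1 := S.abs_le p.1 ((1 / ((k : ℝ) + 1)) • b) p.2
      rw [inner_smul_right, norm_smul, Real.norm_of_nonneg (by positivity), mul_pow] at h1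
      have h2 : ((k : ℝ) + 1) * (F (p.1 + (1 / ((k : ℝ) + 1)) • b) p.2 - F p.1 p.2) -
          inner ℝ (stochGrad F p.1 p.2) b =
          ((k : ℝ) + 1) * (F (p.1 + (1 / ((k : ℝ) + 1)) • b) p.2 - F p.1 p.2 -
            (1 / ((k : ℝ) + 1)) * inner ℝ (stochGrad F p.1 p.2) b) := by
        field_simp
      rw [h2, norm_mul, Real.norm_of_nonneg hk.le, Real.norm_eq_abs]
      refine (mul_le_mul_of_nonneg_left h1 hk.le).trans_eq ?_
      field_simp
    refine measurable_of_tendsto_metrizable (fun k => ?_) (tendsto_pi_nhds.2 hlim)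
    have hs : Measurable fun p : Weights m n × Ξ => (p.1 + (1 / ((k : ℝ) + 1)) • b, p.2) :=
      (measurable_fst.add_const _).prodMk measurable_snd
    exact ((S.measurable_uncurry.comp hs).sub S.measurable_uncurry).const_mul _
  have : (fun p : Weights m n × Ξ => stochGrad F p.1 p.2) =
      fun p => WithLp.toLp 2 fun e => stochGrad F p.1 p.2 e := rfl
  rw [this]
  exact (PiLp.continuous_toLp 2 _).measurable.comp (measurable_pi_iff.2 hinner)

end IsSmoothStochastic

end Smooth

/-! ### The estimator at a fixed point -/

section Estimator

variable {q : ℕ} {m n r : Fin q → ℕ} {Ξ : Type*} [MeasurableSpace Ξ]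
  {F : Weights m n → Ξ → ℝ} {D : Measure Ξ} {L σ : ℝ}

/-- The number of weights. -/
def dim (m n : Fin q → ℕ) : ℝ := ∑ l, (m l : ℝ) * n l

lemma dim_nonneg (m n : Fin q → ℕ) : 0 ≤ dim m n := Finset.sum_nonneg fun _ _ => by positivity

/-- The symmetric difference quotient of the loss. -/
def slope (F : Weights m n → Ξ → ℝ) (ε : ℝ) (X : Weights m n) (U : Blocks m r) (V : Blocks n r)
    (z : Ξ) : ℝ :=
  (F (X + ε • direction U V) z - F (X - ε • direction U V) z) / (2 * ε)

omit [MeasurableSpace Ξ] in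
lemma lge_eq (F : Weights m n → Ξ → ℝ) (ε : ℝ) (X : Weights m n) (U : Blocks m r)
    (V : Blocks n r) (z : Ξ) :
    lge F ε X U V z = slope F ε X U V z • scaledDirection U V := rfl

/-- Each of the two evaluations has Taylor error at most L ε²/2 times ‖U Vᵀ‖²; their sum is divided
by 2ε. -/
lemma IsSmoothStochastic.abs_slope_sub_le (S : IsSmoothStochastic F D L σ) {ε : ℝ} (hε : 0 < ε)
    (X : Weights m n) (U : Blocks m r) (V : Blocks n r) (z : Ξ) :
    |slope F ε X U V z - inner ℝ (stochGrad F X z) (direction U V)| ≤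
      L * ε / 2 * ‖direction U V‖ ^ 2 := by
  have h1 := S.abs_le X (ε • direction U V) z
  have h2 := S.abs_le X (-(ε • direction U V)) z
  rw [norm_neg, inner_neg_right, ← sub_eq_add_neg] at h2
  rw [norm_smul, Real.norm_of_nonneg hε.le, mul_pow, inner_smul_right] at h1 h2
  rw [_root_.abs_le] at h1 h2
  have e1 : slope F ε X U V z - inner ℝ (stochGrad F X z) (direction U V) =
      (F (X + ε • direction U V) z - F (X - ε • direction U V) z -
        2 * (ε * inner ℝ (stochGrad F X z) (direction U V))) / (2 * ε) := by
    rw [slope]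
    field_simp
  rw [e1, abs_div, abs_of_pos (by positivity : (0 : ℝ) < 2 * ε), div_le_iff₀ (by positivity),
    _root_.abs_le]
  constructor <;> nlinarith [h1.1, h1.2, h2.1, h2.2]

lemma IsSmoothStochastic.measurable_slope (S : IsSmoothStochastic F D L σ) (ε : ℝ) :
    Measurable fun p : Weights m n × Blocks m r × Blocks n r × Ξ =>
      slope F ε p.1 p.2.1 p.2.2.1 p.2.2.2 := by
  have hd : Measurable fun p : Weights m n × Blocks m r × Blocks n r × Ξ =>
      direction p.2.1 p.2.2.1 :=
    measurable_direction.comp (by fun_prop :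
      Measurable fun p : Weights m n × Blocks m r × Blocks n r × Ξ => (p.2.1, p.2.2.1))
  have h1 : Measurable fun p : Weights m n × Blocks m r × Blocks n r × Ξ =>
      (p.1 + ε • direction p.2.1 p.2.2.1, p.2.2.2) :=
    (measurable_fst.add (hd.const_smul ε)).prodMk (by fun_prop)
  have h2 : Measurable fun p : Weights m n × Blocks m r × Blocks n r × Ξ =>
      (p.1 - ε • direction p.2.1 p.2.2.1, p.2.2.2) :=
    (measurable_fst.sub (hd.const_smul ε)).prodMk (by fun_prop)
  exact ((S.measurable_uncurry.comp h1).sub (S.measurable_uncurry.comp h2)).div_const _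

lemma IsSmoothStochastic.measurable_slope_fst_snd (S : IsSmoothStochastic F D L σ) (ε : ℝ)
    (X : Weights m n) (V : Blocks n r) :
    Measurable fun p : Blocks m r × Ξ => slope F ε X p.1 V p.2 :=
  (S.measurable_slope ε).comp
    (measurable_const.prodMk (measurable_fst.prodMk (measurable_const.prodMk measurable_snd)))

/-- The sum of the weights `n l` over the entries of the Gaussian matrices. -/
lemma RankBounds.sum_le {R ρ : ℝ} (h : RankBounds r R ρ) (m n : Fin q → ℕ) :
    ∑ e : (l : Fin q) × (Fin (m l) × Fin (r l)), (n e.1 : ℝ) ≤ R * dim m n := by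
  rw [Fintype.sum_sigma, dim, Finset.mul_sum]
  refine Finset.sum_le_sum fun l _ => ?_
  simp only [Finset.sum_const, Finset.card_univ, Fintype.card_prod, Fintype.card_fin,
    nsmul_eq_mul, Nat.cast_mul]
  have := h.le l
  have h2 : (0 : ℝ) ≤ m l * n l := by positivity
  nlinarith

lemma sum_cols_nonneg (m n r : Fin q → ℕ) :
    0 ≤ ∑ e : (l : Fin q) × (Fin (m l) × Fin (r l)), (n e.1 : ℝ) :=
  Finset.sum_nonneg fun _ _ => by positivity

/-- Under the Gram condition ‖U Vᵀ‖² is a weighted sum of squared Gaussian coordinates, of total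
weight at most R d, so the weighted moment bounds apply. -/
lemma IsGram.integral_norm_direction_pow_four {V : Blocks n r} (hV : IsGram V) {R ρ : ℝ}
    (hR : RankBounds r R ρ) :
    Integrable (fun U : Blocks m r => ‖direction U V‖ ^ 4) (gaussianLaw m r) ∧
      ∫ U : Blocks m r, ‖direction U V‖ ^ 4 ∂gaussianLaw m r ≤ 3 * (R * dim m n) ^ 2 := by
  have h := (isStdGaussian_flatten m r).weighted_sq (fun e => (n e.1 : ℝ))
    (fun _ => by positivity)
  have e1 : ∀ U : Blocks m r, ‖direction U V‖ ^ 4 =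
      (∑ e : (l : Fin q) × (Fin (m l) × Fin (r l)), (n e.1 : ℝ) * flatten U e ^ 2) ^ 2 := by
    intro U
    rw [← hV.norm_direction_sq]
    ring
  simp_rw [e1]
  refine ⟨h.1, h.2.trans ?_⟩
  have := hR.sum_le m n
  have := sum_cols_nonneg m n r
  gcongr

lemma IsGram.integral_norm_direction_pow_six {V : Blocks n r} (hV : IsGram V) {R ρ : ℝ}
    (hR : RankBounds r R ρ) :
    Integrable (fun U : Blocks m r => ‖direction U V‖ ^ 6) (gaussianLaw m r) ∧
      ∫ U : Blocks m r, ‖direction U V‖ ^ 6 ∂gaussianLaw m r ≤ 15 * (R * dim m n) ^ 3 := by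
  have h := (isStdGaussian_flatten m r).weighted_cube (fun e => (n e.1 : ℝ))
    (fun _ => by positivity)
  have e1 : ∀ U : Blocks m r, ‖direction U V‖ ^ 6 =
      (∑ e : (l : Fin q) × (Fin (m l) × Fin (r l)), (n e.1 : ℝ) * flatten U e ^ 2) ^ 3 := by
    intro U
    rw [← hV.norm_direction_sq]
    ring
  simp_rw [e1]
  refine ⟨h.1, h.2.trans ?_⟩
  have := hR.sum_le m n
  have := sum_cols_nonneg m n r
  gcongr

lemma IsGram.integral_inner_sq_mul {V : Blocks n r} (hV : IsGram V) {R ρ : ℝ}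
    (hR : RankBounds r R ρ) (G : Weights m n) :
    Integrable (fun U : Blocks m r => inner ℝ G (direction U V) ^ 2 * ‖direction U V‖ ^ 2)
      (gaussianLaw m r) ∧
      ∫ U : Blocks m r, inner ℝ G (direction U V) ^ 2 * ‖direction U V‖ ^ 2 ∂gaussianLaw m r ≤
        3 * R ^ 2 * dim m n * projSq V G := by
  have hRp := hR.R_pos
  have h := (isStdGaussian_flatten m r).inner_sq_mul_weighted (fun e => (n e.1 : ℝ))
    (fun _ => by positivity) (proj V G)
  simp_rw [hV.norm_direction_sq, inner_direction]
  refine ⟨h.1, h.2.trans ?_⟩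
  have h1 := hR.sum_le m n
  have h2 := hR.norm_proj_sq_le V G
  have h3 := sum_cols_nonneg m n r
  have h4 := projSq_nonneg V G
  calc _ ≤ 3 * (R * projSq V G) * (R * dim m n) := by gcongr
    _ = _ := by ring

lemma inner_proj_eq (V : Blocks n r) (G : Weights m n) (a : Weights m r) :
    inner ℝ (proj V G) a = inner ℝ G (direction (fun l i j => a ⟨l, i, j⟩) V) :=
  (inner_direction G (fun l i j => a ⟨l, i, j⟩ : Blocks m r) V).symm

lemma measurable_scaledDirection_fst (V : Blocks n r) :
    Measurable fun p : Blocks m r × Ξ => scaledDirection p.1 V := by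
  have h : Measurable fun p : Blocks m r × Ξ => (p.1, V) := measurable_fst.prodMk measurable_const
  have h2 := (measurable_scaledDirection (m := m) (n := n) (r := r)).comp h
  exact h2

lemma measurable_direction_fst (V : Blocks n r) :
    Measurable fun p : Blocks m r × Ξ => direction p.1 V := by
  have h : Measurable fun p : Blocks m r × Ξ => (p.1, V) := measurable_fst.prodMk measurable_const
  have h2 := (measurable_direction (m := m) (n := n) (r := r)).comp h
  exact h2

lemma IsSmoothStochastic.measurable_inner_direction (S : IsSmoothStochastic F D L σ)
    (X : Weights m n) (V : Blocks n r) :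
    Measurable fun p : Blocks m r × Ξ => inner ℝ (stochGrad F X p.2) (direction p.1 V) :=
  (S.measurable_stochGrad.comp (measurable_const.prodMk measurable_snd)).inner
    (measurable_direction_fst V)

/-- This is the estimator without smoothing. In coordinates of U the integrand is a sum of products
of a function of U and a function of ξ; the ξ-mean is given by unbiasedness and the U-mean by the
identity covariance. -/
lemma integral_inner_mul_inner_scaledDirection [IsProbabilityMeasure D]
    (S : IsSmoothStochastic F D L σ) (X H : Weights m n) (V : Blocks n r) :
    Integrable (fun p : Blocks m r × Ξ => inner ℝ (stochGrad F X p.2) (direction p.1 V) *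
      inner ℝ H (scaledDirection p.1 V)) ((gaussianLaw m r).prod D) ∧
    ∫ p, inner ℝ (stochGrad F X p.2) (direction p.1 V) * inner ℝ H (scaledDirection p.1 V)
      ∂(gaussianLaw m r).prod D =
        inner ℝ (proj V (gradient (objective F D) X)) (scaledProj V H) := by
  classical
  set a := scaledProj V H
  have hcoordz : ∀ e, Integrable (fun z => proj V (stochGrad F X z) e) D ∧
      ∫ z, proj V (stochGrad F X z) e ∂D = proj V (gradient (objective F D) X) e := by
    intro e
    simp_rw [IsStdGaussian.coord_eq _ e, real_inner_comm _ (EuclideanSpace.single e (1 : ℝ)),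
      inner_proj_eq]
    exact ⟨S.integrable_inner_stochGrad X _, S.integral_inner_stochGrad X _⟩
  have hcoordU : ∀ e, Integrable (fun U : Blocks m r => flatten U e * inner ℝ a (flatten U))
      (gaussianLaw m r) ∧
      ∫ U : Blocks m r, flatten U e * inner ℝ a (flatten U) ∂gaussianLaw m r = a e := by
    intro e
    have h := (isStdGaussian_flatten m r).inner_mul_inner (EuclideanSpace.single e (1 : ℝ)) a
    simp_rw [← IsStdGaussian.coord_eq] at h
    exact h
  have hexp : (fun p : Blocks m r × Ξ => inner ℝ (stochGrad F X p.2) (direction p.1 V) *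
      inner ℝ H (scaledDirection p.1 V)) = fun p => ∑ e,
        (flatten p.1 e * inner ℝ a (flatten p.1)) * proj V (stochGrad F X p.2) e := by
    ext p
    rw [inner_direction, inner_scaledDirection, inner_eq_sum, Finset.sum_mul]
    exact Finset.sum_congr rfl fun e _ => by ring
  have hterm := fun e => (hcoordU e).1.mul_prod (hcoordz e).1
  rw [hexp]
  refine ⟨integrable_finsetSum _ fun e _ => hterm e, ?_⟩
  rw [integral_finsetSum _ fun e _ => hterm e, inner_eq_sum]
  refine Finset.sum_congr rfl fun e _ => ?_
  rw [integral_prod_mul (fun U : Blocks m r => flatten U e * inner ℝ a (flatten U))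
    (fun z => proj V (stochGrad F X z) e), (hcoordU e).2, (hcoordz e).2, mul_comm]

/-- The expected estimator is, up to the smoothing bias, the projected gradient. -/
lemma integral_slope_mul_inner [IsProbabilityMeasure D] (S : IsSmoothStochastic F D L σ)
    {R ρ : ℝ} (hR : RankBounds r R ρ) {ε : ℝ} (hε : 0 < ε) {V : Blocks n r} (hV : IsGram V)
    (X H : Weights m n) {τ : ℝ} (hτ : 0 < τ) :
    Integrable (fun p : Blocks m r × Ξ => slope F ε X p.1 V p.2 *
      inner ℝ H (scaledDirection p.1 V)) ((gaussianLaw m r).prod D) ∧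
    |∫ p, slope F ε X p.1 V p.2 * inner ℝ H (scaledDirection p.1 V) ∂(gaussianLaw m r).prod D -
        inner ℝ (proj V (gradient (objective F D) X)) (scaledProj V H)| ≤
      τ / 2 * projSq V H + 3 * ρ * L ^ 2 * ε ^ 2 * R * dim m n ^ 2 / (8 * τ) := by
  obtain ⟨hi1, he1⟩ := integral_inner_mul_inner_scaledDirection (r := r) S X H V
  have hRp := hR.R_pos
  have hρp : 0 < ρ := lt_of_lt_of_le one_pos hR.one_le
  -- This choice makes (θ/2)(ρ/R) equal to τ/2, the coefficient of `projSq V H` in the bound.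
  set θ := τ * R / ρ with hθ
  have hθp : 0 < θ := by positivity
  set err : Blocks m r × Ξ → ℝ := fun p =>
    (slope F ε X p.1 V p.2 - inner ℝ (stochGrad F X p.2) (direction p.1 V)) *
      inner ℝ H (scaledDirection p.1 V) with herr
  set bnd : Blocks m r → ℝ := fun U => θ / 2 * inner ℝ (scaledProj V H) (flatten U) ^ 2 +
    (L * ε) ^ 2 / (8 * θ) * ‖direction U V‖ ^ 4 with hbnd
  have hsq := (isStdGaussian_flatten m r).integrable_inner_pow (scaledProj V H) 2
  have hfour := hV.integral_norm_direction_pow_four (m := m) hR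
  have hbi : Integrable bnd (gaussianLaw m r) :=
    (hsq.const_mul _).add (hfour.1.const_mul _)
  have hbb : ∫ U, bnd U ∂gaussianLaw m r ≤
      τ / 2 * projSq V H + 3 * ρ * L ^ 2 * ε ^ 2 * R * dim m n ^ 2 / (8 * τ) := by
    rw [hbnd, integral_add (hsq.const_mul _) (hfour.1.const_mul _), integral_const_mul,
      integral_const_mul, ((isStdGaussian_flatten m r).integral_inner_pow _).1]
    have h1 : θ / 2 * ‖scaledProj V H‖ ^ 2 ≤ θ / 2 * (ρ / R * projSq V H) := by
      have := hR.norm_scaledProj_sq_le V H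
      gcongr
    have h2 : (L * ε) ^ 2 / (8 * θ) * ∫ U : Blocks m r, ‖direction U V‖ ^ 4 ∂gaussianLaw m r ≤
        (L * ε) ^ 2 / (8 * θ) * (3 * (R * dim m n) ^ 2) := by
      have := hfour.2
      gcongr
    have e1 : θ / 2 * (ρ / R * projSq V H) = τ / 2 * projSq V H := by
      rw [hθ]; field_simp
    have e2 : (L * ε) ^ 2 / (8 * θ) * (3 * (R * dim m n) ^ 2) =
        3 * ρ * L ^ 2 * ε ^ 2 * R * dim m n ^ 2 / (8 * τ) := by
      rw [hθ]; field_simp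
    linarith
  have hpt : ∀ p, ‖err p‖ ≤ bnd p.1 := by
    intro p
    have h1 := S.abs_slope_sub_le hε X p.1 V p.2
    rw [herr, norm_mul, Real.norm_eq_abs, Real.norm_eq_abs, inner_scaledDirection]
    set x := |inner ℝ (scaledProj V H) (flatten p.1)| with hx
    have hx2 : inner ℝ (scaledProj V H) (flatten p.1) ^ 2 = x ^ 2 := (sq_abs _).symm
    refine (mul_le_mul_of_nonneg_right h1 (abs_nonneg _)).trans ?_
    rw [hbnd]
    simp only
    rw [hx2]
    have h3 : 0 ≤ (θ * x - L * ε / 2 * ‖direction p.1 V‖ ^ 2) ^ 2 / (2 * θ) := by positivity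
    have h4 : (θ * x - L * ε / 2 * ‖direction p.1 V‖ ^ 2) ^ 2 / (2 * θ) =
        θ / 2 * x ^ 2 + (L * ε) ^ 2 / (8 * θ) * ‖direction p.1 V‖ ^ 4 -
          L * ε / 2 * ‖direction p.1 V‖ ^ 2 * x := by
      field_simp
      ring
    linarith
  have hei : Integrable err ((gaussianLaw m r).prod D) := by
    refine (hbi.comp_fst D).mono' (Measurable.aestronglyMeasurable ?_)
      (Filter.Eventually.of_forall hpt)
    exact ((S.measurable_slope_fst_snd ε X V).sub (S.measurable_inner_direction X V)).mul
      (measurable_const.inner (measurable_scaledDirection_fst V))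
  have hsplit : (fun p : Blocks m r × Ξ => slope F ε X p.1 V p.2 *
      inner ℝ H (scaledDirection p.1 V)) = fun p =>
        inner ℝ (stochGrad F X p.2) (direction p.1 V) * inner ℝ H (scaledDirection p.1 V) +
          err p := by
    ext p
    rw [herr]
    ring
  rw [hsplit]
  refine ⟨hi1.add hei, ?_⟩
  rw [integral_add hi1 hei, he1, add_sub_cancel_left]
  refine (norm_integral_le_of_norm_le (hbi.comp_fst D) (Filter.Eventually.of_forall hpt)).trans ?_
  rw [integral_fun_fst]
  simpa using hbb

lemma integrable_projSq_stochGrad [IsProbabilityMeasure D] (S : IsSmoothStochastic F D L σ)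
    (hm : ∀ l, 0 < m l) (hr : ∀ l, 0 < r l) {V : Blocks n r} (hV : IsGram V) (X : Weights m n)
    (G : Weights m n) : Integrable (fun z => projSq V (stochGrad F X z - G)) D := by
  have hsq : Integrable (fun z => 2 * ‖stochGrad F X z - gradient (objective F D) X‖ ^ 2 +
      2 * ‖gradient (objective F D) X - G‖ ^ 2) D :=
    ((S.sq_integrable X).const_mul 2).add (integrable_const _)
  refine (hsq.const_mul (dim m n)).mono' (Measurable.aestronglyMeasurable ?_)
    (Filter.Eventually.of_forall fun z => ?_)
  · have h1 : Measurable fun z => stochGrad F X z :=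
      S.measurable_stochGrad.comp (measurable_const.prodMk measurable_id)
    have h3 : Measurable fun z => (V, stochGrad F X z - G) :=
      measurable_const.prodMk (h1.sub_const G)
    have h4 := (measurable_projSq (m := m) (n := n) (r := r)).comp h3
    exact h4
  · rw [Real.norm_of_nonneg (projSq_nonneg _ _)]
    refine (projSq_le hm hV hr _).trans (mul_le_mul_of_nonneg_left ?_ (dim_nonneg m n))
    have h2 : stochGrad F X z - G = (stochGrad F X z - gradient (objective F D) X) +
      (gradient (objective F D) X - G) := by abel
    rw [h2]
    set a := stochGrad F X z - gradient (objective F D) X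
    set b := gradient (objective F D) X - G
    have h3 := norm_add_le a b
    have h4 := norm_nonneg (a + b)
    nlinarith [sq_nonneg (‖a‖ - ‖b‖)]

/-- The second moment of the estimator. -/
lemma integral_slope_sq_mul [IsProbabilityMeasure D] (S : IsSmoothStochastic F D L σ)
    (hm : ∀ l, 0 < m l)
    {R ρ : ℝ} (hR : RankBounds r R ρ) {ε : ℝ} (hε : 0 < ε) {V : Blocks n r} (hV : IsGram V)
    (X : Weights m n) :
    Integrable (fun p : Blocks m r × Ξ => slope F ε X p.1 V p.2 ^ 2 *
      ‖scaledDirection p.1 V‖ ^ 2) ((gaussianLaw m r).prod D) ∧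
    ∫ p, slope F ε X p.1 V p.2 ^ 2 * ‖scaledDirection p.1 V‖ ^ 2 ∂(gaussianLaw m r).prod D ≤
      6 * ρ ^ 2 * dim m n * ∫ z, projSq V (stochGrad F X z) ∂D +
        15 / 2 * ρ ^ 2 * L ^ 2 * ε ^ 2 * R * dim m n ^ 3 := by
  have hRp := hR.R_pos
  have hρp : 0 < ρ := lt_of_lt_of_le one_pos hR.one_le
  have hd0 := dim_nonneg m n
  have hpi : Integrable (fun z => projSq V (stochGrad F X z)) D := by
    simpa using integrable_projSq_stochGrad S hm hR.pos hV X 0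
  have hsix := hV.integral_norm_direction_pow_six (m := m) hR
  set A : Blocks m r × Ξ → ℝ := fun p =>
    inner ℝ (stochGrad F X p.2) (direction p.1 V) ^ 2 * ‖direction p.1 V‖ ^ 2 with hA
  have hAm : Measurable A := ((S.measurable_inner_direction X V).pow_const 2).mul
    ((measurable_direction_fst V).norm.pow_const 2)
  have hAnn : ∀ p, 0 ≤ A p := fun p => by rw [hA]; positivity
  have hAint : ∀ z, Integrable (fun U => A (U, z)) (gaussianLaw m r) := fun z => by
    have h := (hV.integral_inner_sq_mul (m := m) hR (stochGrad F X z)).1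
    exact h
  have hAfib : ∀ z, ∫ U, A (U, z) ∂gaussianLaw m r ≤
      3 * R ^ 2 * dim m n * projSq V (stochGrad F X z) := fun z => by
    have h := (hV.integral_inner_sq_mul (m := m) hR (stochGrad F X z)).2
    exact h
  -- Integrating over U first, with ξ fixed, uses the Gaussian moment bound and leaves a multiple of
  -- the integrable function `projSq V (stochGrad F X z)`.
  have hAi : Integrable A ((gaussianLaw m r).prod D) := by
    rw [integrable_prod_iff' hAm.aestronglyMeasurable]
    refine ⟨Filter.Eventually.of_forall hAint, ?_⟩
    simp_rw [Real.norm_of_nonneg (hAnn _)]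
    refine (hpi.const_mul (3 * R ^ 2 * dim m n)).mono' ?_ (Filter.Eventually.of_forall fun z => ?_)
    · exact (hAm.comp measurable_swap).stronglyMeasurable.integral_prod_right'.aestronglyMeasurable
    · rw [Real.norm_of_nonneg (integral_nonneg fun U => hAnn _)]
      exact hAfib z
  have hAb : ∫ p, A p ∂(gaussianLaw m r).prod D ≤
      3 * R ^ 2 * dim m n * ∫ z, projSq V (stochGrad F X z) ∂D := by
    rw [integral_prod_symm _ hAi, ← integral_const_mul]
    exact integral_mono hAi.integral_prod_right (hpi.const_mul _) hAfib
  set bnd : Blocks m r × Ξ → ℝ := fun p => (ρ / R) ^ 2 * (2 * A p +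
    L ^ 2 * ε ^ 2 / 2 * ‖direction p.1 V‖ ^ 6) with hbnd
  have hsix' : Integrable (fun p : Blocks m r × Ξ => ‖direction p.1 V‖ ^ 6)
      ((gaussianLaw m r).prod D) := hsix.1.comp_fst D
  have hbi : Integrable bnd ((gaussianLaw m r).prod D) :=
    ((hAi.const_mul 2).add (hsix'.const_mul _)).const_mul _
  have hpt : ∀ p : Blocks m r × Ξ,
      slope F ε X p.1 V p.2 ^ 2 * ‖scaledDirection p.1 V‖ ^ 2 ≤ bnd p := by
    intro p
    have h1 := S.abs_slope_sub_le hε X p.1 V p.2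
    set c := slope F ε X p.1 V p.2
    set g := inner ℝ (stochGrad F X p.2) (direction p.1 V) with hg
    have h2 : c ^ 2 ≤ 2 * g ^ 2 + 2 * (L * ε / 2 * ‖direction p.1 V‖ ^ 2) ^ 2 := by
      have h3 : (c - g) ^ 2 ≤ (L * ε / 2 * ‖direction p.1 V‖ ^ 2) ^ 2 := by
        rw [← sq_abs (c - g)]
        exact pow_le_pow_left₀ (abs_nonneg _) h1 2
      nlinarith [sq_nonneg (c - 2 * g)]
    calc c ^ 2 * ‖scaledDirection p.1 V‖ ^ 2
        ≤ (2 * g ^ 2 + 2 * (L * ε / 2 * ‖direction p.1 V‖ ^ 2) ^ 2) *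
          ((ρ / R) ^ 2 * ‖direction p.1 V‖ ^ 2) := by
          have := hR.norm_scaledDirection_sq_le hV p.1
          gcongr
      _ = bnd p := by
          rw [hbnd, hA]
          simp only [← hg]
          ring
  have hint : Integrable (fun p : Blocks m r × Ξ => slope F ε X p.1 V p.2 ^ 2 *
      ‖scaledDirection p.1 V‖ ^ 2) ((gaussianLaw m r).prod D) :=
    hbi.mono' (Measurable.aestronglyMeasurable
      (((S.measurable_slope_fst_snd ε X V).pow_const 2).mul
        ((measurable_scaledDirection_fst V).norm.pow_const 2)))
      (Filter.Eventually.of_forall fun p => by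
        rw [Real.norm_of_nonneg (by positivity)]
        exact hpt p)
  have hfst : ∫ p : Blocks m r × Ξ, ‖direction p.1 V‖ ^ 6 ∂(gaussianLaw m r).prod D =
      ∫ U : Blocks m r, ‖direction U V‖ ^ 6 ∂gaussianLaw m r := by
    have h := integral_fun_fst (μ := gaussianLaw m r) (ν := D)
      (fun U : Blocks m r => ‖direction U V‖ ^ 6)
    simpa using h
  refine ⟨hint, (integral_mono hint hbi hpt).trans ?_⟩
  rw [hbnd, integral_const_mul, integral_add (hAi.const_mul 2) (hsix'.const_mul _),
    integral_const_mul, integral_const_mul, hfst]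
  calc _ ≤ (ρ / R) ^ 2 * (2 * (3 * R ^ 2 * dim m n * ∫ z, projSq V (stochGrad F X z) ∂D) +
      L ^ 2 * ε ^ 2 / 2 * (15 * (R * dim m n) ^ 3)) := by
        have := hsix.2
        gcongr
    _ = _ := by
        field_simp
        ring

end Estimator

/-! ### One step of the algorithm -/

section Step

variable {q : ℕ} {m n r : Fin q → ℕ} {Ξ : Type*} [MeasurableSpace Ξ]
  {F : Weights m n → Ξ → ℝ} {D : Measure Ξ} {L σ R ρ α ε ν : ℝ}

/-- The step sizes allowed in the analysis. -/
structure Admissible (m n r : Fin q → ℕ) (R ρ L α ε ν : ℝ) : Prop where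
  rows_pos : ∀ l, 0 < m l
  ranks : RankBounds r R ρ
  dim_pos : 0 < dim m n
  L_pos : 0 < L
  α_pos : 0 < α
  ε_pos : 0 < ε
  one_le_ν : 1 ≤ ν
  step_le : ρ ^ 2 * L * dim m n * ν * α ≤ 1 / 144

/-- The projected variance of the stochastic gradient. -/
def projNoise (F : Weights m n → Ξ → ℝ) (D : Measure Ξ) (V : Blocks n r) (X : Weights m n) : ℝ :=
  ∫ z, projSq V (stochGrad F X z - gradient (objective F D) X) ∂D

lemma projNoise_nonneg (V : Blocks n r) (X : Weights m n) : 0 ≤ projNoise F D V X :=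
  integral_nonneg fun _ => projSq_nonneg _ _

/-- The stochastic gradient at X is moved to Y with the same ξ, using the Lipschitz bound for that
ξ. The noise thus appears at Y, which will be the start of the block and independent of V; noise at
X could not be averaged over V. -/
lemma Admissible.integral_projSq_stochGrad_le (h : Admissible m n r R ρ L α ε ν)
    [IsProbabilityMeasure D] (S : IsSmoothStochastic F D L σ) {V : Blocks n r} (hV : IsGram V)
    (X Y : Weights m n) :
    ∫ z, projSq V (stochGrad F X z) ∂D ≤ 3 * (dim m n * (L ^ 2 * ‖X - Y‖ ^ 2) +
      projNoise F D V Y + projSq V (gradient (objective F D) Y)) := by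
  set G := gradient (objective F D) Y
  have hi : Integrable (fun z => projSq V (stochGrad F X z)) D := by
    simpa using integrable_projSq_stochGrad S h.rows_pos h.ranks.pos hV X 0
  have hn := integrable_projSq_stochGrad S h.rows_pos h.ranks.pos hV Y G
  have hb : ∀ z, projSq V (stochGrad F X z) ≤ 3 * (dim m n * (L ^ 2 * ‖X - Y‖ ^ 2) +
      projSq V (stochGrad F Y z - G) + projSq V G) := by
    intro z
    have e : stochGrad F X z =
        (stochGrad F X z - stochGrad F Y z) + (stochGrad F Y z - G) + G := by abel
    have h1 := projSq_add_add_le V (stochGrad F X z - stochGrad F Y z) (stochGrad F Y z - G) G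
    rw [← e] at h1
    have h2 := projSq_le h.rows_pos hV h.ranks.pos (stochGrad F X z - stochGrad F Y z)
    have h3 : ‖stochGrad F X z - stochGrad F Y z‖ ^ 2 ≤ L ^ 2 * ‖X - Y‖ ^ 2 := by
      rw [← mul_pow]
      exact pow_le_pow_left₀ (norm_nonneg _) (S.lipschitz z X Y) 2
    have h4 := mul_le_mul_of_nonneg_left h3 h.dim_pos.le
    have h5 : projSq V (stochGrad F X z - stochGrad F Y z) ≤
      dim m n * ‖stochGrad F X z - stochGrad F Y z‖ ^ 2 := h2
    linarith
  have hc : Integrable (fun _ : Ξ => dim m n * (L ^ 2 * ‖X - Y‖ ^ 2)) D := integrable_const _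
  have hc' : Integrable (fun _ : Ξ => projSq V G) D := integrable_const _
  have hcn : Integrable (fun z => dim m n * (L ^ 2 * ‖X - Y‖ ^ 2) +
      projSq V (stochGrad F Y z - G)) D := hc.add hn
  refine (integral_mono hi ((hcn.add hc').const_mul 3) hb).trans_eq ?_
  rw [integral_const_mul]
  congr 1
  have := integral_add hcn hc'
  simp only [Pi.add_apply] at this ⊢
  rw [this, integral_add hc hn]
  simp [projNoise, G]

lemma Admissible.projSq_gradient_le (h : Admissible m n r R ρ L α ε ν)
    [IsProbabilityMeasure D] (S : IsSmoothStochastic F D L σ) {V : Blocks n r} (hV : IsGram V)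
    (X Y : Weights m n) :
    projSq V (gradient (objective F D) X) ≤ 2 * projSq V (gradient (objective F D) Y) +
      2 * (dim m n * (L ^ 2 * ‖X - Y‖ ^ 2)) := by
  have e : gradient (objective F D) X = gradient (objective F D) Y +
    (gradient (objective F D) X - gradient (objective F D) Y) := by abel
  have h1 := projSq_add_le V (gradient (objective F D) Y)
    (gradient (objective F D) X - gradient (objective F D) Y)
  rw [← e] at h1
  have h2 : _ ≤ dim m n * _ := projSq_le h.rows_pos hV h.ranks.pos
    (gradient (objective F D) X - gradient (objective F D) Y)
  have h3 : ‖gradient (objective F D) X - gradient (objective F D) Y‖ ^ 2 ≤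
      L ^ 2 * ‖X - Y‖ ^ 2 := by
    rw [← mul_pow]
    exact pow_le_pow_left₀ (norm_nonneg _) (S.objective_lipschitz X Y) 2
  have h4 := mul_le_mul_of_nonneg_left h3 h.dim_pos.le
  linarith

/-- The arithmetic of the drift estimate. `I1` and `I2` are the cross term and the second moment,
`B` is the unsmoothed cross term, y = ‖X - Y‖², and `πY` is the projected size of X - Y. With τ =
1/(2dνα) the terms carrying `πY` add up to at most y/ν, so the growth factor stays 1 + O(1/ν). -/
lemma drift_bound {d ν α L ρ R ε y p₀ N P I1 I2 B πY J : ℝ} (hd : 0 < d) (hα : 0 < α) (hL : 0 < L)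
    (hν : 1 ≤ ν) (hρ : 1 ≤ ρ) (hR : 0 < R) (hp0 : 0 ≤ p₀) (hy0 : 0 ≤ y)
    (hs : ρ ^ 2 * L * d * ν * α ≤ 1 / 144)
    (h1b : |I1 - B| ≤ 1 / (2 * d * ν * α) / 2 * πY +
      3 * ρ * L ^ 2 * ε ^ 2 * R * d ^ 2 / (8 * (1 / (2 * d * ν * α))))
    (h2b : I2 ≤ 6 * ρ ^ 2 * d * J + 15 / 2 * ρ ^ 2 * L ^ 2 * ε ^ 2 * R * d ^ 3)
    (h3 : J ≤ 3 * (d * (L ^ 2 * y) + N + p₀)) (h4 : P ≤ 2 * p₀ + 2 * (d * (L ^ 2 * y)))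
    (h5 : πY ≤ d * y) (h6 : 2 * |B| ≤ P / (1 / (2 * d * ν * α)) + 1 / (2 * d * ν * α) * πY) :
    y - 2 * α * I1 + α ^ 2 * I2 ≤ (1 + 11 / 10 / ν) * y +
      (22 * ρ ^ 2 * α ^ 2 * d * ν * p₀ + 18 * ρ ^ 2 * α ^ 2 * d * N +
        9 * ρ ^ 2 * α ^ 2 * L ^ 2 * ε ^ 2 * R * ν * d ^ 3) := by
  have hν0 : 0 < ν := by linarith
  have hs0 : 0 ≤ ρ ^ 2 * L * d * ν * α := by positivity
  have b1 : -(2 * α * I1) ≤ y / ν + 4 * d * ν * α ^ 2 * (p₀ + d * L ^ 2 * y) +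
      3 / 2 * ρ * L ^ 2 * ε ^ 2 * R * ν * d ^ 3 * α ^ 2 := by
    have h7 := (abs_le.1 h1b).1
    have h8 := neg_abs_le B
    have e3 : 3 * ρ * L ^ 2 * ε ^ 2 * R * d ^ 2 / (8 * (1 / (2 * d * ν * α))) =
      3 / 4 * ρ * L ^ 2 * ε ^ 2 * R * ν * d ^ 3 * α := by field_simp; ring
    have e4 : P / (1 / (2 * d * ν * α)) = P * (2 * d * ν * α) := by field_simp
    have e5 : 2 * α * (1 / (2 * d * ν * α) * πY) ≤ y / ν := by
      have : 2 * α * (1 / (2 * d * ν * α) * πY) = πY / (d * ν) := by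
        field_simp
      rw [this, div_le_div_iff₀ (by positivity) hν0]
      have h15 := mul_le_mul_of_nonneg_right h5 hν0.le
      linarith
    rw [e3] at h7
    rw [e4] at h6
    have h9 : P * (2 * d * ν * α) ≤ (2 * p₀ + 2 * (d * (L ^ 2 * y))) * (2 * d * ν * α) := by
      gcongr
    have h10 : -(2 * α * I1) ≤ α * (2 * |B|) + 2 * α * (1 / (2 * d * ν * α) / 2 *
        πY + 3 / 4 * ρ * L ^ 2 * ε ^ 2 * R * ν * d ^ 3 * α) := by
      have h13 : -I1 ≤ |B| + (1 / (2 * d * ν * α) / 2 * πY +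
        3 / 4 * ρ * L ^ 2 * ε ^ 2 * R * ν * d ^ 3 * α) := by linarith
      have h14 := mul_le_mul_of_nonneg_left h13 (by positivity : 0 ≤ 2 * α)
      linarith
    have h11 := mul_le_mul_of_nonneg_left h6 hα.le
    have h12 := mul_le_mul_of_nonneg_left h9 hα.le
    linarith
  have b2 : α ^ 2 * I2 ≤ α ^ 2 * (18 * ρ ^ 2 * d * (d * L ^ 2 * y + N + p₀) +
      15 / 2 * ρ ^ 2 * L ^ 2 * ε ^ 2 * R * d ^ 3) := by
    refine mul_le_mul_of_nonneg_left (h2b.trans ?_) (sq_nonneg α)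
    have := mul_le_mul_of_nonneg_left h3 (by positivity : 0 ≤ 6 * ρ ^ 2 * d)
    linarith
  have hρ2 : 1 ≤ ρ ^ 2 := one_le_pow₀ hρ
  -- By the step-size bound the coefficient is at most (4 + 18)/144² divided by ν, far below
  -- 1/(10ν).
  have b3 : 4 * d * ν * α ^ 2 * (d * L ^ 2 * y) + α ^ 2 * (18 * ρ ^ 2 * d * (d * L ^ 2 * y)) ≤
      1 / 10 / ν * y := by
    have hk : (ρ ^ 2 * L * d * ν * α) ^ 2 ≤ (1 / 144) ^ 2 := pow_le_pow_left₀ hs0 hs 2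
    have c1 : (L * d * ν * α) ^ 2 ≤ (ρ ^ 2 * L * d * ν * α) ^ 2 := by
      refine pow_le_pow_left₀ (by positivity) ?_ 2
      have : 0 ≤ L * d * ν * α := by positivity
      nlinarith
    have c2 : ρ ^ 2 * (L * d * α) ^ 2 * ν ≤ (ρ ^ 2 * L * d * ν * α) ^ 2 := by
      have : (ρ ^ 2 * L * d * ν * α) ^ 2 = (ρ ^ 2 * (L * d * α) ^ 2 * ν) * (ρ ^ 2 * ν) := by ring
      rw [this]
      exact le_mul_of_one_le_right (by positivity) (one_le_mul_of_one_le_of_one_le hρ2 hν)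
    have e : 4 * d * ν * α ^ 2 * (d * L ^ 2 * y) + α ^ 2 * (18 * ρ ^ 2 * d * (d * L ^ 2 * y)) =
        (4 * (L * d * ν * α) ^ 2 + 18 * (ρ ^ 2 * (L * d * α) ^ 2 * ν)) * y / ν := by
      field_simp
    rw [e, show 1 / 10 / ν * y = 1 / 10 * y / ν by ring]
    gcongr
    linarith
  have b4 : 4 * d * ν * α ^ 2 * p₀ + α ^ 2 * (18 * ρ ^ 2 * d * p₀) ≤
      22 * ρ ^ 2 * α ^ 2 * d * ν * p₀ := by
    have c1 : d * ν * α ^ 2 * p₀ * 1 ≤ d * ν * α ^ 2 * p₀ * ρ ^ 2 := by gcongr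
    have c2 : α ^ 2 * ρ ^ 2 * d * p₀ * 1 ≤ α ^ 2 * ρ ^ 2 * d * p₀ * ν := by gcongr
    linarith
  have b5 : 3 / 2 * ρ * L ^ 2 * ε ^ 2 * R * ν * d ^ 3 * α ^ 2 +
      α ^ 2 * (15 / 2 * ρ ^ 2 * L ^ 2 * ε ^ 2 * R * d ^ 3) ≤
      9 * ρ ^ 2 * α ^ 2 * L ^ 2 * ε ^ 2 * R * ν * d ^ 3 := by
    have c1 : ρ * L ^ 2 * ε ^ 2 * R * ν * d ^ 3 * α ^ 2 * 1 ≤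
      ρ * L ^ 2 * ε ^ 2 * R * ν * d ^ 3 * α ^ 2 * ρ := by gcongr
    have c2 : α ^ 2 * (ρ ^ 2 * L ^ 2 * ε ^ 2 * R * d ^ 3) * 1 ≤
      α ^ 2 * (ρ ^ 2 * L ^ 2 * ε ^ 2 * R * d ^ 3) * ν := by gcongr
    linarith
  have e6 : (1 + 11 / 10 / ν) * y = y + y / ν + 1 / 10 / ν * y := by ring
  rw [e6]
  linarith

/-- The expected squared distance to the start of the block after one step. -/
lemma Admissible.integral_norm_sub_sq_le (h : Admissible m n r R ρ L α ε ν)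
    [IsProbabilityMeasure D] (S : IsSmoothStochastic F D L σ) {V : Blocks n r} (hV : IsGram V)
    (X Y : Weights m n) :
    Integrable (fun p : Blocks m r × Ξ => ‖X - α • lge F ε X p.1 V p.2 - Y‖ ^ 2)
      ((gaussianLaw m r).prod D) ∧
    ∫ p, ‖X - α • lge F ε X p.1 V p.2 - Y‖ ^ 2 ∂(gaussianLaw m r).prod D ≤
      (1 + 11 / 10 / ν) * ‖X - Y‖ ^ 2 +
        (22 * ρ ^ 2 * α ^ 2 * dim m n * ν * projSq V (gradient (objective F D) Y) +
          18 * ρ ^ 2 * α ^ 2 * dim m n * projNoise F D V Y +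
          9 * ρ ^ 2 * α ^ 2 * L ^ 2 * ε ^ 2 * R * ν * dim m n ^ 3) := by
  have hd := h.dim_pos
  have hα := h.α_pos
  have hL := h.L_pos
  have hν := h.one_le_ν
  have hν0 : 0 < ν := by linarith
  have hρ := h.ranks.one_le
  have hR := h.ranks.R_pos
  obtain ⟨h1i, h1b⟩ := integral_slope_mul_inner S h.ranks h.ε_pos hV X (X - Y)
    (τ := 1 / (2 * dim m n * ν * α)) (by positivity)
  obtain ⟨h2i, h2b⟩ := integral_slope_sq_mul S h.rows_pos h.ranks h.ε_pos hV X
  have e1 : ∀ p : Blocks m r × Ξ, ‖X - α • lge F ε X p.1 V p.2 - Y‖ ^ 2 =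
      ‖X - Y‖ ^ 2 - 2 * α * (slope F ε X p.1 V p.2 * inner ℝ (X - Y) (scaledDirection p.1 V)) +
        α ^ 2 * (slope F ε X p.1 V p.2 ^ 2 * ‖scaledDirection p.1 V‖ ^ 2) := by
    intro p
    rw [lge_eq, sub_right_comm, norm_sub_sq_real, inner_smul_right, inner_smul_right, norm_smul,
      norm_smul, mul_pow, mul_pow, Real.norm_eq_abs, Real.norm_eq_abs, sq_abs, sq_abs]
    ring
  simp_rw [e1]
  have hc : Integrable (fun _ : Blocks m r × Ξ => ‖X - Y‖ ^ 2) ((gaussianLaw m r).prod D) :=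
    integrable_const _
  have hcs : Integrable (fun p : Blocks m r × Ξ => ‖X - Y‖ ^ 2 -
      2 * α * (slope F ε X p.1 V p.2 * inner ℝ (X - Y) (scaledDirection p.1 V)))
      ((gaussianLaw m r).prod D) := hc.sub (h1i.const_mul _)
  refine ⟨hcs.add (h2i.const_mul _), ?_⟩
  rw [integral_add hcs (h2i.const_mul _), integral_sub hc (h1i.const_mul _), integral_const_mul,
    integral_const_mul]
  simp only [integral_const, probReal_univ, one_smul]
  set I1 := ∫ p, slope F ε X p.1 V p.2 * inner ℝ (X - Y) (scaledDirection p.1 V)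
    ∂(gaussianLaw m r).prod D
  set I2 := ∫ p, slope F ε X p.1 V p.2 ^ 2 * ‖scaledDirection p.1 V‖ ^ 2
    ∂(gaussianLaw m r).prod D
  have h3 := h.integral_projSq_stochGrad_le S hV X Y
  have h4 := h.projSq_gradient_le S hV X Y
  have h5 : projSq V (X - Y) ≤ dim m n * ‖X - Y‖ ^ 2 :=
    projSq_le h.rows_pos hV h.ranks.pos (X - Y)
  have h6 := abs_inner_proj_scaledProj_le V (gradient (objective F D) X) (X - Y)
    (τ := 1 / (2 * dim m n * ν * α)) (by positivity)
  set B := inner ℝ (proj V (gradient (objective F D) X)) (scaledProj V (X - Y))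
  set P := projSq V (gradient (objective F D) X)
  set p₀ := projSq V (gradient (objective F D) Y) with hp₀
  set N := projNoise F D V Y with hN
  set d := dim m n
  set y := ‖X - Y‖ ^ 2
  exact drift_bound hd hα hL hν hρ hR (projSq_nonneg _ _) (sq_nonneg _)
    h.step_le h1b h2b h3 h4 h5 h6

/-- The expected decrease of the objective in one step. -/
lemma Admissible.integral_objective_le (h : Admissible m n r R ρ L α ε ν)
    [IsProbabilityMeasure D] (S : IsSmoothStochastic F D L σ) {V : Blocks n r} (hV : IsGram V)
    (X Y : Weights m n) :
    ∫ p : Blocks m r × Ξ, objective F D (X - α • lge F ε X p.1 V p.2) ∂(gaussianLaw m r).prod D ≤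
      objective F D X - 5 / 16 * α * projSq V (gradient (objective F D) Y) +
        13 / 16 * α * dim m n * L ^ 2 * ‖X - Y‖ ^ 2 +
        9 * L * α ^ 2 * ρ ^ 2 * dim m n * projNoise F D V Y +
        4 / 5 * α * ρ * L ^ 2 * ε ^ 2 * R * dim m n ^ 2 := by
  have hd := h.dim_pos
  have hα := h.α_pos
  have hL := h.L_pos
  have hν := h.one_le_ν
  have hν0 : 0 < ν := by linarith
  have hρ := h.ranks.one_le
  have hR := h.ranks.R_pos
  -- With τ = 1/2 the smoothing bias consumes a quarter of the descent term, leaving 3/4.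
  obtain ⟨h1i, h1b⟩ := integral_slope_mul_inner S h.ranks h.ε_pos hV X
    (gradient (objective F D) X) (τ := 1 / 2) (by positivity)
  obtain ⟨h2i, h2b⟩ := integral_slope_sq_mul S h.rows_pos h.ranks h.ε_pos hV X
  set lin : Blocks m r × Ξ → ℝ := fun p => objective F D X -
    α * (slope F ε X p.1 V p.2 * inner ℝ (gradient (objective F D) X) (scaledDirection p.1 V))
    with hlin
  set quad : Blocks m r × Ξ → ℝ := fun p => L / 2 * α ^ 2 *
    (slope F ε X p.1 V p.2 ^ 2 * ‖scaledDirection p.1 V‖ ^ 2) with hquad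
  have hpt : ∀ p : Blocks m r × Ξ,
      |objective F D (X - α • lge F ε X p.1 V p.2) - lin p| ≤ quad p := by
    intro p
    have h3 := S.objective_abs_le X (-(α • lge F ε X p.1 V p.2))
    rw [lge_eq, inner_neg_right, norm_neg, inner_smul_right, inner_smul_right, norm_smul,
      norm_smul, mul_pow, mul_pow, Real.norm_eq_abs, Real.norm_eq_abs, sq_abs, sq_abs,
      ← sub_eq_add_neg] at h3
    rw [hlin, hquad, lge_eq]
    refine le_of_eq_of_le ?_ (h3.trans_eq ?_)
    · congr 1
      ring
    · ring
  have hlini : Integrable lin ((gaussianLaw m r).prod D) :=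
    (integrable_const _).sub (h1i.const_mul α)
  have hquadi : Integrable quad ((gaussianLaw m r).prod D) := h2i.const_mul _
  have hmeas : Measurable fun p : Blocks m r × Ξ =>
      objective F D (X - α • lge F ε X p.1 V p.2) := by
    refine S.objective_continuous.measurable.comp (measurable_const.sub (Measurable.const_smul ?_ α))
    exact (S.measurable_slope_fst_snd ε X V).smul (measurable_scaledDirection_fst V)
  have hint : Integrable (fun p : Blocks m r × Ξ =>
      objective F D (X - α • lge F ε X p.1 V p.2)) ((gaussianLaw m r).prod D) := by
    have h4 : Integrable (fun p : Blocks m r × Ξ =>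
        objective F D (X - α • lge F ε X p.1 V p.2) - lin p) ((gaussianLaw m r).prod D) :=
      hquadi.mono' (hmeas.aestronglyMeasurable.sub hlini.aestronglyMeasurable)
        (Filter.Eventually.of_forall hpt)
    refine (h4.add hlini).congr (Filter.Eventually.of_forall fun p => ?_)
    simp
  have hle : ∀ p : Blocks m r × Ξ,
      objective F D (X - α • lge F ε X p.1 V p.2) ≤ lin p + quad p := fun p => by
    have := (abs_le.1 (hpt p)).2
    linarith
  refine (integral_mono hint (hlini.add hquadi) hle).trans ?_
  have e1 : ∫ p, (lin + quad) p ∂(gaussianLaw m r).prod D =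
      ∫ p, lin p ∂(gaussianLaw m r).prod D + ∫ p, quad p ∂(gaussianLaw m r).prod D :=
    integral_add hlini hquadi
  have e2 : ∫ p, lin p ∂(gaussianLaw m r).prod D = objective F D X -
      α * ∫ p, slope F ε X p.1 V p.2 * inner ℝ (gradient (objective F D) X)
        (scaledDirection p.1 V) ∂(gaussianLaw m r).prod D := by
    rw [hlin, integral_sub (integrable_const _) (h1i.const_mul α), integral_const_mul]
    simp
  refine (e1.trans (by rw [e2, hquad, integral_const_mul])).le.trans ?_
  rw [← projSq_eq_inner] at h1b
  set I1 := ∫ p, slope F ε X p.1 V p.2 * inner ℝ (gradient (objective F D) X)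
    (scaledDirection p.1 V) ∂(gaussianLaw m r).prod D
  set I2 := ∫ p, slope F ε X p.1 V p.2 ^ 2 * ‖scaledDirection p.1 V‖ ^ 2
    ∂(gaussianLaw m r).prod D
  have h3 := h.integral_projSq_stochGrad_le S hV X Y
  have h4 := h.projSq_gradient_le S hV Y X
  rw [norm_sub_rev] at h4
  set P := projSq V (gradient (objective F D) X)
  set p₀ := projSq V (gradient (objective F D) Y) with hp₀
  set N := projNoise F D V Y with hN
  set d := dim m n
  set y := ‖X - Y‖ ^ 2
  have hp0 : 0 ≤ p₀ := projSq_nonneg _ _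
  have hN0 : 0 ≤ N := projNoise_nonneg _ _
  have hy0 : 0 ≤ y := sq_nonneg _
  have hs : ρ ^ 2 * L * d * α ≤ 1 / 144 := by
    refine le_trans ?_ h.step_le
    have : 0 ≤ ρ ^ 2 * L * d * α := by positivity
    have e : ρ ^ 2 * L * d * ν * α = ρ ^ 2 * L * d * α * ν := by ring
    rw [e]
    exact le_mul_of_one_le_right this hν
  have b1 : -(α * I1) ≤ -(3 / 4 * α * P) + 3 / 4 * α * ρ * L ^ 2 * ε ^ 2 * R * d ^ 2 := by
    have h7 := (abs_le.1 h1b).1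
    have e3 : 3 * ρ * L ^ 2 * ε ^ 2 * R * d ^ 2 / (8 * (1 / 2)) =
      3 / 4 * ρ * L ^ 2 * ε ^ 2 * R * d ^ 2 := by ring
    rw [e3] at h7
    have := mul_le_mul_of_nonneg_left h7 hα.le
    linarith
  have b2 : L / 2 * α ^ 2 * I2 ≤ L / 2 * α ^ 2 * (18 * ρ ^ 2 * d * (d * L ^ 2 * y + N + p₀) +
      15 / 2 * ρ ^ 2 * L ^ 2 * ε ^ 2 * R * d ^ 3) := by
    refine mul_le_mul_of_nonneg_left (h2b.trans ?_) (by positivity)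
    have := mul_le_mul_of_nonneg_left h3 (by positivity : 0 ≤ 6 * ρ ^ 2 * d)
    linarith
  -- The constant 144 in the step-size condition turns the factor 9 of the second-order term into
  -- 9/144 = 1/16.
  have b3 : 9 * L * α ^ 2 * ρ ^ 2 * d * (d * L ^ 2 * y + p₀) ≤
      1 / 16 * α * (d * L ^ 2 * y + p₀) := by
    have c : 9 * L * α ^ 2 * ρ ^ 2 * d * (d * L ^ 2 * y + p₀) =
        9 * (ρ ^ 2 * L * d * α) * (α * (d * L ^ 2 * y + p₀)) := by ring
    have c0 : 0 ≤ α * (d * L ^ 2 * y + p₀) := by positivity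
    rw [c]
    nlinarith
  have b4 : L / 2 * α ^ 2 * (15 / 2 * ρ ^ 2 * L ^ 2 * ε ^ 2 * R * d ^ 3) ≤
      1 / 20 * α * ρ * L ^ 2 * ε ^ 2 * R * d ^ 2 := by
    have c : L / 2 * α ^ 2 * (15 / 2 * ρ ^ 2 * L ^ 2 * ε ^ 2 * R * d ^ 3) =
        15 / 4 * (ρ ^ 2 * L * d * α) * (α * L ^ 2 * ε ^ 2 * R * d ^ 2) := by ring
    have c0 : 0 ≤ α * L ^ 2 * ε ^ 2 * R * d ^ 2 := by positivity
    have c1 : α * L ^ 2 * ε ^ 2 * R * d ^ 2 ≤ ρ * (α * L ^ 2 * ε ^ 2 * R * d ^ 2) :=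
      le_mul_of_one_le_left c0 hρ
    rw [c]
    nlinarith
  -- Moving the gradient from X to Y halves 3/4 to 3/8; subtracting 1/16 leaves the 5/16 of the
  -- statement, and the drift coefficient is 3/4 + 1/16 = 13/16.
  have b5 : α * p₀ ≤ α * (2 * P + 2 * (d * (L ^ 2 * y))) := mul_le_mul_of_nonneg_left h4 hα.le
  linarith

end Step

/-! ### Independence and conditioning -/

section Conditioning

variable {Ω A B : Type*} [MeasurableSpace Ω] [MeasurableSpace A] [MeasurableSpace B]
  {P : Measure Ω} [IsProbabilityMeasure P] {H : Ω → A} {W : Ω → B}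

/-- Fubini for the joint law, which is a product by independence. It serves as conditioning on `H`
without conditional expectations. -/
lemma integral_eq_integral_integral_of_indepFun (hH : Measurable H) (hW : Measurable W)
    (hind : IndepFun H W P) {Φ : A × B → ℝ} (hΦ : Measurable Φ)
    (hi : Integrable (fun ω => Φ (H ω, W ω)) P) :
    Integrable (fun ω => ∫ w, Φ (H ω, w) ∂P.map W) P ∧
      ∫ ω, Φ (H ω, W ω) ∂P = ∫ ω, ∫ w, Φ (H ω, w) ∂P.map W ∂P := by
  have hlaw := (indepFun_iff_map_prod_eq_prod_map_map hH.aemeasurable hW.aemeasurable).1 hind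
  have hHW : Measurable fun ω => (H ω, W ω) := hH.prodMk hW
  have := Measure.isProbabilityMeasure_map (μ := P) hW.aemeasurable
  have := Measure.isProbabilityMeasure_map (μ := P) hH.aemeasurable
  have hi' : Integrable Φ ((P.map H).prod (P.map W)) := by
    rw [← hlaw]
    exact (integrable_map_measure hΦ.aestronglyMeasurable hHW.aemeasurable).2 hi
  refine ⟨hi'.integral_prod_left.comp_measurable hH, ?_⟩
  rw [← integral_map (f := Φ) hHW.aemeasurable hΦ.aestronglyMeasurable, hlaw,
    integral_prod _ hi', integral_map hH.aemeasurable hi'.integral_prod_left.aestronglyMeasurable]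

/-- Tonelli for nonnegative functions: an integrable bound on the inner integrals gives joint
integrability, which is not known beforehand. -/
lemma integrable_of_indepFun (hH : Measurable H) (hW : Measurable W)
    (hind : IndepFun H W P) {Φ : A × B → ℝ} (hΦ : Measurable Φ) (hnn : ∀ p, 0 ≤ Φ p)
    {Ψ : Ω → ℝ} (hΨ : Integrable Ψ P)
    (hle : ∀ᵐ ω ∂P, Integrable (fun w => Φ (H ω, w)) (P.map W) ∧
      ∫ w, Φ (H ω, w) ∂P.map W ≤ Ψ ω) :
    Integrable (fun ω => Φ (H ω, W ω)) P := by
  have hlaw := (indepFun_iff_map_prod_eq_prod_map_map hH.aemeasurable hW.aemeasurable).1 hind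
  have hHW : Measurable fun ω => (H ω, W ω) := hH.prodMk hW
  have := Measure.isProbabilityMeasure_map (μ := P) hW.aemeasurable
  have := Measure.isProbabilityMeasure_map (μ := P) hH.aemeasurable
  have hlint : ∫⁻ ω, ENNReal.ofReal (Φ (H ω, W ω)) ∂P ≤ ∫⁻ ω, ENNReal.ofReal (Ψ ω) ∂P := by
    rw [← lintegral_map (f := fun p => ENNReal.ofReal (Φ p)) hΦ.ennreal_ofReal hHW, hlaw,
      lintegral_prod _ hΦ.ennreal_ofReal.aemeasurable,
      lintegral_map (hΦ.ennreal_ofReal.lintegral_prod_right') hH]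
    refine lintegral_mono_ae ?_
    filter_upwards [hle] with ω hω
    rw [← ofReal_integral_eq_lintegral_ofReal hω.1 (Filter.Eventually.of_forall fun w => hnn _)]
    exact ENNReal.ofReal_le_ofReal hω.2
  refine ⟨(hΦ.comp hHW).aestronglyMeasurable, ?_⟩
  rw [hasFiniteIntegral_iff_ofReal (Filter.Eventually.of_forall fun ω => hnn _)]
  refine hlint.trans_lt ?_
  refine lt_of_le_of_lt (lintegral_mono fun ω => ?_) hΨ.2
  rw [← ofReal_norm]
  exact ENNReal.ofReal_le_ofReal (le_abs_self _)

end Conditioning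

section Sampling

variable {q : ℕ} {m n r : Fin q → ℕ} {Ξ Ω : Type*} [MeasurableSpace Ξ] [mΩ : MeasurableSpace Ω]
  {F : Weights m n → Ξ → ℝ} {D : Measure Ξ} {L σ α ε : ℝ} {ν : ℕ}
  {P : Measure Ω} {Q : Measure (Blocks n r)}
  {U : ℕ → Ω → Blocks m r} {V : ℕ → Ω → Blocks n r} {ξ : ℕ → Ω → Ξ} {X₀ : Weights m n}

/-- The σ-algebras generated by the individual samples. -/
abbrev sampleAlgebra (U : ℕ → Ω → Blocks m r) (V : ℕ → Ω → Blocks n r) (ξ : ℕ → Ω → Ξ) :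
    ℕ ⊕ (ℕ ⊕ ℕ) → MeasurableSpace Ω :=
  Sum.elim (fun t : ℕ => MeasurableSpace.comap (U t) inferInstance)
    (Sum.elim (fun k : ℕ => MeasurableSpace.comap (V k) inferInstance)
      (fun t : ℕ => MeasurableSpace.comap (ξ t) inferInstance))

/-- The σ-algebra generated by a set of samples. -/
abbrev algebraOf (U : ℕ → Ω → Blocks m r) (V : ℕ → Ω → Blocks n r) (ξ : ℕ → Ω → Ξ)
    (s : Set (ℕ ⊕ (ℕ ⊕ ℕ))) : MeasurableSpace Ω := ⨆ i ∈ s, sampleAlgebra U V ξ i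

omit mΩ in
lemma measurable_U_algebraOf {s : Set (ℕ ⊕ (ℕ ⊕ ℕ))} {t : ℕ} (h : Sum.inl t ∈ s) :
    Measurable[algebraOf U V ξ s] (U t) :=
  measurable_iff_comap_le.2 (le_iSup₂_of_le (Sum.inl t) h le_rfl)

omit mΩ in
lemma measurable_V_algebraOf {s : Set (ℕ ⊕ (ℕ ⊕ ℕ))} {k : ℕ} (h : Sum.inr (Sum.inl k) ∈ s) :
    Measurable[algebraOf U V ξ s] (V k) :=
  measurable_iff_comap_le.2 (le_iSup₂_of_le (Sum.inr (Sum.inl k)) h le_rfl)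

omit mΩ in
lemma measurable_ξ_algebraOf {s : Set (ℕ ⊕ (ℕ ⊕ ℕ))} {t : ℕ} (h : Sum.inr (Sum.inr t) ∈ s) :
    Measurable[algebraOf U V ξ s] (ξ t) :=
  measurable_iff_comap_le.2 (le_iSup₂_of_le (Sum.inr (Sum.inr t)) h le_rfl)

omit mΩ in
lemma measurable_prodMk_of {𝒢 : MeasurableSpace Ω} {A B : Type*} [MeasurableSpace A]
    [MeasurableSpace B] {f : Ω → A} {g : Ω → B} (hf : Measurable[𝒢] f) (hg : Measurable[𝒢] g) :
    Measurable[𝒢] fun ω => (f ω, g ω) := hf.prodMk hg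

/-- The iterates as random variables. -/
def path (F : Weights m n → Ξ → ℝ) (α ε : ℝ) (ν : ℕ) (X₀ : Weights m n)
    (U : ℕ → Ω → Blocks m r) (V : ℕ → Ω → Blocks n r) (ξ : ℕ → Ω → Ξ) (t : ℕ) (ω : Ω) :
    Weights m n :=
  iterate F α ε ν X₀ (fun t => U t ω) (fun j => V j ω) (fun t => ξ t ω) t

lemma IsSmoothStochastic.measurable_step (S : IsSmoothStochastic F D L σ) (α ε : ℝ) :
    Measurable fun p : Weights m n × Blocks m r × Blocks n r × Ξ =>
      p.1 - α • lge F ε p.1 p.2.1 p.2.2.1 p.2.2.2 := by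
  have h1 : Measurable fun p : Weights m n × Blocks m r × Blocks n r × Ξ => (p.2.1, p.2.2.1) :=
    measurable_snd.fst.prodMk measurable_snd.snd.fst
  have h2 := (measurable_scaledDirection (m := m) (n := n) (r := r)).comp h1
  have h3 : Measurable fun p : Weights m n × Blocks m r × Blocks n r × Ξ =>
      lge F ε p.1 p.2.1 p.2.2.1 p.2.2.2 := (S.measurable_slope ε).smul h2
  exact measurable_fst.sub (h3.const_smul α)

omit mΩ in
-- The iterate at time t sees only the samples of steps before t. Stating this for an arbitrary
-- index set `s` lets one lemma serve every independence claim.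
lemma IsSmoothStochastic.measurable_path (S : IsSmoothStochastic F D L σ)
    {s : Set (ℕ ⊕ (ℕ ⊕ ℕ))} (t : ℕ)
    (h : ∀ i < t, Sum.inl i ∈ s ∧ Sum.inr (Sum.inl (i / ν)) ∈ s ∧ Sum.inr (Sum.inr i) ∈ s) :
    Measurable[algebraOf U V ξ s] (path F α ε ν X₀ U V ξ t) := by
  induction t with
  | zero => exact @measurable_const _ _ _ (algebraOf U V ξ s) X₀
  | succ t ih =>
    have h1 := ih fun i hi => h i (by omega)
    obtain ⟨h2, h3, h4⟩ := h t (by omega)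
    have h5 := measurable_prodMk_of (measurable_V_algebraOf (U := U) (V := V) (ξ := ξ) h3)
      (measurable_ξ_algebraOf (U := U) (V := V) (ξ := ξ) h4)
    have h6 := measurable_prodMk_of (measurable_U_algebraOf (U := U) (V := V) (ξ := ξ) h2) h5
    have h7 := measurable_prodMk_of h1 h6
    exact (S.measurable_step (r := r) α ε).comp h7

namespace IsSampling

variable (s : IsSampling P D Q U V ξ)
include s

lemma sampleAlgebra_le (i) : sampleAlgebra U V ξ i ≤ mΩ := by
  rcases i with t | k | t
  · exact (s.measurable_U t).comap_le
  · exact (s.measurable_V k).comap_le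
  · exact (s.measurable_ξ t).comap_le

lemma algebraOf_le (S : Set (ℕ ⊕ (ℕ ⊕ ℕ))) : algebraOf U V ξ S ≤ mΩ :=
  iSup₂_le fun i _ => s.sampleAlgebra_le i

lemma indepFun {A B : Type*} [mA : MeasurableSpace A] [mB : MeasurableSpace B]
    {f : Ω → A} {g : Ω → B}
    {S T : Set (ℕ ⊕ (ℕ ⊕ ℕ))} (hST : Disjoint S T) (hf : Measurable[algebraOf U V ξ S] f)
    (hg : Measurable[algebraOf U V ξ T] g) : IndepFun f g P := by
  have h := indep_iSup_of_disjoint (m := sampleAlgebra U V ξ) s.sampleAlgebra_le s.indep hST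
  rw [IndepFun_iff_Indep]
  exact indep_of_indep_of_le_left (indep_of_indep_of_le_right h hg.comap_le) hf.comap_le

lemma measurable_path' (S : IsSmoothStochastic F D L σ) (t : ℕ) :
    Measurable (path F α ε ν X₀ U V ξ t) :=
  (S.measurable_path (s := Set.univ) t fun _ _ => ⟨trivial, trivial, trivial⟩).mono
    (s.algebraOf_le _) le_rfl

lemma map_prodMk [IsProbabilityMeasure P] (t : ℕ) :
    P.map (fun ω => (U t ω, ξ t ω)) = (gaussianLaw m r).prod D := by
  have h : IndepFun (U t) (ξ t) P := s.indepFun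
    (S := {Sum.inl t}) (T := {Sum.inr (Sum.inr t)}) (by simp)
    (measurable_U_algebraOf (Set.mem_singleton _)) (measurable_ξ_algebraOf (Set.mem_singleton _))
  rw [(indepFun_iff_map_prod_eq_prod_map_map (s.measurable_U t).aemeasurable
    (s.measurable_ξ t).aemeasurable).1 h, s.law_U, s.law_ξ]

/-- The samples of step `t` are independent of the past and of all subspaces. -/
lemma indepFun_history (S : IsSmoothStochastic F D L σ) {t₀ t : ℕ} (ht : t₀ ≤ t) (k : ℕ) :
    IndepFun (fun ω => (V k ω, path F α ε ν X₀ U V ξ t₀ ω, path F α ε ν X₀ U V ξ t ω))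
      (fun ω => (U t ω, ξ t ω)) P := by
  -- All subspaces are placed in the history, since only U and ξ of step t are to be fresh.
  set A : Set (ℕ ⊕ (ℕ ⊕ ℕ)) := {i | Sum.elim (fun i => i < t) (Sum.elim (fun _ => True)
    (fun i => i < t)) i} with hA
  set B : Set (ℕ ⊕ (ℕ ⊕ ℕ)) := {Sum.inl t, Sum.inr (Sum.inr t)} with hB
  have hdisj : Disjoint A B := by
    rw [Set.disjoint_left]
    rintro i hi (rfl | rfl)
    · simp [hA] at hi
    · simp [hA] at hi
  have hp : ∀ t', t' ≤ t → Measurable[algebraOf U V ξ A] (path F α ε ν X₀ U V ξ t') :=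
    fun t' ht' => S.measurable_path t' fun i hi => ⟨show i < t by omega, trivial, show i < t by omega⟩
  refine s.indepFun hdisj ?_ ?_
  · have hV : Measurable[algebraOf U V ξ A] (V k) := measurable_V_algebraOf (by simp [hA])
    exact measurable_prodMk_of hV (measurable_prodMk_of (hp t₀ ht) (hp t le_rfl))
  · have hU : Measurable[algebraOf U V ξ B] (U t) := measurable_U_algebraOf (by simp [hB])
    have hξ : Measurable[algebraOf U V ξ B] (ξ t) := measurable_ξ_algebraOf (by simp [hB])
    exact measurable_prodMk_of hU hξ

/-- The iterate at the start of a block is independent of the subspace of the block. -/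
lemma indepFun_path_V (S : IsSmoothStochastic F D L σ) (hν : 0 < ν) (k : ℕ) :
    IndepFun (path F α ε ν X₀ U V ξ (k * ν)) (V k) P := by
  -- Before time kν only the subspaces with index below k have been used, because i < kν gives i / ν
  -- < k.
  set A : Set (ℕ ⊕ (ℕ ⊕ ℕ)) := {i | Sum.elim (fun _ => True) (Sum.elim (fun j => j < k)
    (fun _ => True)) i} with hA
  refine s.indepFun (S := A) (T := {Sum.inr (Sum.inl k)}) ?_ ?_
    (measurable_V_algebraOf (Set.mem_singleton _))
  · rw [Set.disjoint_singleton_right]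
    simp [hA]
  · exact S.measurable_path _ fun i hi =>
      ⟨trivial, (Nat.div_lt_iff_lt_mul hν).2 hi, trivial⟩

lemma ae_isGram (hQ : IsSubspaceLaw Q) (k : ℕ) : ∀ᵐ ω ∂P, IsGram (V k ω) :=
  ae_of_ae_map (s.measurable_V k).aemeasurable (by rw [s.law_V k]; exact hQ.gram)

end IsSampling

end Sampling

/-! ### Expectations along the iterates -/

section Path

variable {q : ℕ} {m n r : Fin q → ℕ} {Ξ Ω : Type*} [MeasurableSpace Ξ] [mΩ : MeasurableSpace Ω]
  {F : Weights m n → Ξ → ℝ} {D : Measure Ξ} {L σ α ε R ρ : ℝ} {ν : ℕ}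
  {P : Measure Ω} {Q : Measure (Blocks n r)}
  {U : ℕ → Ω → Blocks m r} {V : ℕ → Ω → Blocks n r} {ξ : ℕ → Ω → Ξ} {X₀ : Weights m n}

/-- A worst-case bound with the extra factor d, used only for integrability; the quantitative
argument uses the bound averaged over V. -/
lemma projNoise_le [IsProbabilityMeasure D] (S : IsSmoothStochastic F D L σ)
    (hm : ∀ l, 0 < m l) (hr : ∀ l, 0 < r l) {V : Blocks n r} (hV : IsGram V) (X : Weights m n) :
    projNoise F D V X ≤ dim m n * σ ^ 2 := by
  have h1 : projNoise F D V X ≤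
      ∫ z, dim m n * ‖stochGrad F X z - gradient (objective F D) X‖ ^ 2 ∂D :=
    integral_mono (integrable_projSq_stochGrad S hm hr hV X _)
      ((S.sq_integrable X).const_mul _) fun z => projSq_le hm hV hr _
  rw [integral_const_mul] at h1
  exact h1.trans (mul_le_mul_of_nonneg_left (S.variance_le X) (dim_nonneg m n))

lemma IsSmoothStochastic.measurable_projSq_noise [IsProbabilityMeasure D]
    (S : IsSmoothStochastic F D L σ) :
    Measurable fun p : (Weights m n × Blocks n r) × Ξ =>
      projSq p.1.2 (stochGrad F p.1.1 p.2 - gradient (objective F D) p.1.1) := by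
  have h1 : Measurable fun p : (Weights m n × Blocks n r) × Ξ => stochGrad F p.1.1 p.2 :=
    S.measurable_stochGrad.comp (measurable_fst.fst.prodMk measurable_snd)
  have h2 : Measurable fun p : (Weights m n × Blocks n r) × Ξ =>
      gradient (objective F D) p.1.1 :=
    S.gradient_continuous.measurable.comp measurable_fst.fst
  have h3 : Measurable fun p : (Weights m n × Blocks n r) × Ξ =>
      (p.1.2, stochGrad F p.1.1 p.2 - gradient (objective F D) p.1.1) :=
    measurable_fst.snd.prodMk (h1.sub h2)
  have h4 := (measurable_projSq (m := m) (n := n) (r := r)).comp h3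
  exact h4

lemma IsSmoothStochastic.measurable_projNoise [IsProbabilityMeasure D]
    (S : IsSmoothStochastic F D L σ) :
    Measurable fun p : Weights m n × Blocks n r => projNoise F D p.2 p.1 :=
  S.measurable_projSq_noise.stronglyMeasurable.integral_prod_right'.measurable

lemma IsSmoothStochastic.measurable_projSq_gradient [IsProbabilityMeasure D]
    (S : IsSmoothStochastic F D L σ) :
    Measurable fun p : Weights m n × Blocks n r => projSq p.2 (gradient (objective F D) p.1) := by
  have h3 : Measurable fun p : Weights m n × Blocks n r =>
      (p.2, gradient (objective F D) p.1) :=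
    measurable_snd.prodMk (S.gradient_continuous.measurable.comp measurable_fst)
  have h4 := (measurable_projSq (m := m) (n := n) (r := r)).comp h3
  exact h4

/-- Exchanging the order of integration, V is averaged first for fixed ξ, which turns the projected
noise into the full squared noise. -/
lemma IsSubspaceLaw.integral_projNoise_le [IsProbabilityMeasure D] [IsProbabilityMeasure Q]
    (hQ : IsSubspaceLaw Q) (S : IsSmoothStochastic F D L σ) (hr : ∀ l, 0 < r l)
    (X : Weights m n) : ∫ V, projNoise F D V X ∂Q ≤ σ ^ 2 := by
  have hmeas : Measurable fun p : Blocks n r × Ξ =>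
      projSq p.1 (stochGrad F X p.2 - gradient (objective F D) X) := by
    have h0 : Measurable fun p : Blocks n r × Ξ => ((X, p.1), p.2) :=
      (measurable_const.prodMk measurable_fst).prodMk measurable_snd
    have h1 := (S.measurable_projSq_noise (r := r)).comp h0
    exact h1
  have hfib := fun z => integral_projSq hQ hr (stochGrad F X z - gradient (objective F D) X)
  have hi : Integrable (fun p : Blocks n r × Ξ =>
      projSq p.1 (stochGrad F X p.2 - gradient (objective F D) X)) (Q.prod D) := by
    rw [integrable_prod_iff' hmeas.aestronglyMeasurable]
    refine ⟨Filter.Eventually.of_forall fun z => (hfib z).1, ?_⟩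
    simp_rw [Real.norm_of_nonneg (projSq_nonneg _ _), (hfib _).2]
    exact S.sq_integrable X
  have h1 := integral_prod _ hi
  rw [integral_prod_symm _ hi] at h1
  simp only [(hfib _).2] at h1
  exact h1.symm.le.trans (S.variance_le X)

namespace IsSampling

variable [IsProbabilityMeasure D] [IsProbabilityMeasure P] [IsProbabilityMeasure Q]
  (s : IsSampling P D Q U V ξ) (hQ : IsSubspaceLaw Q) (S : IsSmoothStochastic F D L σ)
  (h : Admissible m n r R ρ L α ε ν)
include s hQ S h

omit [IsProbabilityMeasure Q] in
-- Induction with the drift estimate applied at Y = `X₀`, whatever the block. This square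
-- integrability yields all other integrability claims about the path that depend on growth.
lemma integrable_norm_sub_initial (t : ℕ) :
    Integrable (fun ω => ‖path F α ε ν X₀ U V ξ t ω - X₀‖ ^ 2) P := by
  induction t with
  | zero =>
    have : ∀ ω, path F α ε ν X₀ U V ξ 0 ω = X₀ := fun _ => rfl
    simp [this]
  | succ t ih =>
    have hν : (0 : ℝ) < ν := by linarith [h.one_le_ν]
    have hR := h.ranks.R_pos
    set Φ : (Blocks n r × Weights m n × Weights m n) × (Blocks m r × Ξ) → ℝ := fun p =>
      ‖p.1.2.2 - α • lge F ε p.1.2.2 p.2.1 p.1.1 p.2.2 - p.1.2.1‖ ^ 2 with hΦ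
    have hstep : Measurable fun p : (Blocks n r × Weights m n × Weights m n) × (Blocks m r × Ξ) =>
        p.1.2.2 - α • lge F ε p.1.2.2 p.2.1 p.1.1 p.2.2 :=
      (S.measurable_step (r := r) α ε).comp (measurable_fst.snd.snd.prodMk
        (measurable_snd.fst.prodMk (measurable_fst.fst.prodMk measurable_snd.snd)))
    have hΦm : Measurable Φ := (hstep.sub measurable_fst.snd.fst).norm.pow_const 2
    have hHm : Measurable fun ω => (V (t / ν) ω, path F α ε ν X₀ U V ξ 0 ω,
        path F α ε ν X₀ U V ξ t ω) :=
      (s.measurable_V _).prodMk ((s.measurable_path' S 0).prodMk (s.measurable_path' S t))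
    have hWm : Measurable fun ω => (U t ω, ξ t ω) := (s.measurable_U t).prodMk (s.measurable_ξ t)
    set c := 22 * ρ ^ 2 * α ^ 2 * dim m n * ν * (dim m n * ‖gradient (objective F D) X₀‖ ^ 2) +
      18 * ρ ^ 2 * α ^ 2 * dim m n * (dim m n * σ ^ 2) +
      9 * ρ ^ 2 * α ^ 2 * L ^ 2 * ε ^ 2 * R * ν * dim m n ^ 3 with hc
    have hΨ : Integrable (fun ω => (1 + 11 / 10 / (ν : ℝ)) *
        ‖path F α ε ν X₀ U V ξ t ω - X₀‖ ^ 2 + c) P :=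
      (ih.const_mul _).add (integrable_const c)
    refine integrable_of_indepFun (Φ := Φ) hHm hWm (s.indepFun_history S (Nat.zero_le t) (t / ν))
      hΦm (fun p => sq_nonneg _) hΨ ?_
    filter_upwards [s.ae_isGram hQ (t / ν)] with ω hω
    rw [s.map_prodMk t]
    obtain ⟨h1, h2⟩ := h.integral_norm_sub_sq_le S hω (path F α ε ν X₀ U V ξ t ω) X₀
    refine ⟨h1, h2.trans ?_⟩
    have hd := dim_nonneg m n
    have h3 : _ ≤ dim m n * _ := projSq_le h.rows_pos hω h.ranks.pos (gradient (objective F D) X₀)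
    have h4 := projNoise_le S h.rows_pos h.ranks.pos hω X₀
    rw [hc]
    gcongr

omit [IsProbabilityMeasure Q] in
lemma integrable_norm_sub (t t' : ℕ) :
    Integrable (fun ω => ‖path F α ε ν X₀ U V ξ t ω - path F α ε ν X₀ U V ξ t' ω‖ ^ 2) P := by
  have h1 := s.integrable_norm_sub_initial hQ S h (X₀ := X₀) t
  have h2 := s.integrable_norm_sub_initial hQ S h (X₀ := X₀) t'
  refine ((h1.const_mul 2).add (h2.const_mul 2)).mono'
    (((s.measurable_path' S t).sub (s.measurable_path' S t')).norm.pow_const 2).aestronglyMeasurable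
    (Filter.Eventually.of_forall fun ω => ?_)
  rw [Real.norm_of_nonneg (sq_nonneg _)]
  have h3 := norm_sub_le_norm_sub_add_norm_sub (path F α ε ν X₀ U V ξ t ω) X₀
    (path F α ε ν X₀ U V ξ t' ω)
  rw [norm_sub_rev X₀] at h3
  have h4 := norm_nonneg (path F α ε ν X₀ U V ξ t ω - path F α ε ν X₀ U V ξ t' ω)
  simp only [Pi.add_apply]
  nlinarith [sq_nonneg (‖path F α ε ν X₀ U V ξ t ω - X₀‖ - ‖path F α ε ν X₀ U V ξ t' ω - X₀‖)]

omit [IsProbabilityMeasure Q] in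
lemma integrable_gradient_sq (t : ℕ) :
    Integrable (fun ω => ‖gradient (objective F D) (path F α ε ν X₀ U V ξ t ω)‖ ^ 2) P := by
  have h1 := s.integrable_norm_sub_initial hQ S h (X₀ := X₀) t
  have h2 : Integrable (fun _ : Ω => 2 * ‖gradient (objective F D) X₀‖ ^ 2) P := integrable_const _
  refine ((h1.const_mul (2 * L ^ 2)).add h2).mono'
    ((S.gradient_continuous.measurable.comp
      (s.measurable_path' S t)).norm.pow_const 2).aestronglyMeasurable
    (Filter.Eventually.of_forall fun ω => ?_)
  rw [Real.norm_of_nonneg (sq_nonneg _)]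
  set X := path F α ε ν X₀ U V ξ t ω
  have h3 := S.objective_lipschitz X X₀
  have h4 := norm_le_norm_add_norm_sub (gradient (objective F D) X₀) (gradient (objective F D) X)
  rw [norm_sub_rev] at h4
  have h5 : ‖gradient (objective F D) X‖ ^ 2 ≤ (‖gradient (objective F D) X₀‖ + L * ‖X - X₀‖) ^ 2 :=
    pow_le_pow_left₀ (norm_nonneg _) (by linarith) 2
  simp only [Pi.add_apply]
  nlinarith [sq_nonneg (‖gradient (objective F D) X₀‖ - L * ‖X - X₀‖)]

omit [IsProbabilityMeasure Q] in
lemma integrable_objective (t : ℕ) :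
    Integrable (fun ω => objective F D (path F α ε ν X₀ U V ξ t ω)) P := by
  have h1 := s.integrable_norm_sub_initial hQ S h (X₀ := X₀) t
  have h2 : Integrable (fun _ : Ω => |objective F D X₀| +
      ‖gradient (objective F D) X₀‖ ^ 2) P := integrable_const _
  refine ((h1.const_mul (1 + L / 2)).add h2).mono'
    (S.objective_continuous.measurable.comp (s.measurable_path' S t)).aestronglyMeasurable
    (Filter.Eventually.of_forall fun ω => ?_)
  set X := path F α ε ν X₀ U V ξ t ω
  have h3 := S.objective_abs_le X₀ (X - X₀)
  rw [add_sub_cancel] at h3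
  have h4 := abs_real_inner_le_norm (gradient (objective F D) X₀) (X - X₀)
  have h5 : ‖gradient (objective F D) X₀‖ * ‖X - X₀‖ ≤
      ‖gradient (objective F D) X₀‖ ^ 2 + ‖X - X₀‖ ^ 2 := by
    nlinarith [sq_nonneg (‖gradient (objective F D) X₀‖ - ‖X - X₀‖),
      sq_nonneg ‖gradient (objective F D) X₀‖, sq_nonneg ‖X - X₀‖]
  simp only [Pi.add_apply, Real.norm_eq_abs]
  have h6 := abs_le.1 h3
  have h7 := abs_le.1 h4
  have h8 := neg_abs_le (objective F D X₀)
  have h9 := le_abs_self (objective F D X₀)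
  rw [abs_le]
  constructor <;> linarith [h6.1, h6.2, h7.1, h7.2]

omit [IsProbabilityMeasure Q] in
lemma integrable_projSq_gradient (k t : ℕ) : Integrable (fun ω =>
    projSq (V k ω) (gradient (objective F D) (path F α ε ν X₀ U V ξ t ω))) P := by
  refine ((s.integrable_gradient_sq hQ S h (X₀ := X₀) t).const_mul (dim m n)).mono'
    (S.measurable_projSq_gradient.comp
      ((s.measurable_path' S t).prodMk (s.measurable_V k))).aestronglyMeasurable ?_
  filter_upwards [s.ae_isGram hQ k] with ω hω
  rw [Real.norm_of_nonneg (projSq_nonneg _ _)]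
  exact projSq_le h.rows_pos hω h.ranks.pos _

omit [IsProbabilityMeasure Q] in
lemma integrable_projNoise (k t : ℕ) :
    Integrable (fun ω => projNoise F D (V k ω) (path F α ε ν X₀ U V ξ t ω)) P := by
  refine (integrable_const (dim m n * σ ^ 2)).mono'
    (S.measurable_projNoise.comp
      ((s.measurable_path' S t).prodMk (s.measurable_V k))).aestronglyMeasurable ?_
  filter_upwards [s.ae_isGram hQ k] with ω hω
  rw [Real.norm_of_nonneg (projNoise_nonneg _ _)]
  exact projNoise_le S h.rows_pos h.ranks.pos hω _

/-- Here V is averaged out of the gradient term, which is possible only at the start of a block. -/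
lemma integral_projSq_gradient (hν : 0 < ν) (k : ℕ) :
    ∫ ω, projSq (V k ω) (gradient (objective F D) (path F α ε ν X₀ U V ξ (k * ν) ω)) ∂P =
      ∫ ω, ‖gradient (objective F D) (path F α ε ν X₀ U V ξ (k * ν) ω)‖ ^ 2 ∂P := by
  have h1 := integral_eq_integral_integral_of_indepFun (s.measurable_path' S (k * ν))
    (s.measurable_V k) (s.indepFun_path_V S hν k)
    (Φ := fun p => projSq p.2 (gradient (objective F D) p.1)) S.measurable_projSq_gradient
    (s.integrable_projSq_gradient hQ S h (X₀ := X₀) k (k * ν))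
  rw [h1.2, s.law_V]
  simp_rw [(integral_projSq hQ h.ranks.pos _).2]

lemma integral_projNoise_le (hν : 0 < ν) (k : ℕ) :
    ∫ ω, projNoise F D (V k ω) (path F α ε ν X₀ U V ξ (k * ν) ω) ∂P ≤ σ ^ 2 := by
  have h1 := integral_eq_integral_integral_of_indepFun (s.measurable_path' S (k * ν))
    (s.measurable_V k) (s.indepFun_path_V S hν k)
    (Φ := fun p => projNoise F D p.2 p.1) S.measurable_projNoise
    (s.integrable_projNoise hQ S h (X₀ := X₀) k (k * ν))
  rw [h1.2]
  rw [s.law_V] at h1 ⊢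
  refine (integral_mono h1.1 (integrable_const (σ ^ 2)) fun ω =>
    hQ.integral_projNoise_le S h.ranks.pos _).trans ?_
  simp

omit [IsProbabilityMeasure Q] in
lemma integral_norm_sub_succ_le {t₀ t : ℕ} (ht : t₀ ≤ t) :
    ∫ ω, ‖path F α ε ν X₀ U V ξ (t + 1) ω - path F α ε ν X₀ U V ξ t₀ ω‖ ^ 2 ∂P ≤
      (1 + 11 / 10 / (ν : ℝ)) *
        ∫ ω, ‖path F α ε ν X₀ U V ξ t ω - path F α ε ν X₀ U V ξ t₀ ω‖ ^ 2 ∂P +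
        (22 * ρ ^ 2 * α ^ 2 * dim m n * ν * ∫ ω, projSq (V (t / ν) ω)
            (gradient (objective F D) (path F α ε ν X₀ U V ξ t₀ ω)) ∂P +
          18 * ρ ^ 2 * α ^ 2 * dim m n *
            ∫ ω, projNoise F D (V (t / ν) ω) (path F α ε ν X₀ U V ξ t₀ ω) ∂P +
          9 * ρ ^ 2 * α ^ 2 * L ^ 2 * ε ^ 2 * R * ν * dim m n ^ 3) := by
  set Φ : (Blocks n r × Weights m n × Weights m n) × (Blocks m r × Ξ) → ℝ := fun p =>
    ‖p.1.2.2 - α • lge F ε p.1.2.2 p.2.1 p.1.1 p.2.2 - p.1.2.1‖ ^ 2 with hΦ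
  have hstep : Measurable fun p : (Blocks n r × Weights m n × Weights m n) × (Blocks m r × Ξ) =>
      p.1.2.2 - α • lge F ε p.1.2.2 p.2.1 p.1.1 p.2.2 :=
    (S.measurable_step (r := r) α ε).comp (measurable_fst.snd.snd.prodMk
      (measurable_snd.fst.prodMk (measurable_fst.fst.prodMk measurable_snd.snd)))
  have hΦm : Measurable Φ := (hstep.sub measurable_fst.snd.fst).norm.pow_const 2
  have hHm : Measurable fun ω => (V (t / ν) ω, path F α ε ν X₀ U V ξ t₀ ω,
      path F α ε ν X₀ U V ξ t ω) :=
    (s.measurable_V _).prodMk ((s.measurable_path' S t₀).prodMk (s.measurable_path' S t))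
  have hWm : Measurable fun ω => (U t ω, ξ t ω) := (s.measurable_U t).prodMk (s.measurable_ξ t)
  obtain ⟨hi, he⟩ := integral_eq_integral_integral_of_indepFun (Φ := Φ) hHm hWm
    (s.indepFun_history S ht (t / ν)) hΦm (s.integrable_norm_sub hQ S h (X₀ := X₀) (t + 1) t₀)
  have i1 := (s.integrable_norm_sub hQ S h (X₀ := X₀) t t₀).const_mul (1 + 11 / 10 / (ν : ℝ))
  have i2 := (s.integrable_projSq_gradient hQ S h (X₀ := X₀) (t / ν) t₀).const_mul
    (22 * ρ ^ 2 * α ^ 2 * dim m n * ν)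
  have i3 := (s.integrable_projNoise hQ S h (X₀ := X₀) (t / ν) t₀).const_mul
    (18 * ρ ^ 2 * α ^ 2 * dim m n)
  have i4 : Integrable (fun _ : Ω => 9 * ρ ^ 2 * α ^ 2 * L ^ 2 * ε ^ 2 * R * ν * dim m n ^ 3) P :=
    integrable_const _
  have h1 : ∫ ω, ‖path F α ε ν X₀ U V ξ (t + 1) ω - path F α ε ν X₀ U V ξ t₀ ω‖ ^ 2 ∂P ≤ _ :=
    he.le.trans (integral_mono_ae hi (i1.add ((i2.add i3).add i4)) (by
      filter_upwards [s.ae_isGram hQ (t / ν)] with ω hω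
      rw [s.map_prodMk t]
      exact (h.integral_norm_sub_sq_le S hω (path F α ε ν X₀ U V ξ t ω)
        (path F α ε ν X₀ U V ξ t₀ ω)).2))
  rw [integral_add' i1 ((i2.add i3).add i4), integral_add' (i2.add i3) i4, integral_add' i2 i3,
    integral_const_mul, integral_const_mul, integral_const_mul] at h1
  simpa using h1

omit [IsProbabilityMeasure Q] in
lemma integral_objective_succ_le {t₀ t : ℕ} (ht : t₀ ≤ t) :
    ∫ ω, objective F D (path F α ε ν X₀ U V ξ (t + 1) ω) ∂P ≤
      ∫ ω, objective F D (path F α ε ν X₀ U V ξ t ω) ∂P -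
        5 / 16 * α * ∫ ω, projSq (V (t / ν) ω)
          (gradient (objective F D) (path F α ε ν X₀ U V ξ t₀ ω)) ∂P +
        13 / 16 * α * dim m n * L ^ 2 *
          ∫ ω, ‖path F α ε ν X₀ U V ξ t ω - path F α ε ν X₀ U V ξ t₀ ω‖ ^ 2 ∂P +
        9 * L * α ^ 2 * ρ ^ 2 * dim m n *
          ∫ ω, projNoise F D (V (t / ν) ω) (path F α ε ν X₀ U V ξ t₀ ω) ∂P +
        4 / 5 * α * ρ * L ^ 2 * ε ^ 2 * R * dim m n ^ 2 := by
  set Φ : (Blocks n r × Weights m n × Weights m n) × (Blocks m r × Ξ) → ℝ := fun p =>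
    objective F D (p.1.2.2 - α • lge F ε p.1.2.2 p.2.1 p.1.1 p.2.2) with hΦ
  have hstep : Measurable fun p : (Blocks n r × Weights m n × Weights m n) × (Blocks m r × Ξ) =>
      p.1.2.2 - α • lge F ε p.1.2.2 p.2.1 p.1.1 p.2.2 :=
    (S.measurable_step (r := r) α ε).comp (measurable_fst.snd.snd.prodMk
      (measurable_snd.fst.prodMk (measurable_fst.fst.prodMk measurable_snd.snd)))
  have hΦm : Measurable Φ := S.objective_continuous.measurable.comp hstep
  have hHm : Measurable fun ω => (V (t / ν) ω, path F α ε ν X₀ U V ξ t₀ ω,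
      path F α ε ν X₀ U V ξ t ω) :=
    (s.measurable_V _).prodMk ((s.measurable_path' S t₀).prodMk (s.measurable_path' S t))
  have hWm : Measurable fun ω => (U t ω, ξ t ω) := (s.measurable_U t).prodMk (s.measurable_ξ t)
  obtain ⟨hi, he⟩ := integral_eq_integral_integral_of_indepFun (Φ := Φ) hHm hWm
    (s.indepFun_history S ht (t / ν)) hΦm (s.integrable_objective hQ S h (X₀ := X₀) (t + 1))
  have i0 := s.integrable_objective hQ S h (X₀ := X₀) t
  have i1 := (s.integrable_norm_sub hQ S h (X₀ := X₀) t t₀).const_mul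
    (13 / 16 * α * dim m n * L ^ 2)
  have i2 := (s.integrable_projSq_gradient hQ S h (X₀ := X₀) (t / ν) t₀).const_mul (5 / 16 * α)
  have i3 := (s.integrable_projNoise hQ S h (X₀ := X₀) (t / ν) t₀).const_mul
    (9 * L * α ^ 2 * ρ ^ 2 * dim m n)
  have i4 : Integrable (fun _ : Ω => 4 / 5 * α * ρ * L ^ 2 * ε ^ 2 * R * dim m n ^ 2) P :=
    integrable_const _
  have h1 : ∫ ω, objective F D (path F α ε ν X₀ U V ξ (t + 1) ω) ∂P ≤ _ :=
    he.le.trans (integral_mono_ae hi ((((i0.sub i2).add i1).add i3).add i4) (by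
      filter_upwards [s.ae_isGram hQ (t / ν)] with ω hω
      rw [s.map_prodMk t]
      exact h.integral_objective_le S hω (path F α ε ν X₀ U V ξ t ω)
        (path F α ε ν X₀ U V ξ t₀ ω)))
  rw [integral_add' (((i0.sub i2).add i1).add i3) i4, integral_add' ((i0.sub i2).add i1) i3,
    integral_add' (i0.sub i2) i1, integral_sub' i0 i2,
    integral_const_mul, integral_const_mul, integral_const_mul] at h1
  simpa using h1

end IsSampling

end Path

/-! ### Summation over the blocks -/

/-- Unrolling gives at most s c^s `Z` with c = 1 + 11/(10ν), and c^ν ≤ exp(11/10) independently of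
ν. -/
lemma le_of_drift_recursion {ν : ℕ} (hν : 0 < ν) {y : ℕ → ℝ} {Z : ℝ} (hZ : 0 ≤ Z) (h0 : y 0 = 0)
    (h : ∀ s < ν, y (s + 1) ≤ (1 + 11 / 10 / (ν : ℝ)) * y s + Z) {s : ℕ} (hs : s ≤ ν) :
    y s ≤ 15 / 2 * ν * Z := by
  have hν' : (0 : ℝ) < ν := by exact_mod_cast hν
  set c := 1 + 11 / 10 / (ν : ℝ) with hc
  have hc1 : 1 ≤ c := by rw [hc]; linarith [show (0 : ℝ) ≤ 11 / 10 / ν by positivity]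
  have key : ∀ s ≤ ν, y s ≤ s * c ^ s * Z := by
    intro s
    induction s with
    | zero => intro _; simp [h0]
    | succ s ih =>
      intro hs
      have h1 := h s (by omega)
      have h2 := mul_le_mul_of_nonneg_left (ih (by omega)) (by linarith : 0 ≤ c)
      have h3 : Z ≤ c ^ (s + 1) * Z := le_mul_of_one_le_left hZ (one_le_pow₀ hc1)
      push_cast
      calc y (s + 1) ≤ c * (s * c ^ s * Z) + c ^ (s + 1) * Z := by linarith
        _ = (s + 1) * c ^ (s + 1) * Z := by ring
  have hcν : c ^ ν ≤ 15 / 2 := by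
    have h1 : c ≤ Real.exp (11 / 10 / ν) := by
      rw [hc, add_comm]
      exact Real.add_one_le_exp _
    calc c ^ ν ≤ Real.exp (11 / 10 / ν) ^ ν := pow_le_pow_left₀ (by linarith) h1 ν
      _ = Real.exp (11 / 10) := by
        rw [← Real.exp_nat_mul]
        congr 1
        field_simp
      -- The exponent 11/10 is crudely raised to 2, since 2.72² < 15/2.
      _ ≤ Real.exp 1 ^ 2 := by
        rw [← Real.exp_nat_mul]
        exact Real.exp_le_exp.2 (by norm_num)
      _ ≤ 2.72 ^ 2 := pow_le_pow_left₀ (Real.exp_pos 1).le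
        (Real.exp_one_lt_d9.le.trans (by norm_num)) 2
      _ ≤ 15 / 2 := by norm_num
  have h1 : (s : ℝ) ≤ ν := by exact_mod_cast hs
  have h2 : c ^ s ≤ c ^ ν := pow_le_pow_right₀ hc1 hs
  calc y s ≤ s * c ^ s * Z := key s hs
    _ ≤ ν * (15 / 2) * Z := by
      have : c ^ s ≤ 15 / 2 := h2.trans hcν
      gcongr
    _ = _ := by ring

/-- The accumulated drift carries additional powers of Ldνα, so it is absorbed by enlarging
constants: 5/16 drops to 3/10, the noise factor rises from 9 to 10, and the smoothing factor from
4/5 to 9/10. In the result the noise is replaced by its bound `V`. -/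
lemma step_with_drift {d ν α L ρ R ε y p₀ N V φ φ' Z : ℝ} (hd : 0 < d) (hα : 0 < α) (hL : 0 < L)
    (hν : 1 ≤ ν) (hρ : 1 ≤ ρ) (hR : 0 < R) (hp0 : 0 ≤ p₀) (hN0 : 0 ≤ N) (hNV : N ≤ V)
    (hs : ρ ^ 2 * L * d * ν * α ≤ 1 / 144)
    (hZ : Z = 22 * ρ ^ 2 * α ^ 2 * d * ν * p₀ + 18 * ρ ^ 2 * α ^ 2 * d * N +
      9 * ρ ^ 2 * α ^ 2 * L ^ 2 * ε ^ 2 * R * ν * d ^ 3) (hy : y ≤ 15 / 2 * ν * Z)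
    (h : φ' ≤ φ - 5 / 16 * α * p₀ + 13 / 16 * α * d * L ^ 2 * y +
      9 * L * α ^ 2 * ρ ^ 2 * d * N + 4 / 5 * α * ρ * L ^ 2 * ε ^ 2 * R * d ^ 2) :
    φ' ≤ φ - 3 / 10 * α * p₀ + 10 * ρ ^ 2 * L * α ^ 2 * d * V +
      9 / 10 * α * ρ * L ^ 2 * ε ^ 2 * R * d ^ 2 := by
  have hρ2 : 1 ≤ ρ ^ 2 := one_le_pow₀ hρ
  have hs0 : 0 ≤ L * d * ν * α := by positivity
  have hs1 : L * d * ν * α ≤ 1 / 144 := by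
    refine le_trans ?_ hs
    have : ρ ^ 2 * L * d * ν * α = ρ ^ 2 * (L * d * ν * α) := by ring
    rw [this]
    exact le_mul_of_one_le_left hs0 hρ2
  have hs2 : ρ ^ 2 * (L * d * ν * α) ^ 2 ≤ 1 / 144 ^ 2 := by
    have e : ρ ^ 2 * (L * d * ν * α) ^ 2 = (ρ ^ 2 * L * d * ν * α) * (L * d * ν * α) := by ring
    rw [e]
    calc _ ≤ 1 / 144 * (1 / 144 : ℝ) := mul_le_mul hs hs1 hs0 (by norm_num)
      _ = _ := by norm_num
  have h1 : 13 / 16 * α * d * L ^ 2 * y ≤ 13 / 16 * α * d * L ^ 2 * (15 / 2 * ν * Z) := by gcongr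
  have h2 : 13 / 16 * α * d * L ^ 2 * (15 / 2 * ν * Z) =
      195 / 32 * (22 * (ρ ^ 2 * (L * d * ν * α) ^ 2) * (α * p₀) +
        18 * (L * d * ν * α) * (ρ ^ 2 * L * α ^ 2 * d * N) +
        9 * (ρ ^ 2 * (L * d * ν * α) ^ 2) * (α * L ^ 2 * ε ^ 2 * R * d ^ 2)) := by
    rw [hZ]
    ring
  have c1 : ρ ^ 2 * (L * d * ν * α) ^ 2 * (α * p₀) ≤ 1 / 144 ^ 2 * (α * p₀) := by gcongr
  have c2 : L * d * ν * α * (ρ ^ 2 * L * α ^ 2 * d * N) ≤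
    1 / 144 * (ρ ^ 2 * L * α ^ 2 * d * N) := by gcongr
  have c3 : ρ ^ 2 * (L * d * ν * α) ^ 2 * (α * L ^ 2 * ε ^ 2 * R * d ^ 2) ≤
    1 / 144 ^ 2 * (α * L ^ 2 * ε ^ 2 * R * d ^ 2) := by gcongr
  have c4 : α * L ^ 2 * ε ^ 2 * R * d ^ 2 ≤ ρ * (α * L ^ 2 * ε ^ 2 * R * d ^ 2) :=
    le_mul_of_one_le_left (by positivity) hρ
  have c5 : ρ ^ 2 * L * α ^ 2 * d * N ≤ ρ ^ 2 * L * α ^ 2 * d * V := by gcongr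
  have c6 : 0 ≤ α * p₀ := by positivity
  have c7 : 0 ≤ α * L ^ 2 * ε ^ 2 * R * d ^ 2 := by positivity
  have c8 : 0 ≤ ρ ^ 2 * L * α ^ 2 * d * N := by positivity
  norm_num at c1 c3
  linarith

/-! ### Descent over one block and telescoping. -/

section Main

variable {q : ℕ} {m n r : Fin q → ℕ} {Ξ Ω : Type*} [MeasurableSpace Ξ] [mΩ : MeasurableSpace Ω]
  {F : Weights m n → Ξ → ℝ} {D : Measure Ξ} {L σ α ε R ρ : ℝ} {ν : ℕ}
  {P : Measure Ω} {Q : Measure (Blocks n r)}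
  {U : ℕ → Ω → Blocks m r} {V : ℕ → Ω → Blocks n r} {ξ : ℕ → Ω → Ξ}
  [IsProbabilityMeasure D] [IsProbabilityMeasure P] [IsProbabilityMeasure Q]

lemma IsSampling.block_descent (s : IsSampling P D Q U V ξ) (hQ : IsSubspaceLaw Q)
    (S : IsSmoothStochastic F D L σ) (h : Admissible m n r R ρ L α ε ν) (X₀ : Weights m n)
    (k : ℕ) :
    ∫ ω, objective F D (path F α ε ν X₀ U V ξ ((k + 1) * ν) ω) ∂P ≤
      ∫ ω, objective F D (path F α ε ν X₀ U V ξ (k * ν) ω) ∂P +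
        ν * (-(3 / 10 * α *
          ∫ ω, ‖gradient (objective F D) (path F α ε ν X₀ U V ξ (k * ν) ω)‖ ^ 2 ∂P) +
        10 * ρ ^ 2 * L * α ^ 2 * dim m n * σ ^ 2 +
        9 / 10 * α * ρ * L ^ 2 * ε ^ 2 * R * dim m n ^ 2) := by
  have hν : 0 < ν := by
    have := h.one_le_ν
    exact_mod_cast (by linarith : (0 : ℝ) < ν)
  have hd := h.dim_pos
  have hR := h.ranks.R_pos
  set p₀ := ∫ ω, ‖gradient (objective F D) (path F α ε ν X₀ U V ξ (k * ν) ω)‖ ^ 2 ∂P with hp₀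
  set N := ∫ ω, projNoise F D (V k ω) (path F α ε ν X₀ U V ξ (k * ν) ω) ∂P with hN
  set y : ℕ → ℝ := fun j => ∫ ω, ‖path F α ε ν X₀ U V ξ (k * ν + j) ω -
    path F α ε ν X₀ U V ξ (k * ν) ω‖ ^ 2 ∂P with hy
  set φ : ℕ → ℝ := fun j => ∫ ω, objective F D (path F α ε ν X₀ U V ξ (k * ν + j) ω) ∂P with hφ
  have hp0 : 0 ≤ p₀ := integral_nonneg fun _ => sq_nonneg _
  have hN0 : 0 ≤ N := integral_nonneg fun _ => projNoise_nonneg _ _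
  have hNσ : N ≤ σ ^ 2 := s.integral_projNoise_le hQ S h hν k
  -- All steps of the block share the subspace with index k, so the same projected quantities occur
  -- in each of them.
  have hdiv : ∀ j < ν, (k * ν + j) / ν = k := fun j hj => by
    rw [mul_comm, Nat.mul_add_div hν, Nat.div_eq_of_lt hj, add_zero]
  set Z := 22 * ρ ^ 2 * α ^ 2 * dim m n * ν * p₀ + 18 * ρ ^ 2 * α ^ 2 * dim m n * N +
      9 * ρ ^ 2 * α ^ 2 * L ^ 2 * ε ^ 2 * R * ν * dim m n ^ 3 with hZ
  have hyrec : ∀ j < ν, y (j + 1) ≤ (1 + 11 / 10 / (ν : ℝ)) * y j + Z := by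
    intro j hj
    have h1 := s.integral_norm_sub_succ_le hQ S h (X₀ := X₀) (Nat.le_add_right (k * ν) j)
    rw [hdiv j hj, s.integral_projSq_gradient hQ S h hν k] at h1
    exact h1
  have hφrec : ∀ j < ν, φ (j + 1) ≤ φ j - 3 / 10 * α * p₀ +
      10 * ρ ^ 2 * L * α ^ 2 * dim m n * σ ^ 2 +
      9 / 10 * α * ρ * L ^ 2 * ε ^ 2 * R * dim m n ^ 2 := by
    intro j hj
    have h1 := s.integral_objective_succ_le hQ S h (X₀ := X₀) (Nat.le_add_right (k * ν) j)
    rw [hdiv j hj, s.integral_projSq_gradient hQ S h hν k] at h1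
    exact step_with_drift hd h.α_pos h.L_pos h.one_le_ν h.ranks.one_le hR hp0 hN0 hNσ h.step_le hZ
      (le_of_drift_recursion hν (by positivity) (by simp [hy]) hyrec hj.le) h1
  have hsum : ∀ j ≤ ν, φ j ≤ φ 0 + j * (-(3 / 10 * α * p₀) +
      10 * ρ ^ 2 * L * α ^ 2 * dim m n * σ ^ 2 +
      9 / 10 * α * ρ * L ^ 2 * ε ^ 2 * R * dim m n ^ 2) := by
    intro j
    induction j with
    | zero => intro _; simp
    | succ j ih =>
      intro hj
      have h1 := hφrec j (by omega)
      have h2 := ih (by omega)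
      push_cast
      linarith
  have := hsum ν le_rfl
  simp only [hφ, add_zero] at this
  rw [add_one_mul]
  exact this

/-- The convergence bound with general step sizes. -/
theorem IsSampling.avgGradSqLe (s : IsSampling P D Q U V ξ) (hQ : IsSubspaceLaw Q)
    (S : IsSmoothStochastic F D L σ) (hbdd : BddBelow (Set.range (objective F D)))
    (h : Admissible m n r R ρ L α ε ν) (X₀ : Weights m n) {K : ℕ} (hK : 0 < K) {B : ℝ}
    (hB : 4 * initialGap F D X₀ / (K * ν * α) + 40 * ρ ^ 2 * L * α * dim m n * σ ^ 2 +
        3 * ρ * L ^ 2 * ε ^ 2 * R * dim m n ^ 2 ≤ B) :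
    AvgGradSqLe P F D α ε ν K X₀ U V ξ B := by
  refine ⟨fun k _ => s.integrable_gradient_sq hQ S h (k * ν), le_trans ?_ hB⟩
  have hν : (0 : ℝ) < ν := by linarith [h.one_le_ν]
  have hK' : (0 : ℝ) < K := by exact_mod_cast hK
  have hα := h.α_pos
  have hR := h.ranks.R_pos
  have hρ := h.ranks.one_le
  have hL := h.L_pos
  have hd := h.dim_pos
  set G : ℕ → ℝ := fun k =>
    ∫ ω, ‖gradient (objective F D) (path F α ε ν X₀ U V ξ (k * ν) ω)‖ ^ 2 ∂P with hG
  set c := 10 * ρ ^ 2 * L * α ^ 2 * dim m n * σ ^ 2 +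
      9 / 10 * α * ρ * L ^ 2 * ε ^ 2 * R * dim m n ^ 2 with hc
  set φ : ℕ → ℝ := fun k => ∫ ω, objective F D (path F α ε ν X₀ U V ξ (k * ν) ω) ∂P with hφ
  have hrec : ∀ k, φ (k + 1) ≤ φ k - ν * (3 / 10 * α * G k) + ν * c := fun k => by
    have := s.block_descent hQ S h X₀ k
    simp only [hφ, hc, hG]
    linarith
  have hsum : ∀ k : ℕ, φ k ≤ φ 0 - ν * (3 / 10 * α * ∑ i ∈ Finset.range k, G i) + k * (ν * c) := by
    intro k
    induction k with
    | zero => simp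
    | succ k ih =>
      rw [Finset.sum_range_succ]
      push_cast
      have := hrec k
      linarith
  have h0 : φ 0 = objective F D X₀ := by
    have : ∀ ω, path F α ε ν X₀ U V ξ 0 ω = X₀ := fun _ => rfl
    simp [hφ, this]
  have hinf : ⨅ X, objective F D X ≤ φ K := by
    have h1 : ∫ _ : Ω, (⨅ X, objective F D X) ∂P ≤ φ K :=
      integral_mono (integrable_const _) (s.integrable_objective hQ S h (K * ν))
        fun ω => ciInf_le hbdd _
    simpa using h1
  have hfin := hsum K
  have hgap : initialGap F D X₀ = objective F D X₀ - ⨅ X, objective F D X := rfl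
  have hgap0 : 0 ≤ initialGap F D X₀ := sub_nonneg.2 (ciInf_le hbdd X₀)
  change 1 / (K : ℝ) * ∑ k ∈ Finset.range K, G k ≤ _
  set SG := ∑ k ∈ Finset.range K, G k
  have h1 : ν * (3 / 10 * α * SG) ≤ initialGap F D X₀ + K * (ν * c) := by linarith
  have h2 : 1 / (K : ℝ) * SG = ν * (3 / 10 * α * SG) * (10 / 3 / (K * ν * α)) := by field_simp
  rw [h2]
  calc _ ≤ (initialGap F D X₀ + K * (ν * c)) * (10 / 3 / (K * ν * α)) := by gcongr
    -- The descent coefficient 3/10 produces 10/3 and 100/3, rounded up to 4 and 40 below; the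
    -- smoothing constant is (9/10)(10/3) = 3.
    _ = 10 / 3 * (initialGap F D X₀ / (K * ν * α)) +
        (100 / 3 * (ρ ^ 2 * L * α * dim m n * σ ^ 2) +
          3 * (ρ * L ^ 2 * ε ^ 2 * R * dim m n ^ 2)) := by
      rw [hc]
      field_simp
      ring
    _ ≤ _ := by
      have e1 : 0 ≤ initialGap F D X₀ / (K * ν * α) := by positivity
      have e2 : 0 ≤ ρ ^ 2 * L * α * dim m n * σ ^ 2 := by positivity
      have e3 : 4 * initialGap F D X₀ / (K * ν * α) = 4 * (initialGap F D X₀ / (K * ν * α)) := by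
        ring
      rw [e3]
      linarith

end Main

/-! ### Choice of the step sizes -/

lemma IsSubspaceLaw.rank_le {q : ℕ} {n r : Fin q → ℕ} {Q : Measure (Blocks n r)}
    [IsProbabilityMeasure Q] (hQ : IsSubspaceLaw Q) (hn : ∀ l, 0 < n l) (l : Fin q) :
    r l ≤ n l := by
  obtain ⟨V, hV⟩ := hQ.gram.exists
  exact IsGram.rank_le hV hn l

lemma admissible_one_layer {m n r ν : ℕ} (hm : 0 < m) (hn : 0 < n) (hr : 0 < r) (hν : 0 < ν)
    {L α ε : ℝ} (hL : 0 < L) (hα : 0 < α) (hε : 0 < ε) (hle : α ≤ 1 / (144 * L * m * n * ν)) :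
    Admissible (fun _ : Fin 1 => m) (fun _ : Fin 1 => n) (fun _ : Fin 1 => r) r 1 L α ε ν := by
  have hm' : (0 : ℝ) < m := by exact_mod_cast hm
  have hn' : (0 : ℝ) < n := by exact_mod_cast hn
  have hr' : (0 : ℝ) < r := by exact_mod_cast hr
  have hν' : (0 : ℝ) < ν := by exact_mod_cast hν
  refine ⟨fun _ => hm, ⟨fun _ => hr, fun _ => le_rfl, fun _ => by simp, hr', le_rfl⟩,
    by simp [dim]; positivity, hL, hα, hε, by exact_mod_cast hν, ?_⟩
  rw [le_div_iff₀ (by positivity)] at hle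
  simp only [dim, Finset.univ_unique, Finset.sum_const, Finset.card_singleton, one_smul]
  linarith

/-- There is room in each term: r ≤ n turns m n into m n² / r, and the smoothing term loses the
factor Lmnνα, which is at most 1. -/
lemma one_layer_bound {m n r ν K L σ α ε T Δ : ℝ} (hm : 0 < m) (hn : 0 < n) (hr : 0 < r)
    (hrn : r ≤ n) (hν : 0 < ν) (hK : 0 < K) (hL : 0 < L) (hα : 0 < α) (hT : T = K * ν)
    (hΔ : 0 ≤ Δ) (hle : α ≤ 1 / (144 * L * m * n * ν)) :
    4 * Δ / (K * ν * α) + 40 * 1 ^ 2 * L * α * (m * n) * σ ^ 2 +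
        3 * 1 * L ^ 2 * ε ^ 2 * r * (m * n) ^ 2 ≤
      8 * Δ / (T * α) + 56 * L * m * n ^ 2 * σ ^ 2 * α / r + 16 * L * m * n * r * ε ^ 2 / (ν * α) := by
  subst hT
  have h1 : 4 * Δ / (K * ν * α) ≤ 8 * Δ / (K * ν * α) := by gcongr; norm_num
  have h2 : 40 * 1 ^ 2 * L * α * (m * n) * σ ^ 2 ≤ 56 * L * m * n ^ 2 * σ ^ 2 * α / r := by
    rw [le_div_iff₀ hr]
    have : 0 ≤ L * α * m * n * σ ^ 2 := by positivity
    nlinarith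
  have h3 : 3 * 1 * L ^ 2 * ε ^ 2 * r * (m * n) ^ 2 ≤ 16 * L * m * n * r * ε ^ 2 / (ν * α) := by
    rw [le_div_iff₀ (by positivity)] at hle ⊢
    have h4 : 0 ≤ L * m * n * r * ε ^ 2 := by positivity
    have h5 : L * m * n * ν * α ≤ 1 := by linarith
    calc _ = 3 * (L * m * n * r * ε ^ 2) * (L * m * n * ν * α) := by ring
      _ ≤ 3 * (L * m * n * r * ε ^ 2) * 1 := by gcongr
      _ ≤ _ := by linarith
  linarith

/-- With S the square root in α, the inverse step size contributes 4ΔS/T, while Sα ≤ 1 bounds the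
noise term by 7ΔS/T. The square of ΔS/T is 8/9 of the radicand in the conclusion, so 4 + 7 ≤ 16
suffices; the other terms add up to 576 + 3/16 ≤ 2592. -/
lemma one_layer_tuned_bound {m n r ν K L σ α ε T Δ : ℝ} (hm : 0 < m) (hn : 0 < n) (hr : 0 < r)
    (hrn : r ≤ n) (hν : 0 < ν) (hK : 0 < K) (hL : 0 < L) (hT : T = K * ν)
    (hΔ : 0 < Δ) (hε : ε = Real.sqrt (Δ * ν / (16 * T * L * m * n * r)))
    (hα : α = (144 * L * m * n * ν
      + Real.sqrt (56 * T * L * m * n ^ 2 * σ ^ 2 / (9 * Δ * r)))⁻¹) :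
    4 * Δ / (K * ν * α) + 40 * 1 ^ 2 * L * α * (m * n) * σ ^ 2 +
        3 * 1 * L ^ 2 * ε ^ 2 * r * (m * n) ^ 2 ≤
      16 * Real.sqrt (1 / T * (7 * Δ * L * m * n ^ 2 * σ ^ 2 / r))
        + 2592 * Δ * L * m * n * ν / T := by
  have hT0 : 0 < T := by rw [hT]; positivity
  have hε2 : ε ^ 2 = Δ * ν / (16 * T * L * m * n * r) := by
    rw [hε, Real.sq_sqrt (by positivity)]
  set S := Real.sqrt (56 * T * L * m * n ^ 2 * σ ^ 2 / (9 * Δ * r)) with hS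
  have hS0 : 0 ≤ S := Real.sqrt_nonneg _
  have hS2 : S ^ 2 = 56 * T * L * m * n ^ 2 * σ ^ 2 / (9 * Δ * r) := Real.sq_sqrt (by positivity)
  have hα0 : 0 < α := by rw [hα]; positivity
  have h1 : 4 * Δ / (K * ν * α) = 4 * Δ * (144 * L * m * n * ν) / T + 4 * (Δ * S / T) := by
    rw [← hT, hα]
    field_simp
  have hSα : S * α ≤ 1 := by
    rw [hα, ← div_eq_mul_inv, div_le_one (by positivity)]
    linarith [show 0 ≤ 144 * L * m * n * ν by positivity]
  have h2 : 40 * 1 ^ 2 * L * α * (m * n) * σ ^ 2 ≤ 7 * (Δ * S / T) := by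
    have e1 : L * m * n ^ 2 * σ ^ 2 / r = 9 * Δ * S ^ 2 / (56 * T) := by
      rw [hS2]; field_simp
    calc 40 * 1 ^ 2 * L * α * (m * n) * σ ^ 2 = 40 * α * (L * m * n * r * σ ^ 2 / r) := by
          field_simp
      _ ≤ 40 * α * (L * m * n * n * σ ^ 2 / r) := by gcongr
      _ = 40 * α * (9 * Δ * S ^ 2 / (56 * T)) := by rw [← e1]; ring
      _ = 360 / 56 * (Δ * S / T) * (S * α) := by field_simp; ring
      _ ≤ 360 / 56 * (Δ * S / T) * 1 := by gcongr
      _ ≤ _ := by linarith [show 0 ≤ Δ * S / T by positivity]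
  have h3 : 3 * 1 * L ^ 2 * ε ^ 2 * r * (m * n) ^ 2 = 3 / 16 * (Δ * L * m * n * ν / T) := by
    rw [hε2]; field_simp
  have h4 : Δ * S / T ≤ Real.sqrt (1 / T * (7 * Δ * L * m * n ^ 2 * σ ^ 2 / r)) := by
    refine Real.le_sqrt_of_sq_le ?_
    have e : (Δ * S / T) ^ 2 = 8 / 9 * (1 / T * (7 * Δ * L * m * n ^ 2 * σ ^ 2 / r)) := by
      rw [div_pow, mul_pow, hS2]
      field_simp
      ring
    have h0 : 0 ≤ 1 / T * (7 * Δ * L * m * n ^ 2 * σ ^ 2 / r) := by positivity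
    linarith
  have e5 : 4 * Δ * (144 * L * m * n * ν) / T = 576 * (Δ * L * m * n * ν / T) := by ring
  have e6 : 2592 * Δ * L * m * n * ν / T = 2592 * (Δ * L * m * n * ν / T) := by ring
  have h7 : 0 ≤ Δ * L * m * n * ν / T := by positivity
  have h8 : 0 ≤ Real.sqrt (1 / T * (7 * Δ * L * m * n ^ 2 * σ ^ 2 / r)) := Real.sqrt_nonneg _
  rw [h1, h3, e5, e6]
  linarith

/-- Here ΔS/T equals the target square root exactly, and ε is chosen so that the smoothing term is a
multiple of ΔLdν/T. The constants 576 + 3 and 4 + 40 both fit under 600. -/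
lemma tuned_bound {d dt ρ R ν K L σ α ε T Δ S : ℝ} (hd : 0 < d) (hdt : d ≤ dt) (hR : 0 < R)
    (hν : 0 < ν) (hK : 0 < K) (hL : 0 < L) (hT : T = K * ν) (hΔ : 0 < Δ) (hρ : 1 ≤ ρ)
    (hS : S = Real.sqrt (T * L * dt * σ ^ 2 / Δ))
    (hε : ε = Real.sqrt (Δ * ν / (T * L * R * d)))
    (hα : α = (144 * ρ ^ 2 * L * d * ν + S)⁻¹) :
    4 * Δ / (K * ν * α) + 40 * ρ ^ 2 * L * α * d * σ ^ 2 + 3 * ρ * L ^ 2 * ε ^ 2 * R * d ^ 2 ≤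
      600 * ρ ^ 2 * (Real.sqrt (Δ * L * dt * σ ^ 2 / T) + Δ * L * d * ν / T) := by
  have hdt0 : 0 < dt := hd.trans_le hdt
  have hT0 : 0 < T := by rw [hT]; positivity
  have hε2 : ε ^ 2 = Δ * ν / (T * L * R * d) := by
    rw [hε, Real.sq_sqrt (by positivity)]
  have hS0 : 0 ≤ S := by rw [hS]; exact Real.sqrt_nonneg _
  have hS2 : S ^ 2 = T * L * dt * σ ^ 2 / Δ := by rw [hS]; exact Real.sq_sqrt (by positivity)
  have hα0 : 0 < α := by rw [hα]; positivity
  have hρ2 : 1 ≤ ρ ^ 2 := one_le_pow₀ hρ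
  have h1 : 4 * Δ / (K * ν * α) = 576 * ρ ^ 2 * (Δ * L * d * ν / T) + 4 * (Δ * S / T) := by
    rw [← hT, hα]
    field_simp
    ring
  have hSα : S * α ≤ 1 := by
    rw [hα, ← div_eq_mul_inv, div_le_one (by positivity)]
    linarith [show 0 ≤ 144 * ρ ^ 2 * L * d * ν by positivity]
  have h2 : 40 * ρ ^ 2 * L * α * d * σ ^ 2 ≤ 40 * ρ ^ 2 * (Δ * S / T) := by
    have e1 : L * dt * σ ^ 2 = Δ * S ^ 2 / T := by
      rw [hS2]; field_simp
    calc 40 * ρ ^ 2 * L * α * d * σ ^ 2 ≤ 40 * ρ ^ 2 * L * α * dt * σ ^ 2 := by gcongr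
      _ = 40 * ρ ^ 2 * α * (L * dt * σ ^ 2) := by ring
      _ = 40 * ρ ^ 2 * (Δ * S / T) * (S * α) := by rw [e1]; field_simp
      _ ≤ 40 * ρ ^ 2 * (Δ * S / T) * 1 := by gcongr
      _ = _ := by ring
  have h3 : 3 * ρ * L ^ 2 * ε ^ 2 * R * d ^ 2 = 3 * ρ * (Δ * L * d * ν / T) := by
    rw [hε2]; field_simp
  have h4 : Real.sqrt (Δ * L * dt * σ ^ 2 / T) = Δ * S / T := by
    rw [Real.sqrt_eq_iff_mul_self_eq (by positivity) (by positivity), ← sq, div_pow, mul_pow, hS2]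
    field_simp
  rw [h1, h3, h4]
  have h5 : 0 ≤ Δ * L * d * ν / T := by positivity
  have h6 : 0 ≤ Δ * S / T := by positivity
  have h7 : ρ ≤ ρ ^ 2 := by nlinarith
  have h8 : ρ * (Δ * L * d * ν / T) ≤ ρ ^ 2 * (Δ * L * d * ν / T) := by gcongr
  have h9 : 1 * (Δ * S / T) ≤ ρ ^ 2 * (Δ * S / T) := by gcongr
  have h10 : 0 ≤ ρ ^ 2 * (Δ * L * d * ν / T) := by positivity
  have h11 : 0 ≤ ρ ^ 2 * (Δ * S / T) := by positivity
  linarith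

lemma initialGap_nonneg {q : ℕ} {m n : Fin q → ℕ} {Ξ : Type*} [MeasurableSpace Ξ]
    {F : Weights m n → Ξ → ℝ} {D : Measure Ξ} (h : BddBelow (Set.range (objective F D)))
    (X₀ : Weights m n) : 0 ≤ initialGap F D X₀ :=
  sub_nonneg.2 (ciInf_le h X₀)

/-- Without layers the space of weights is a single point. This excludes q = 0 when the gap is
positive. -/
lemma initialGap_eq_zero {m n : Fin 0 → ℕ} {Ξ : Type*} [MeasurableSpace Ξ]
    (F : Weights m n → Ξ → ℝ) (D : Measure Ξ) (X₀ : Weights m n) : initialGap F D X₀ = 0 := by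
  have h : ∀ X, objective F D X = objective F D X₀ := fun X => by
    rw [show X = X₀ from by ext e; exact e.1.elim0]
  simp [initialGap, h]

lemma dim_le_sum {q : ℕ} {m n r : Fin q → ℕ} (hr : ∀ l, 0 < r l) (hrn : ∀ l, r l ≤ n l) :
    dim m n ≤ ∑ l, (m l : ℝ) * (n l : ℝ) ^ 2 / r l := by
  refine Finset.sum_le_sum fun l _ => ?_
  have h1 : (0 : ℝ) < r l := by exact_mod_cast hr l
  have h2 : (r l : ℝ) ≤ n l := by exact_mod_cast hrn l
  rw [le_div_iff₀ h1, sq, ← mul_assoc]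
  gcongr

end LOZO

end

/-! ### Assembly of the two statements. -/

theorem theorem1 :
    -- One layer, with explicit constants.
    (∀ (m n r ν K : ℕ), 0 < m → 0 < n → 0 < r → 0 < ν → 0 < K →
      ∀ (L σ : ℝ), 0 < L →
      ∀ (Ξ : Type*) [MeasurableSpace Ξ] (D : Measure Ξ) [IsProbabilityMeasure D]
        (F : LOZO.Weights (fun _ : Fin 1 => m) (fun _ : Fin 1 => n) → Ξ → ℝ),
        LOZO.IsSmoothStochastic F D L σ →
        BddBelow (Set.range (LOZO.objective F D)) →
      ∀ (Q : Measure (LOZO.Blocks (fun _ : Fin 1 => n) (fun _ : Fin 1 => r)))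
        [IsProbabilityMeasure Q], LOZO.IsSubspaceLaw Q →
      ∀ (Ω : Type*) [MeasurableSpace Ω] (P : Measure Ω) [IsProbabilityMeasure P]
        (U : ℕ → Ω → LOZO.Blocks (fun _ : Fin 1 => m) (fun _ : Fin 1 => r))
        (V : ℕ → Ω → LOZO.Blocks (fun _ : Fin 1 => n) (fun _ : Fin 1 => r))
        (ξ : ℕ → Ω → Ξ), LOZO.IsSampling P D Q U V ξ →
      ∀ (X₀ : LOZO.Weights (fun _ : Fin 1 => m) (fun _ : Fin 1 => n)) (T Δ₀ : ℝ),
        T = K * ν → Δ₀ = LOZO.initialGap F D X₀ →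
        (∀ α ε : ℝ, 0 < α → 0 < ε → α ≤ 1 / (144 * L * m * n * ν) →
          LOZO.AvgGradSqLe P F D α ε ν K X₀ U V ξ
            (8 * Δ₀ / (T * α) + 56 * L * m * n ^ 2 * σ ^ 2 * α / r
              + 16 * L * m * n * r * ε ^ 2 / (ν * α))) ∧
        (0 < Δ₀ → ∀ α ε : ℝ,
          ε = Real.sqrt (Δ₀ * ν / (16 * T * L * m * n * r)) →
          α = (144 * L * m * n * ν
            + Real.sqrt (56 * T * L * m * n ^ 2 * σ ^ 2 / (9 * Δ₀ * r)))⁻¹ →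
          LOZO.AvgGradSqLe P F D α ε ν K X₀ U V ξ
            (16 * Real.sqrt (1 / T * (7 * Δ₀ * L * m * n ^ 2 * σ ^ 2 / r))
              + 2592 * Δ₀ * L * m * n * ν / T))) ∧
    -- Any number of layers; the constant depends only on a bound for the ratios of the ranks.
    (∀ ρ : ℝ, ∃ C : ℝ, 0 < C ∧
      ∀ (q : ℕ) (m n r : Fin q → ℕ) (ν K : ℕ),
        (∀ l, 0 < m l) → (∀ l, 0 < n l) → (∀ l, 0 < r l) → 0 < ν → 0 < K →
        (∀ l l', (r l : ℝ) ≤ ρ * r l') →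
      ∀ (L σ Δ₀ T : ℝ), 0 < L → 0 < Δ₀ → T = K * ν →
      ∃ α ε : ℝ, 0 < α ∧ 0 < ε ∧
      ∀ (Ξ : Type*) [MeasurableSpace Ξ] (D : Measure Ξ) [IsProbabilityMeasure D]
        (F : LOZO.Weights m n → Ξ → ℝ),
        LOZO.IsSmoothStochastic F D L σ →
        BddBelow (Set.range (LOZO.objective F D)) →
      ∀ (Q : Measure (LOZO.Blocks n r)) [IsProbabilityMeasure Q], LOZO.IsSubspaceLaw Q →
      ∀ (Ω : Type*) [MeasurableSpace Ω] (P : Measure Ω) [IsProbabilityMeasure P]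
        (U : ℕ → Ω → LOZO.Blocks m r) (V : ℕ → Ω → LOZO.Blocks n r) (ξ : ℕ → Ω → Ξ),
        LOZO.IsSampling P D Q U V ξ →
      ∀ X₀ : LOZO.Weights m n, Δ₀ = LOZO.initialGap F D X₀ →
        LOZO.AvgGradSqLe P F D α ε ν K X₀ U V ξ
          (C * (Real.sqrt (Δ₀ * L * (∑ l, (m l : ℝ) * (n l : ℝ) ^ 2 / r l) * σ ^ 2 / T)
            + Δ₀ * L * (∑ l, (m l : ℝ) * (n l : ℝ)) * ν / T))) := by
  refine ⟨?_, ?_⟩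
  · intro m n r ν K hm hn hr hν hK L σ hL Ξ _ D _ F S hbdd Q _ hQ Ω _ P _ U V ξ s X₀ T Δ₀ hT hΔ
    have hm' : (0 : ℝ) < m := by exact_mod_cast hm
    have hn' : (0 : ℝ) < n := by exact_mod_cast hn
    have hr' : (0 : ℝ) < r := by exact_mod_cast hr
    have hν' : (0 : ℝ) < ν := by exact_mod_cast hν
    have hK' : (0 : ℝ) < K := by exact_mod_cast hK
    have hrn : (r : ℝ) ≤ n := by exact_mod_cast hQ.rank_le (fun _ => hn) 0
    have hdim : LOZO.dim (fun _ : Fin 1 => m) (fun _ : Fin 1 => n) = m * n := by simp [LOZO.dim]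
    have hΔ0 : 0 ≤ Δ₀ := hΔ ▸ LOZO.initialGap_nonneg hbdd X₀
    refine ⟨fun α ε hα hε hle => ?_, fun hΔpos α ε hε hα => ?_⟩
    · refine s.avgGradSqLe hQ S hbdd (LOZO.admissible_one_layer hm hn hr hν hL hα hε hle) X₀ hK ?_
      rw [hdim, ← hΔ]
      exact LOZO.one_layer_bound hm' hn' hr' hrn hν' hK' hL hα hT hΔ0 hle
    · have hT0 : 0 < T := by rw [hT]; positivity
      have hα0 : 0 < α := by rw [hα]; positivity
      have hε0 : 0 < ε := by rw [hε]; exact Real.sqrt_pos.2 (by positivity)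
      have hle : α ≤ 1 / (144 * L * m * n * ν) := by
        rw [hα, ← one_div]
        exact one_div_le_one_div_of_le (by positivity)
          (le_add_of_nonneg_right (Real.sqrt_nonneg _))
      refine s.avgGradSqLe hQ S hbdd (LOZO.admissible_one_layer hm hn hr hν hL hα0 hε0 hle) X₀ hK ?_
      rw [hdim, ← hΔ]
      exact LOZO.one_layer_tuned_bound hm' hn' hr' hrn hν' hK' hL hT hΔpos hε hα
  · intro ρ
    -- The general bound is applied with ρ² in place of ρ; adding 1 keeps the constant positive even
    -- for ρ = 0.
    refine ⟨600 * (ρ ^ 2) ^ 2 + 1, by positivity, ?_⟩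
    intro q m n r ν K hm hn hr hν hK hρ L σ Δ₀ T hL hΔpos hT
    -- A layer is needed to deduce ρ ≥ 1 and d > 0; with no layers any step sizes will do, since the
    -- gap vanishes.
    rcases Nat.eq_zero_or_pos q with rfl | hq
    · refine ⟨1, 1, one_pos, one_pos, ?_⟩
      intro Ξ _ D _ F S hbdd Q _ hQ Ω _ P _ U V ξ s X₀ hΔ
      rw [LOZO.initialGap_eq_zero] at hΔ
      exact absurd hΔ hΔpos.ne'
    have hν' : (0 : ℝ) < ν := by exact_mod_cast hν
    have hK' : (0 : ℝ) < K := by exact_mod_cast hK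
    have hT0 : 0 < T := by rw [hT]; positivity
    have hr' : ∀ l, (0 : ℝ) < r l := fun l => by exact_mod_cast hr l
    set l₀ : Fin q := ⟨0, hq⟩ with hl₀
    have hρ1 : 1 ≤ ρ := by
      have := hρ l₀ l₀
      exact le_of_mul_le_mul_right (by linarith) (hr' l₀)
    have hρ2 : 1 ≤ ρ ^ 2 := one_le_pow₀ hρ1
    have hR : 0 < ρ * r l₀ := by have := hr' l₀; positivity
    have hd : 0 < LOZO.dim m n := by
      have : Nonempty (Fin q) := ⟨l₀⟩
      refine Finset.sum_pos (fun l _ => ?_) Finset.univ_nonempty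
      have h1 : (0 : ℝ) < m l := by exact_mod_cast hm l
      have h2 : (0 : ℝ) < n l := by exact_mod_cast hn l
      positivity
    -- The first layer serves as reference: R = ρ r_{l₀} bounds every rank from above, and comparing
    -- back costs another factor ρ, hence the ratio ρ².
    have hranks : LOZO.RankBounds r (ρ * r l₀) (ρ ^ 2) :=
      ⟨hr, fun l => hρ l l₀, fun l => by
        rw [sq, mul_assoc]
        exact mul_le_mul_of_nonneg_left (hρ l₀ l) (by linarith), hR, hρ2⟩
    set S₀ := Real.sqrt (T * L * (∑ l, (m l : ℝ) * (n l : ℝ) ^ 2 / r l) * σ ^ 2 / Δ₀) with hS₀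
    have hS₀0 : 0 ≤ S₀ := Real.sqrt_nonneg _
    have hα0 : 0 < (144 * (ρ ^ 2) ^ 2 * L * LOZO.dim m n * ν + S₀)⁻¹ := by positivity
    refine ⟨(144 * (ρ ^ 2) ^ 2 * L * LOZO.dim m n * ν + S₀)⁻¹,
      Real.sqrt (Δ₀ * ν / (T * L * (ρ * r l₀) * LOZO.dim m n)), hα0,
      Real.sqrt_pos.2 (by positivity), ?_⟩
    intro Ξ _ D _ F S hbdd Q _ hQ Ω _ P _ U V ξ s X₀ hΔ
    have hadm : LOZO.Admissible m n r (ρ * r l₀) (ρ ^ 2) L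
        (144 * (ρ ^ 2) ^ 2 * L * LOZO.dim m n * ν + S₀)⁻¹
        (Real.sqrt (Δ₀ * ν / (T * L * (ρ * r l₀) * LOZO.dim m n))) ν := by
      refine ⟨hm, hranks, hd, hL, hα0, Real.sqrt_pos.2 (by positivity), by exact_mod_cast hν, ?_⟩
      rw [← div_eq_mul_inv, div_le_div_iff₀ (by positivity) (by norm_num)]
      linarith
    refine s.avgGradSqLe hQ S hbdd hadm X₀ hK ?_
    rw [← hΔ]
    -- The inequality r ≤ n comes from the law of V, which is introduced only after α and ε have
    -- been chosen; it enters only here, to compare d with ∑ m n² / r.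
    refine (LOZO.tuned_bound hd (LOZO.dim_le_sum hr (hQ.rank_le hn)) hR hν' hK' hL hT hΔpos hρ2
      hS₀ rfl rfl).trans ?_
    refine mul_le_mul_of_nonneg_right (by linarith) ?_
    have h1 : 0 ≤ Δ₀ * L * LOZO.dim m n * ν / T := by positivity
    exact add_nonneg (Real.sqrt_nonneg _) h1
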